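/- **Theorem (thirty nonvanishing local adapted d-curvatures).** *Setting.* Let $(M,F)$ and $(N,\widetilde F)$ be Finsler manifolds of dimensions $p$ and $n$ ($F\ge 0$ is smooth on $TM\setminus\{0\}$, positively homogeneous of degree one on the fibres, with positive definite $g_{\alpha\beta}=\frac12\partial^2F^2/\partial s^\alpha\partial s^\beta$; similarly $\widetilde F$). Fix charts of $M$ and $N$, with induced coordinates $(t^\alpha,s^a)$ on $TM$, $(x^i,y^i)$ on $TN$; $\alpha,\beta,\dots$ and $a,b,\dots$ run over $1,\dots,p$, and $i,j,\dots$ over $1,\dots,n$; repeated indices are summed. On $TM\setminus\{0\}$ put $C_{\alpha\beta\gamma}=\frac12\partial g_{\alpha\beta}/\partial s^\gamma$, $C^\gamma_{\alpha\beta}=g^{\gamma\mu}C_{\mu\alpha\beta}$, $$\gamma^\mu_{\alpha\beta}=\tfrac12 g^{\mu\varepsilon}\Big(\frac{\partial g_{\varepsilon\alpha}}{\partial t^\beta}+\frac{\partial g_{\varepsilon\beta}}{\partial t^\alpha}-\frac{\partial g_{\alpha\beta}}{\partial t^\varepsilon}\Big),\quad N^\beta_\alpha=\gamma^\beta_{\alpha\varepsilon}s^\varepsilon-C^\beta_{\alpha\varepsilon}\gamma^\varepsilon_{\mu\nu}s^\mu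 s^\nu,\quad \frac{\delta}{\delta t^\alpha}=\frac{\partial}{\partial t^\alpha}-N^\varepsilon_\alpha\frac{\partial}{\partial s^\varepsilon},$$ $$\Gamma^\gamma_{\alpha\beta}=\tfrac12 g^{\gamma\mu}\Big(\frac{\delta g_{\mu\alpha}}{\delta t^\beta}+\frac{\delta g_{\mu\beta}}{\delta t^\alpha}-\frac{\delta g_{\alpha\beta}}{\delta t^\mu}\Big),\quad C^\gamma_{\alpha\beta|\mu}=\frac{\delta C^\gamma_{\alpha\beta}}{\delta t^\mu}+C^\varepsilon_{\alpha\beta}\Gamma^\gamma_{\varepsilon\mu}-C^\gamma_{\varepsilon\beta}\Gamma^\varepsilon_{\alpha\mu}-C^\gamma_{\alpha\varepsilon}\Gamma^\varepsilon_{\beta\mu},$$ $$B^\gamma_{\alpha\beta}=\Gamma^\gamma_{\alpha\beta}+C^\gamma_{\alpha\beta|\mu}s^\mu,\quad \mathcal P^\alpha_{\beta\gamma\varepsilon}=\frac{\partial B^\alpha_{\beta\gamma}}{\partial s^\varepsilon},\quad \mathcal R^\alpha_{\beta\gamma\varepsilon}=\frac{\delta B^\alpha_{\beta\gamma}}{\delta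 t^\varepsilon}-\frac{\delta B^\alpha_{\beta\varepsilon}}{\delta t^\gamma}+B^\mu_{\beta\gamma}B^\alpha_{\mu\varepsilon}-B^\mu_{\beta\varepsilon}B^\alpha_{\mu\gamma},$$ $$N^c_{\alpha:\beta}=\frac{\partial N^c_\alpha}{\partial t^\beta}+N^d_\alpha B^c_{d\beta}-N^c_\gamma B^\gamma_{\alpha\beta}.$$ The same objects of $(N,\widetilde F)$ carry a tilde. The Berwald connection $\nabla$ on $TM\setminus\{0\}$ is given by $\nabla_{\delta/\delta t^\beta}\frac{\delta}{\delta t^\alpha}=B^\gamma_{\alpha\beta}\frac{\delta}{\delta t^\gamma}$, $\nabla_{\delta/\delta t^\beta}\frac{\partial}{\partial s^a}=B^c_{a\beta}\frac{\partial}{\partial s^c}$, $\nabla_{\partial/\partial s^b}\frac{\delta}{\delta t^\alpha}=\nabla_{\partial/\partial s^b}\frac{\partial}{\partial s^a}=0$. Write $A=(\alpha,a)$, $(T^A)=(t^\alpha,s^a)$, and $\nabla_{\partial/\partial T^B}\frac{\partial}{\partial T^A}={}^b\Gamma^C_{AB}\frac{\partial}{\partial T^C}$. On $J^1(TM,N)$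 take the induced coordinates $(T^A,x^i,X^i_A)$, $(X^i_A)=(x^i_\alpha,y^i_a)$, restricted to the points with $s\ne0$ and $(y^i_as^a)_i\neq 0$. All tilde objects are evaluated at $(x^l,y^l_as^a)$. The jet adapted frame is $$\frac{\delta^J}{\delta T^A}=\frac{\partial}{\partial T^A}+{}^b\Gamma^C_{AB}X^j_C\frac{\partial}{\partial X^j_B},\qquad \frac{\delta^J}{\delta x^i}=\frac{\partial}{\partial x^i}-\widetilde B^j_{ik}X^k_B\frac{\partial}{\partial X^j_B},\qquad \frac{\partial}{\partial X^i_A}.$$ The jet Berwald linear d-connection $B\Gamma^b_{jet}$ is the linear connection $D$ with $$D_{\delta^J/\delta T^C}\frac{\delta^J}{\delta T^B}={}^b\Gamma^A_{BC}\frac{\delta^J}{\delta T^A},\quad D_{\delta^J/\delta T^C}\frac{\partial}{\partial X^i_B}=-{}^b\Gamma^B_{CA}\frac{\partial}{\partial X^i_A},\quad D_{\delta^J/\delta x^j}\frac{\delta^J}{\delta x^i}=\widetilde B^k_{ij}\frac{\delta^J}{\delta x^k},\quad D_{\delta^J/\delta x^k}\frac{\partial}{\partial X^j_A}=\widetilde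 B^i_{jk}\frac{\partial}{\partial X^i_A},$$ and all other covariant derivatives of frame vectors along frame vectors zero. With $R(X,Y)Z=D_XD_YZ-D_YD_XZ-D_{[X,Y]}Z$, its adapted d-curvatures are the components $R(e_c,e_b)e_a=R^{\,d}_{a\,b\,c}\,e_d$ in the adapted frame, written as follows: the index of $\delta^J/\delta t^\alpha,\delta^J/\delta s^a,\delta^J/\delta x^i$ is $\alpha,a,i$ ($\overline R$ when $d$ and $a$ are both of the first two kinds); in $R^{(l)(A)}_{(D)(i)bc}$ one has $e_a=\partial/\partial X^i_A$ and $e_d=\partial/\partial X^l_D$; and $P^{\,l\ (c)}_{ij(k)}$, $P^{(l)(A)\ (c)}_{(D)(i)j(k)}$ are the components with $e_b=\delta^J/\delta x^j$ and $e_c=\partial/\partial y^k_c$. *Claim.* For all $(M,F)$, $(N,\widetilde F)$ and all charts, at every such point (with $\mathcal A_{\{\beta,\gamma\}}[Z_{\beta\gamma}]=Z_{\beta\gamma}-Z_{\gamma\beta}$): (C1) $\overline R^\delta_{\alpha\beta\gamma}=\mathcal R^\delta_{\alpha\beta\gamma}+\mathcal P^\delta_{\alpha\beta c}N^c_\gamma-\mathcal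 P^\delta_{\alpha\gamma c}N^c_\beta$; (C2) $\overline R^d_{\alpha\beta\gamma}=\mathcal A_{\{\beta,\gamma\}}\big[\frac{\partial N^d_{\alpha:\beta}}{\partial t^\gamma}+N^c_{\alpha:\beta}B^d_{c\gamma}-N^d_{\mu:\beta}B^\mu_{\alpha\gamma}\big]$; (C3) $\overline R^\delta_{\alpha\beta c}=\mathcal P^\delta_{\alpha\beta c}$; (C4) $\overline R^d_{\alpha\beta c}=\frac{\partial N^d_{\alpha:\beta}}{\partial s^c}-\frac{\partial B^d_{\alpha c}}{\partial t^\beta}+B^\mu_{\alpha\beta}B^d_{\mu c}-B^f_{\alpha c}B^d_{f\beta}$; (C5) $\overline R^\delta_{\alpha b\gamma}=-\mathcal P^\delta_{\alpha b\gamma}$; (C6) $\overline R^d_{\alpha b\gamma}=\frac{\partial B^d_{\alpha b}}{\partial t^\gamma}-\frac{\partial N^d_{\alpha:\gamma}}{\partial s^b}+B^c_{\alpha b}B^d_{c\gamma}-B^\mu_{\alpha\gamma}B^d_{\mu b}$; (C7) $\overline R^d_{a\beta\gamma}=\mathcal R^d_{a\beta\gamma}+\mathcal P^d_{a\beta c}N^c_\gamma-\mathcal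 P^d_{a\gamma c}N^c_\beta$; (C8) $\overline R^d_{a\beta c}=\mathcal P^d_{a\beta c}$; (C9) $\overline R^d_{ab\gamma}=-\mathcal P^d_{ab\gamma}$; (C10) $R^l_{i\beta k}=-\widetilde{\mathcal P}^l_{ikj}B^c_{\beta a}s^ay^j_c$; (C11) $R^l_{ibk}=-\widetilde{\mathcal P}^l_{ikj}y^j_b$; (C12) $R^l_{ijk}=\widetilde{\mathcal R}^l_{ijk}+\widetilde{\mathcal P}^l_{ijr}\widetilde N^r_k-\widetilde{\mathcal P}^l_{ikr}\widetilde N^r_j+\big[\widetilde{\mathcal P}^l_{ikr}\widetilde B^r_{jq}-\widetilde{\mathcal P}^l_{ijr}\widetilde B^r_{kq}\big]y^q_bs^b$; (C13) $P^{\,l\ (c)}_{ij(k)}=\widetilde{\mathcal P}^l_{ijk}s^c$; (C14) $R^{(l)(\alpha)}_{(\varepsilon)(i)\beta\gamma}=-\delta^l_i\big[\mathcal R^\alpha_{\varepsilon\beta\gamma}+\mathcal P^\alpha_{\varepsilon\beta c}N^c_\gamma-\mathcal P^\alpha_{\varepsilon\gamma c}N^c_\beta\big]=-\delta^l_i\overline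 R^\alpha_{\varepsilon\beta\gamma}$; (C15) $R^{(l)(\alpha)}_{(\varepsilon)(i)\beta c}=-\delta^l_i\mathcal P^\alpha_{\varepsilon\beta c}=-\delta^l_i\overline R^\alpha_{\varepsilon\beta c}$; (C16) $R^{(l)(\alpha)}_{(\varepsilon)(i)b\gamma}=\delta^l_i\mathcal P^\alpha_{\varepsilon b\gamma}=-\delta^l_i\overline R^\alpha_{\varepsilon b\gamma}$; (C17) $R^{(l)(a)}_{(\varepsilon)(i)\beta\gamma}=-\delta^l_i\mathcal A_{\{\beta,\gamma\}}\big[\frac{\partial N^a_{\beta:\varepsilon}}{\partial t^\gamma}+N^c_{\beta:\varepsilon}B^a_{c\gamma}-N^a_{\beta:\mu}B^\mu_{\varepsilon\gamma}\big]$; (C18) $R^{(l)(a)}_{(\varepsilon)(i)\beta c}=-\delta^l_i\big[\frac{\partial N^a_{\beta:\varepsilon}}{\partial s^c}-\frac{\partial B^a_{c\varepsilon}}{\partial t^\beta}+B^\mu_{\beta\varepsilon}B^a_{\mu c}-B^d_{c\varepsilon}B^a_{d\beta}\big]$; (C19) $R^{(l)(a)}_{(\varepsilon)(i)b\gamma}=-\delta^l_i\big[\frac{\partial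 B^a_{b\varepsilon}}{\partial t^\gamma}-\frac{\partial N^a_{\gamma:\varepsilon}}{\partial s^b}+B^c_{b\varepsilon}B^a_{c\gamma}-B^\mu_{\gamma\varepsilon}B^a_{\mu b}\big]$; (C20) $R^{(l)(a)}_{(d)(i)\beta\gamma}=-\delta^l_i\big[\mathcal R^a_{d\beta\gamma}+\mathcal P^a_{d\beta c}N^c_\gamma-\mathcal P^a_{d\gamma c}N^c_\beta\big]=-\delta^l_i\overline R^a_{d\beta\gamma}$; (C21) $R^{(l)(a)}_{(d)(i)\beta c}=-\delta^l_i\mathcal P^a_{d\beta c}=-\delta^l_i\overline R^a_{d\beta c}$; (C22) $R^{(l)(a)}_{(d)(i)b\gamma}=\delta^l_i\mathcal P^a_{db\gamma}=-\delta^l_i\overline R^a_{db\gamma}$; (C23) $R^{(l)(\alpha)}_{(\varepsilon)(i)\beta k}=-\delta^\alpha_\varepsilon\widetilde{\mathcal P}^l_{ikj}B^c_{\beta b}s^by^j_c=\delta^\alpha_\varepsilon R^l_{i\beta k}$; (C24) $R^{(l)(\alpha)}_{(\varepsilon)(i)bk}=-\delta^\alpha_\varepsilon\widetilde{\mathcal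 P}^l_{ikj}y^j_b=\delta^\alpha_\varepsilon R^l_{ibk}$; (C25) $R^{(l)(a)}_{(d)(i)\beta k}=-\delta^a_d\widetilde{\mathcal P}^l_{ikj}B^c_{\beta b}s^by^j_c=\delta^a_dR^l_{i\beta k}$; (C26) $R^{(l)(a)}_{(d)(i)bk}=-\delta^a_d\widetilde{\mathcal P}^l_{ikj}y^j_b=\delta^a_dR^l_{ibk}$; (C27) $R^{(l)(\alpha)}_{(\varepsilon)(i)jk}=\delta^\alpha_\varepsilon R^l_{ijk}$; (C28) $R^{(l)(a)}_{(d)(i)jk}=\delta^a_dR^l_{ijk}$; (C29) $P^{(l)(\alpha)\ (c)}_{(\varepsilon)(i)j(k)}=\delta^\alpha_\varepsilon\widetilde{\mathcal P}^l_{ijk}s^c=\delta^\alpha_\varepsilon P^{\,l\ (c)}_{ij(k)}$; (C30) $P^{(l)(a)\ (c)}_{(d)(i)j(k)}=\delta^a_d\widetilde{\mathcal P}^l_{ijk}s^c=\delta^a_dP^{\,l\ (c)}_{ij(k)}$. Every component $R^{\,d}_{a\,b\,c}$ vanishes if neither it nor $R^{\,d}_{a\,c\,b}$ is of one of these thirty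 types (a type being given by the kinds $t,s,x,x_\alpha,y_a$ of the four indices). None of the thirty types vanishes identically: for each of them there are Finsler manifolds $(M,F)$, $(N,\widetilde F)$, charts and a point at which some component of this type is not zero. -/

import Mathlib

open scoped Manifold ContDiff

noncomputable section

namespace JetBerwald

/-! ### Partial derivatives, moving frames and linear connections on a coordinate space -/

section Frames

variable {ι : Type} [Fintype ι] [DecidableEq ι]

/-- The partial derivative of `f` in the `i`-th coordinate. -/
def pd (i : ι) (f : (ι → ℝ) → ℝ) (z : ι → ℝ) : ℝ :=
  fderiv ℝ f z (Pi.single i 1)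

/-- The matrix whose `i`-th column is the frame vector `e i` at `z`. -/
def frameMatrix (e : ι → (ι → ℝ) → (ι → ℝ)) (z : ι → ℝ) : Matrix ι ι ℝ :=
  Matrix.of fun k i => e i z k

/-- The `k`-th component of the vector field `V` in the frame `e`. -/
def frameComp (e : ι → (ι → ℝ) → (ι → ℝ)) (V : (ι → ℝ) → (ι → ℝ)) (k : ι) (z : ι → ℝ) : ℝ :=
  ((frameMatrix e z)⁻¹).mulVec (V z) k

/-- The covariant derivative `∇_X Y` of the linear connection that is given in the frame `e` by
`∇_{e j} (e i) = ∑ k, κ k i j • e k`. -/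
def covDeriv (e : ι → (ι → ℝ) → (ι → ℝ)) (κ : ι → ι → ι → (ι → ℝ) → ℝ)
    (X Y : (ι → ℝ) → (ι → ℝ)) (z : ι → ℝ) : ι → ℝ :=
  ∑ k, (fderiv ℝ (frameComp e Y k) z (X z)
    + ∑ i, ∑ j, κ k i j z * frameComp e Y i z * frameComp e X j z) • e k z

/-- The curvature `R(X, Y) Z = ∇_X ∇_Y Z - ∇_Y ∇_X Z - ∇_{[X, Y]} Z`. -/
def curvature (e : ι → (ι → ℝ) → (ι → ℝ)) (κ : ι → ι → ι → (ι → ℝ) → ℝ)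
    (X Y Z : (ι → ℝ) → (ι → ℝ)) (z : ι → ℝ) : ι → ℝ :=
  covDeriv e κ X (covDeriv e κ Y Z) z - covDeriv e κ Y (covDeriv e κ X Z) z
    - covDeriv e κ (VectorField.lieBracket ℝ X Y) Z z

/-- The component `R^d_{a b c}` of the curvature in the frame `e`:
`R(e c, e b) (e a) = ∑ d, R^d_{a b c} • e d`. -/
def curvComp (e : ι → (ι → ℝ) → (ι → ℝ)) (κ : ι → ι → ι → (ι → ℝ) → ℝ)
    (d a b c : ι) (z : ι → ℝ) : ℝ :=
  frameComp e (curvature e κ (e c) (e b) (e a)) d z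

end Frames

/-- The alternate sum of `X` in its two indices. -/
def alt {p : ℕ} (X : Fin p → Fin p → ℝ) (β γ : Fin p) : ℝ := X β γ - X γ β

/-! ### Local Finsler geometry

Points of the coordinate domain of `TM` are functions `z : Fin p ⊕ Fin p → ℝ`, with
`z (inl α) = t^α` and `z (inr a) = s^a`; `f` is the Finsler function in these coordinates.
In all components the upper index comes first. -/

section Local

open Sum

variable {p : ℕ}

/-- Index of a coordinate on the tangent bundle: `A = (α, a)`. -/
abbrev TIdx (p : ℕ) : Type := Fin p ⊕ Fin p

/-- The fundamental metrical d-tensor `g_{αβ} = (1/2) ∂²F²/∂s^α∂s^β`. -/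
def metric (f : (TIdx p → ℝ) → ℝ) (α β : Fin p) (z : TIdx p → ℝ) : ℝ :=
  (1 / 2) * pd (inr α) (pd (inr β) (fun z' => f z' ^ 2)) z

/-- The inverse matrix `g^{αβ}`. -/
def metricInv (f : (TIdx p → ℝ) → ℝ) (α β : Fin p) (z : TIdx p → ℝ) : ℝ :=
  (Matrix.of fun α' β' => metric f α' β' z)⁻¹ α β

/-- The Cartan d-tensor `C_{αβγ}`. -/
def cartan (f : (TIdx p → ℝ) → ℝ) (α β γ : Fin p) (z : TIdx p → ℝ) : ℝ :=
  (1 / 2) * pd (inr γ) (metric f α β) z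

/-- `C^β_{αε} = g^{βl} C_{lαε}`. -/
def cartanUp (f : (TIdx p → ℝ) → ℝ) (β α ε : Fin p) (z : TIdx p → ℝ) : ℝ :=
  ∑ l, metricInv f β l z * cartan f l α ε z

/-- The formal Christoffel symbols `γ^μ_{αβ}`. -/
def formalChr (f : (TIdx p → ℝ) → ℝ) (μ α β : Fin p) (z : TIdx p → ℝ) : ℝ :=
  ∑ ε, metricInv f μ ε z / 2 *
    (pd (inl β) (metric f ε α) z + pd (inl α) (metric f ε β) z - pd (inl ε) (metric f α β) z)

/-- The nonlinear Cartan connection `N^β_α`. -/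
def nonlin (f : (TIdx p → ℝ) → ℝ) (β α : Fin p) (z : TIdx p → ℝ) : ℝ :=
  ∑ ε, formalChr f β α ε z * z (inr ε)
    - ∑ ε, ∑ μ, ∑ ν, cartanUp f β α ε z * formalChr f ε μ ν z * z (inr μ) * z (inr ν)

/-- The derivation `δ/δt^α = ∂/∂t^α - N^ε_α ∂/∂s^ε`. -/
def hder (f : (TIdx p → ℝ) → ℝ) (α : Fin p) (u : (TIdx p → ℝ) → ℝ) (z : TIdx p → ℝ) : ℝ :=
  pd (inl α) u z - ∑ ε, nonlin f ε α z * pd (inr ε) u z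

/-- The generalized Christoffel symbols `Γ^γ_{αβ}` (the Rund, or Chern, connection). -/
def rund (f : (TIdx p → ℝ) → ℝ) (γ α β : Fin p) (z : TIdx p → ℝ) : ℝ :=
  ∑ μ, metricInv f γ μ z / 2 *
    (hder f β (metric f μ α) z + hder f α (metric f μ β) z - hder f μ (metric f α β) z)

/-- The horizontal covariant derivative `C^γ_{αβ|μ}` produced by the Rund connection. -/
def cartanCov (f : (TIdx p → ℝ) → ℝ) (γ α β μ : Fin p) (z : TIdx p → ℝ) : ℝ :=
  hder f μ (cartanUp f γ α β) z + ∑ ε, cartanUp f ε α β z * rund f γ ε μ z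
    - ∑ ε, cartanUp f γ ε β z * rund f ε α μ z - ∑ ε, cartanUp f γ α ε z * rund f ε β μ z

/-- The Berwald components `B^γ_{αβ} = Γ^γ_{αβ} + C^γ_{αβ|μ} s^μ`. -/
def berwald (f : (TIdx p → ℝ) → ℝ) (γ α β : Fin p) (z : TIdx p → ℝ) : ℝ :=
  rund f γ α β z + ∑ μ, cartanCov f γ α β μ z * z (inr μ)

/-- The Berwald curvature `R^α_{βγε}`. -/
def berwaldR (f : (TIdx p → ℝ) → ℝ) (α β γ ε : Fin p) (z : TIdx p → ℝ) : ℝ :=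
  hder f ε (berwald f α β γ) z - hder f γ (berwald f α β ε) z
    + ∑ μ, berwald f μ β γ z * berwald f α μ ε z - ∑ μ, berwald f μ β ε z * berwald f α μ γ z

/-- The Berwald curvature `P^α_{βγε} = ∂B^α_{βγ}/∂s^ε`. -/
def berwaldP (f : (TIdx p → ℝ) → ℝ) (α β γ ε : Fin p) (z : TIdx p → ℝ) : ℝ :=
  pd (inr ε) (berwald f α β γ) z

/-- `N^c_{α:β} = ∂N^c_α/∂t^β + N^d_α B^c_{dβ} - N^c_γ B^γ_{αβ}`. -/
def nonlinCov (f : (TIdx p → ℝ) → ℝ) (c α β : Fin p) (z : TIdx p → ℝ) : ℝ :=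
  pd (inl β) (nonlin f c α) z + ∑ d, nonlin f d α z * berwald f c d β z
    - ∑ γ, nonlin f c γ z * berwald f γ α β z

/-- The adapted frame `δ/δt^α = ∂/∂t^α - N^b_α ∂/∂s^b`, `∂/∂s^a` of the tangent bundle. -/
def adaptedFrame (f : (TIdx p → ℝ) → ℝ) : TIdx p → (TIdx p → ℝ) → (TIdx p → ℝ)
  | inl α => fun z => Pi.single (inl α) 1 - ∑ b, nonlin f b α z • Pi.single (inr b) 1
  | inr a => fun _ => Pi.single (inr a) 1

/-- The Berwald linear d-connection in the adapted frame:
`∇_{δ/δt^β} δ/δt^α = B^γ_{αβ} δ/δt^γ`, `∇_{δ/δt^β} ∂/∂s^a = B^c_{aβ} ∂/∂s^c`, and the covariant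
derivatives along `∂/∂s^b` of the frame vectors vanish. -/
def berwaldCoeff (f : (TIdx p → ℝ) → ℝ) : TIdx p → TIdx p → TIdx p → (TIdx p → ℝ) → ℝ
  | inl γ, inl α, inl β => berwald f γ α β
  | inr c, inr a, inl β => berwald f c a β
  | _, _, _ => fun _ => 0

/-- The normal components `Γ^C_{AB}` of the Berwald linear d-connection:
`∇_{∂/∂T^B} ∂/∂T^A = Γ^C_{AB} ∂/∂T^C`. -/
def normalCoeff (f : (TIdx p → ℝ) → ℝ) (C A B : TIdx p) (z : TIdx p → ℝ) : ℝ :=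
  covDeriv (adaptedFrame f) (berwaldCoeff f) (fun _ => Pi.single B 1) (fun _ => Pi.single A 1) z C

end Local

/-! ### The jet Berwald connection

In coordinates induced by charts of `M` and `N`, a point of `J¹(TM, N)` is a family
`w : JIdx p n → ℝ` of the coordinates `T^A = (t^α, s^a)`, `x^i`, `X^i_A = (x^i_α, y^i_a)`.
Below `f` and `h` are the Finsler functions of `M` and `N` in coordinates. -/

section Jet

variable {p n : ℕ}

/-- Index of a coordinate `T^A`, `x^i` or `X_A^i` on the jet space. -/
abbrev JIdx (p n : ℕ) : Type := TIdx p ⊕ (Fin n ⊕ (TIdx p × Fin n))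

/-- The index of `T^A`. -/
abbrev jT (A : TIdx p) : JIdx p n := Sum.inl A
/-- The index of `x^i`. -/
abbrev jx (i : Fin n) : JIdx p n := Sum.inr (Sum.inl i)
/-- The index of `X^i_A`. -/
abbrev jX (A : TIdx p) (i : Fin n) : JIdx p n := Sum.inr (Sum.inr (A, i))
/-- The index of `t^α`. -/
abbrev jt (α : Fin p) : JIdx p n := jT (Sum.inl α)
/-- The index of `s^a`. -/
abbrev js (a : Fin p) : JIdx p n := jT (Sum.inr a)
/-- The index of `x^i_α`. -/
abbrev jxt (α : Fin p) (i : Fin n) : JIdx p n := jX (Sum.inl α) i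
/-- The index of `y^i_a`. -/
abbrev jy (a : Fin p) (i : Fin n) : JIdx p n := jX (Sum.inr a) i

/-- The point `(t^α, s^a)` of the source tangent bundle. -/
def srcPt (w : JIdx p n → ℝ) : TIdx p → ℝ := fun A => w (jT A)

/-- The point `(x^l, y^l_a s^a)` of the target tangent bundle. -/
def tgtPt (w : JIdx p n → ℝ) : TIdx n → ℝ :=
  Sum.elim (fun l => w (jx l)) (fun l => ∑ a, w (jy a l) * w (js a))

/-- The Berwald temporal nonlinear connection `M^{(j)}_{(B)A} = - Γ^C_{AB} X^j_C`. -/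
def temporal (f : (TIdx p → ℝ) → ℝ) (j : Fin n) (B A : TIdx p) (w : JIdx p n → ℝ) : ℝ :=
  -∑ C, normalCoeff f C A B (srcPt w) * w (jX C j)

/-- The Berwald spatial nonlinear connection `N^{(j)}_{(B)i} = B~^j_{ik} X^k_B`. -/
def spatial (h : (TIdx n → ℝ) → ℝ) (j : Fin n) (B : TIdx p) (i : Fin n) (w : JIdx p n → ℝ) : ℝ :=
  ∑ k, berwald h j i k (tgtPt w) * w (jX B k)

/-- The jet adapted frame `δ/δT^A = ∂/∂T^A - M^{(j)}_{(B)A} ∂/∂X^j_B`,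
`δ/δx^i = ∂/∂x^i - N^{(j)}_{(B)i} ∂/∂X^j_B`, `∂/∂X^i_A`. -/
def jetFrame (f : (TIdx p → ℝ) → ℝ) (h : (TIdx n → ℝ) → ℝ) :
    JIdx p n → (JIdx p n → ℝ) → (JIdx p n → ℝ)
  | .inl A => fun w =>
      Pi.single (jT A) 1 - ∑ B, ∑ j, temporal f j B A w • Pi.single (jX B j) 1
  | .inr (.inl i) => fun w =>
      Pi.single (jx i) 1 - ∑ B, ∑ j, spatial h j B i w • Pi.single (jX B j) 1
  | .inr (.inr (A, i)) => fun _ => Pi.single (jX A i) 1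

/-- The jet adapted components of the jet Berwald linear d-connection; `jetCoeff f h k i j` is the
coefficient of the frame vector `k` in the covariant derivative of the frame vector `i` along the
frame vector `j`. The nonzero ones are `Γ^A_{BC}` on `δ/δT`, `B~^k_{ij}` on `δ/δx`, and
`-δ^i_j Γ^B_{CA}` and `δ^B_A B~^i_{jk}` on `∂/∂X`. -/
def jetCoeff (f : (TIdx p → ℝ) → ℝ) (h : (TIdx n → ℝ) → ℝ) :
    JIdx p n → JIdx p n → JIdx p n → (JIdx p n → ℝ) → ℝ
  | .inl A, .inl B, .inl C => fun w => normalCoeff f A B C (srcPt w)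
  | .inr (.inl k), .inr (.inl i), .inr (.inl j) => fun w => berwald h k i j (tgtPt w)
  | .inr (.inr (A, i)), .inr (.inr (B, j)), .inl C => fun w =>
      if i = j then -normalCoeff f B C A (srcPt w) else 0
  | .inr (.inr (A, i)), .inr (.inr (B, j)), .inr (.inl k) => fun w =>
      if A = B then berwald h i j k (tgtPt w) else 0
  | _, _, _ => fun _ => 0

/-- The adapted components of the curvature of the jet Berwald linear d-connection: with `e` the
jet adapted frame, `R(e c, e b) (e a) = ∑ d, jetCurv f h d a b c • e d`. -/
def jetCurv (f : (TIdx p → ℝ) → ℝ) (h : (TIdx n → ℝ) → ℝ) (d a b c : JIdx p n)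
    (w : JIdx p n → ℝ) : ℝ :=
  curvComp (jetFrame f h) (jetCoeff f h) d a b c w

/-- The five kinds of indices on the jet space, for the coordinates
`t^α`, `s^a`, `x^i`, `x^i_α`, `y^i_a`. -/
inductive Kind
  | t | s | x | xt | y
  deriving DecidableEq

/-- The kind of an index. -/
def kind : JIdx p n → Kind
  | .inl (.inl _) => .t
  | .inl (.inr _) => .s
  | .inr (.inl _) => .x
  | .inr (.inr (.inl _, _)) => .xt
  | .inr (.inr (.inr _, _)) => .y

open Kind in
/-- The thirty types of adapted d-curvatures, as the kinds of the
indices `d`, `a`, `b`, `c` of `jetCurv`. -/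
def curvTypes : Finset (Kind × Kind × Kind × Kind) :=
  {(t, t, t, t), (s, t, t, t), (t, t, t, s), (s, t, t, s), (t, t, s, t), (s, t, s, t),
   (s, s, t, t), (s, s, t, s), (s, s, s, t),
   (x, x, t, x), (x, x, s, x), (x, x, x, x), (x, x, x, y),
   (xt, xt, t, t), (xt, xt, t, s), (xt, xt, s, t), (xt, y, t, t), (xt, y, t, s), (xt, y, s, t),
   (y, y, t, t), (y, y, t, s), (y, y, s, t),
   (xt, xt, t, x), (xt, xt, s, x), (y, y, t, x), (y, y, s, x),
   (xt, xt, x, x), (y, y, x, x), (xt, xt, x, y), (y, y, x, y)}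

end Jet

/-! ### Finsler manifolds -/

section Manifolds

/-- A Finsler structure on a `p`-dimensional manifold: a nonnegative function on the tangent bundle,
smooth off the zero section, positively homogeneous of degree one, with positive definite
fundamental tensor. -/
structure FinslerStructure (p : ℕ) (M : Type*) [TopologicalSpace M]
    [ChartedSpace (EuclideanSpace ℝ (Fin p)) M] [IsManifold (𝓡 p) ∞ M] where
  /-- the Finsler function -/
  F : TangentBundle (𝓡 p) M → ℝ
  nonneg : ∀ v, 0 ≤ F v
  smooth : ContMDiffOn (𝓡 p).tangent 𝓘(ℝ, ℝ) ∞ F {v | v.2 ≠ 0}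
  homog : ∀ (m : M) (v : EuclideanSpace ℝ (Fin p)) (c : ℝ), 0 < c →
    F ⟨m, c • v⟩ = c * F ⟨m, v⟩
  posDef : ∀ (m : M) (v u : EuclideanSpace ℝ (Fin p)), v ≠ 0 → u ≠ 0 →
    0 < (1 / 2) * fderiv ℝ (fun v₁ : EuclideanSpace ℝ (Fin p) =>
      fderiv ℝ (fun v₂ : EuclideanSpace ℝ (Fin p) => F ⟨m, v₂⟩ ^ 2) v₁ u) v u

variable {p n : ℕ} {M : Type*} [TopologicalSpace M]
  [ChartedSpace (EuclideanSpace ℝ (Fin p)) M]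
  {N : Type*} [TopologicalSpace N] [ChartedSpace (EuclideanSpace ℝ (Fin n)) N]

/-- The tangent vector with coordinates `z = (t^α, s^a)` in the chart `φ`: the vector
`s^a ∂/∂t^a` at the point `φ⁻¹(t)`. -/
def vecOfCoords (φ : OpenPartialHomeomorph M (EuclideanSpace ℝ (Fin p))) (z : TIdx p → ℝ) :
    TangentBundle (𝓡 p) M :=
  ⟨φ.symm (WithLp.toLp 2 fun α => z (Sum.inl α)),
    mfderiv (𝓡 p) (𝓡 p) φ.symm (WithLp.toLp 2 fun α => z (Sum.inl α))
      (WithLp.toLp 2 fun a => z (Sum.inr a) : EuclideanSpace ℝ (Fin p))⟩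

/-- The Finsler function in the coordinates `(t^α, s^a)` induced by the chart `φ`. -/
def FinslerStructure.inChart [IsManifold (𝓡 p) ∞ M] (S : FinslerStructure p M)
    (φ : OpenPartialHomeomorph M (EuclideanSpace ℝ (Fin p))) (z : TIdx p → ℝ) : ℝ :=
  S.F (vecOfCoords φ z)

/-- The coordinates, induced by the charts `φ` of `M` and `ψ` of `N`, of those points of
`J¹(TM, N)` over which the geometry lives: `s` is not zero (the source point is in `TM ∖ {0}`)
and `y_a s^a` is not zero (the target point `(x^l, y^l_a s^a)` is in `TN ∖ {0}`). -/
def jetDomain (φ : OpenPartialHomeomorph M (EuclideanSpace ℝ (Fin p)))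
    (ψ : OpenPartialHomeomorph N (EuclideanSpace ℝ (Fin n))) : Set (JIdx p n → ℝ) :=
  {w | (WithLp.toLp 2 fun α => w (jt α)) ∈ φ.target ∧ (fun a => w (js a)) ≠ 0 ∧
    (WithLp.toLp 2 fun i => w (jx i)) ∈ ψ.target ∧
    (fun i => ∑ a, w (jy a i) * w (js a)) ≠ 0}

end Manifolds

end JetBerwald

end

open JetBerwald

open scoped Manifold ContDiff

noncomputable section

namespace JetBerwald

set_option linter.unusedSimpArgs false
set_option linter.unusedSectionVars false

/-! ### Curvature in a moving frame -/

section FrameCurvature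

variable {ι : Type} [Fintype ι] [DecidableEq ι]
  {e : ι → (ι → ℝ) → (ι → ℝ)} {κ : ι → ι → ι → (ι → ℝ) → ℝ}


/-! In a frame `e` with coefficients `κ`, curvature is e_c(κ_ab) − e_b(κ_ac) plus quadratic terms,
minus a term contracting `κ` with the bracket [e_c, e_b] (`curvComp_eq`). The ∂/∂T and ∂/∂x
components of the jet frame vectors are constant, so their brackets are combinations of the ∂/∂X,
and D along ∂/∂X annihilates the frame. The bracket term therefore disappears (`jetCurv_eq`).
Moreover D preserves the spans of the δ/δT, of the δ/δx and of the ∂/∂X, which leaves three diagonal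
blocks.

On δ/δT the coefficients are functions of (t, s) alone, on which δ/δT^A acts as ∂/∂T^A. This block
is the curvature of the Berwald connection of M in the coordinate frame (`coordCurv`). On δ/δx the
coefficients are B̃ at (x, y_a s^a), and the chain rule produces P̃ contracted with the variation of
y_a s^a. On ∂/∂X, D along δ/δT is dual to the connection whose coefficients ᵇΓ have their lower
indices transposed, and D along δ/δx acts on the index i only. The pure T part is thus minus a
transposed `coordCurv`, and the parts involving δ/δx are copies of the δ/δx block.

What remains is to recognise the entries of ᵇΓ. They are B, N_{α:β}, zero, and ∂N^c_α/∂s^b, and the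
one Finslerian fact needed is that the last equals B (`pd_nonlin`). It is proved through the spray
G: Euler's identity gives C_{αβγ}s^γ = 0, then N = ∂G/∂s (`pd_spray`) and B = ∂N/∂s. All identities
are checked after lowering an index, so that the inverse metric is never differentiated; positive
definiteness enters only through the invertibility of g. It follows that B is symmetric and that P
is totally symmetric in its lower indices, which makes the transposed curvature comparable with the
original one and kills the components along two s-directions.

Nonvanishing needs two planes. The hyperbolic plane has P = 0 but R ≠ 0, and settles the types built
from R and N_{α:β}. A Randers plane has P ≠ 0 at a point over t = 0, where g is Euclidean and the
spray is explicit; it settles the types governed by P. -/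

theorem frameMatrix_mulVec (e : ι → (ι → ℝ) → (ι → ℝ)) (z a : ι → ℝ) :
    (frameMatrix e z).mulVec a = ∑ k, a k • e k z := by
  ext k
  simp [frameMatrix, Matrix.mulVec, dotProduct, mul_comm]

theorem frameComp_eq_of_eq_sum {V : (ι → ℝ) → (ι → ℝ)} {z a : ι → ℝ}
    (hz : IsUnit (frameMatrix e z)) (h : V z = ∑ k, a k • e k z) (k : ι) :
    frameComp e V k z = a k := by
  rw [frameComp, h, ← frameMatrix_mulVec, Matrix.mulVec_mulVec,
    Matrix.nonsing_inv_mul _ ((Matrix.isUnit_iff_isUnit_det _).1 hz), Matrix.one_mulVec]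

theorem frameComp_self {z : ι → ℝ} (hz : IsUnit (frameMatrix e z)) (i k : ι) :
    frameComp e (e i) k z = if k = i then 1 else 0 :=
  frameComp_eq_of_eq_sum (a := fun k => if k = i then 1 else 0) hz (by simp) k

/-- The components of a frame vector in its own frame are constant, so the derivative term drops
out. -/
theorem covDeriv_frame (hz : ∀ z, IsUnit (frameMatrix e z)) (X : (ι → ℝ) → (ι → ℝ)) (a : ι)
    (z : ι → ℝ) :
    covDeriv e κ X (e a) z = ∑ k, (∑ j, κ k a j z * frameComp e X j z) • e k z := by
  have h : ∀ k, frameComp e (e a) k = fun _ => if k = a then (1 : ℝ) else 0 := fun k =>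
    funext fun z => frameComp_self (hz z) a k
  simp [covDeriv, h]

theorem covDeriv_frame_frame (hz : ∀ z, IsUnit (frameMatrix e z)) (a b : ι) :
    covDeriv e κ (e b) (e a) = fun z => ∑ k, κ k a b z • e k z := by
  funext z
  rw [covDeriv_frame hz]
  simp [frameComp_self (hz z)]

/-- The curvature of a linear connection in a moving frame. -/
theorem curvComp_eq (hz : ∀ z, IsUnit (frameMatrix e z)) (d a b c : ι) (z : ι → ℝ) :
    curvComp e κ d a b c z = fderiv ℝ (κ d a b) z (e c z) - fderiv ℝ (κ d a c) z (e b z)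
      + ∑ m, κ m a b z * κ d m c z - ∑ m, κ m a c z * κ d m b z
      - ∑ m, κ d a m z * frameComp e (VectorField.lieBracket ℝ (e c) (e b)) m z := by
  -- The components of the inner derivative are the functions `κ` themselves, so no product rule is
  -- applied and no differentiability of `κ` or of the frame is required.
  have h : ∀ b c, covDeriv e κ (e c) (covDeriv e κ (e b) (e a)) z =
      ∑ d, (fderiv ℝ (κ d a b) z (e c z) + ∑ m, κ m a b z * κ d m c z) • e d z := by
    intro b c
    have hc : ∀ k, frameComp e (fun z => ∑ k, κ k a b z • e k z) k = κ k a b := fun k =>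
      funext fun z => frameComp_eq_of_eq_sum (a := fun k => κ k a b z) (hz z) rfl k
    rw [covDeriv_frame_frame hz, covDeriv]
    simp [hc, frameComp_self (hz z), mul_comm]
  refine frameComp_eq_of_eq_sum (a := fun d => fderiv ℝ (κ d a b) z (e c z)
      - fderiv ℝ (κ d a c) z (e b z) + ∑ m, κ m a b z * κ d m c z - ∑ m, κ m a c z * κ d m b z
      - ∑ m, κ d a m z * frameComp e (VectorField.lieBracket ℝ (e c) (e b)) m z) (hz z) ?_ d
  rw [curvature, h, h, covDeriv_frame hz, ← Finset.sum_sub_distrib, ← Finset.sum_sub_distrib]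
  refine Finset.sum_congr rfl fun k _ => ?_
  rw [← sub_smul, ← sub_smul]
  congr 1
  ring


/-- A component in which two vector fields are constant does not occur in their Lie bracket. -/
theorem lieBracket_apply_of_const {V W : (ι → ℝ) → (ι → ℝ)} {k : ι} {v w : ℝ}
    (hV : ∀ z, V z k = v) (hW : ∀ z, W z k = w) (z : ι → ℝ) :
    VectorField.lieBracket ℝ V W z k = 0 := by
  have key : ∀ {V : (ι → ℝ) → (ι → ℝ)} {v : ℝ}, (∀ z, V z k = v) → ∀ u, fderiv ℝ V z u k = 0 := by
    intro V v hV u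
    -- The other components of `V` may fail to be differentiable; `fderiv` is then zero by
    -- convention, and the claim still holds.
    by_cases hd : DifferentiableAt ℝ V z
    · have h1 := (hasFDerivAt_pi'.1 hd.hasFDerivAt k).fderiv
      have h2 : (fun x => V x k) = fun _ => v := funext hV
      rw [h2, fderiv_fun_const] at h1
      simpa using (DFunLike.congr_fun h1 u).symm
    · simp [fderiv_zero_of_not_differentiableAt hd]
  simp [VectorField.lieBracket, key hV, key hW]

end FrameCurvature

/-! ### The normal components of the Berwald linear d-connection -/

section Normal

open Sum

variable {p : ℕ} (f : (TIdx p → ℝ) → ℝ)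

theorem adaptedFrame_apply_inl (α γ : Fin p) (z : TIdx p → ℝ) :
    adaptedFrame f (inl α) z (inl γ) = if γ = α then 1 else 0 := by
  simp [adaptedFrame, Pi.single_apply]

theorem adaptedFrame_apply_inr (α b : Fin p) (z : TIdx p → ℝ) :
    adaptedFrame f (inl α) z (inr b) = -nonlin f b α z := by
  simp [adaptedFrame, Pi.single_apply]

/-- The frame matrix is block unitriangular: the t-components of a vanishing combination kill the
horizontal coefficients, and then the s-components kill the vertical ones. Nothing about `f`
matters, so this also covers points with s = 0. -/
theorem isUnit_frameMatrix_adaptedFrame (z : TIdx p → ℝ) :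
    IsUnit (frameMatrix (adaptedFrame f) z) := by
  rw [← Matrix.mulVec_injective_iff_isUnit]
  rw [← Matrix.coe_mulVecLin, ← LinearMap.ker_eq_bot, LinearMap.ker_eq_bot']
  intro a ha
  simp only [Matrix.mulVecLin_apply, frameMatrix_mulVec] at ha
  have h1 : ∀ γ, a (inl γ) = 0 := fun γ => by
    have := congrFun ha (inl γ)
    simpa [Fintype.sum_sum_type, adaptedFrame_apply_inl, adaptedFrame, Pi.single_apply] using this
  funext A
  rcases A with γ | b
  · exact h1 γ
  · have := congrFun ha (inr b)
    simpa [Fintype.sum_sum_type, h1, adaptedFrame, Pi.single_apply] using this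

/-- This is ∂/∂t^α = δ/δt^α + N^c_α ∂/∂s^c. -/
theorem frameComp_adaptedFrame (α : Fin p) (k : TIdx p) (z : TIdx p → ℝ) :
    frameComp (adaptedFrame f) (fun _ => Pi.single (inl α) 1) k z =
      Sum.elim (fun γ => if γ = α then 1 else 0) (fun c => nonlin f c α z) k := by
  refine frameComp_eq_of_eq_sum (a := Sum.elim (fun γ => if γ = α then 1 else 0)
    (fun c => nonlin f c α z)) (isUnit_frameMatrix_adaptedFrame f z) ?_ k
  simp [Fintype.sum_sum_type, adaptedFrame]

theorem frameComp_adaptedFrame_inl_inl (α γ : Fin p) :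
    frameComp (adaptedFrame f) (fun _ => Pi.single (inl α) 1) (inl γ) =
      fun _ => if γ = α then 1 else 0 :=
  funext fun z => frameComp_adaptedFrame f α (inl γ) z

theorem frameComp_adaptedFrame_inl_inr (α c : Fin p) :
    frameComp (adaptedFrame f) (fun _ => Pi.single (inl α) 1) (inr c) = nonlin f c α :=
  funext fun z => frameComp_adaptedFrame f α (inr c) z

theorem frameComp_adaptedFrame_inr (a : Fin p) (k : TIdx p) :
    frameComp (adaptedFrame f) (fun _ => Pi.single (inr a) 1) k =
      fun _ => if k = inr a then 1 else 0 :=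
  funext fun z =>
    frameComp_self (e := adaptedFrame f) (isUnit_frameMatrix_adaptedFrame f z) (inr a) k

theorem normalCoeff_inr_right (γ : Fin p) (A : TIdx p) (b : Fin p) :
    normalCoeff f (inl γ) A (inr b) = fun _ => 0 := by
  funext z
  rcases A with α | a <;>
  simp [normalCoeff, covDeriv, Fintype.sum_sum_type, berwaldCoeff, adaptedFrame, Pi.single_apply,
    frameComp_adaptedFrame_inl_inl, frameComp_adaptedFrame_inl_inr, frameComp_adaptedFrame_inr]

/-- Since ∇ along ∂/∂s^b kills the adapted frame, only the coefficients N^c_α of ∂/∂t^α are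
differentiated. -/
theorem normalCoeff_inr_inl_inr (c α b : Fin p) :
    normalCoeff f (inr c) (inl α) (inr b) = pd (inr b) (nonlin f c α) := by
  funext z
  simp [normalCoeff, covDeriv, Fintype.sum_sum_type, berwaldCoeff, adaptedFrame, Pi.single_apply,
    frameComp_adaptedFrame_inl_inl, frameComp_adaptedFrame_inl_inr, frameComp_adaptedFrame_inr, pd]

theorem normalCoeff_inr_inr_inr (c a b : Fin p) :
    normalCoeff f (inr c) (inr a) (inr b) = fun _ => 0 := by
  funext z
  simp [normalCoeff, covDeriv, Fintype.sum_sum_type, berwaldCoeff, adaptedFrame, Pi.single_apply,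
    frameComp_adaptedFrame_inl_inl, frameComp_adaptedFrame_inl_inr, frameComp_adaptedFrame_inr]

theorem normalCoeff_inl_inl_inl (γ α β : Fin p) :
    normalCoeff f (inl γ) (inl α) (inl β) = berwald f γ α β := by
  funext z
  simp [normalCoeff, covDeriv, Fintype.sum_sum_type, berwaldCoeff, adaptedFrame, Pi.single_apply,
    frameComp_adaptedFrame_inl_inl, frameComp_adaptedFrame_inl_inr, frameComp_adaptedFrame_inr]

theorem normalCoeff_inl_inr_inl (γ a β : Fin p) :
    normalCoeff f (inl γ) (inr a) (inl β) = fun _ => 0 := by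
  funext z
  simp [normalCoeff, covDeriv, Fintype.sum_sum_type, berwaldCoeff, adaptedFrame, Pi.single_apply,
    frameComp_adaptedFrame_inl_inl, frameComp_adaptedFrame_inl_inr, frameComp_adaptedFrame_inr]

theorem normalCoeff_inr_inr_inl (c a β : Fin p) :
    normalCoeff f (inr c) (inr a) (inl β) = berwald f c a β := by
  funext z
  simp [normalCoeff, covDeriv, Fintype.sum_sum_type, berwaldCoeff, adaptedFrame, Pi.single_apply,
    frameComp_adaptedFrame_inl_inl, frameComp_adaptedFrame_inl_inr, frameComp_adaptedFrame_inr]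

/-- Differentiating δ/δt^α + N^d_α ∂/∂s^d along ∂/∂t^β gives B^γ_{αβ} δ/δt^γ and the first two terms
of N^c_{α:β}; the third is the ∂/∂s^c component of B^γ_{αβ} δ/δt^γ. -/
theorem normalCoeff_inr_inl_inl (c α β : Fin p) :
    normalCoeff f (inr c) (inl α) (inl β) = nonlinCov f c α β := by
  funext z
  simp [normalCoeff, covDeriv, Fintype.sum_sum_type, berwaldCoeff, adaptedFrame, Pi.single_apply,
    frameComp_adaptedFrame_inl_inl, frameComp_adaptedFrame_inl_inr, frameComp_adaptedFrame_inr, pd, nonlinCov]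
  simp only [mul_comm]
  ring

end Normal

/-! ### Calculus of partial derivatives -/

section PartialDerivatives

variable {ι : Type} [Fintype ι] [DecidableEq ι] {U : Set (ι → ℝ)} {u v : (ι → ℝ) → ℝ}
  {z : ι → ℝ}

theorem ContDiffOn.differentiableAt_of_isOpen (hu : ContDiffOn ℝ ∞ u U) (hU : IsOpen U)
    (hz : z ∈ U) : DifferentiableAt ℝ u z :=
  (hu.contDiffAt (hU.mem_nhds hz)).differentiableAt (by simp)

theorem ContDiffOn.pd (hu : ContDiffOn ℝ ∞ u U) (hU : IsOpen U) (i : ι) :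
    ContDiffOn ℝ ∞ (pd i u) U :=
  (hu.fderiv_of_isOpen hU (m := ∞) (by simp)).clm_apply contDiffOn_const

theorem fderiv_apply_eq_sum_pd (u : (ι → ℝ) → ℝ) (z v : ι → ℝ) :
    fderiv ℝ u z v = ∑ i, v i * pd i u z := by
  conv_lhs => rw [← Finset.univ_sum_single v, map_sum]
  refine Finset.sum_congr rfl fun i _ => ?_
  rw [pd, ← smul_eq_mul, ← map_smul, ← Pi.single_smul, smul_eq_mul, mul_one]

/-- Finsler identities hold only off the zero section; this allows them to be differentiated there.
-/
theorem pd_congr_of_eqOn (hU : IsOpen U) (hz : z ∈ U) (h : Set.EqOn u v U) (i : ι) :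
    pd i u z = pd i v z := by
  rw [pd, pd, (h.eventuallyEq_of_mem (hU.mem_nhds hz)).fderiv_eq]

theorem pd_const (i : ι) (c : ℝ) (z : ι → ℝ) : pd i (fun _ => c) z = 0 := by
  simp [pd]

theorem pd_coord (i j : ι) (z : ι → ℝ) : pd i (fun z => z j) z = if j = i then 1 else 0 := by
  rw [pd, (hasFDerivAt_apply (𝕜 := ℝ) j z).fderiv]
  simp [Pi.single_apply]

theorem pd_add (hu : DifferentiableAt ℝ u z) (hv : DifferentiableAt ℝ v z) (i : ι) :
    pd i (fun z => u z + v z) z = pd i u z + pd i v z := by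
  simp [pd, fderiv_fun_add hu hv]

theorem pd_sub (hu : DifferentiableAt ℝ u z) (hv : DifferentiableAt ℝ v z) (i : ι) :
    pd i (fun z => u z - v z) z = pd i u z - pd i v z := by
  simp [pd, fderiv_fun_sub hu hv]

theorem pd_mul (hu : DifferentiableAt ℝ u z) (hv : DifferentiableAt ℝ v z) (i : ι) :
    pd i (fun z => u z * v z) z = pd i u z * v z + u z * pd i v z := by
  simp [pd, fderiv_fun_mul hu hv]
  ring

theorem pd_const_mul (hu : DifferentiableAt ℝ u z) (c : ℝ) (i : ι) :
    pd i (fun z => c * u z) z = c * pd i u z := by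
  simp [pd, fderiv_const_mul hu]

theorem pd_sum {κ : Type} {s : Finset κ} {u : κ → (ι → ℝ) → ℝ}
    (hu : ∀ k ∈ s, DifferentiableAt ℝ (u k) z) (i : ι) :
    pd i (fun z => ∑ k ∈ s, u k z) z = ∑ k ∈ s, pd i (u k) z := by
  simp [pd, fderiv_fun_sum hu]

theorem pd_comm (hU : IsOpen U) (hu : ContDiffOn ℝ ∞ u U) (hz : z ∈ U) (i j : ι) :
    pd i (pd j u) z = pd j (pd i u) z := by
  have h : ∀ i j, pd i (pd j u) z = fderiv ℝ (fderiv ℝ u) z (Pi.single i 1) (Pi.single j 1) := by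
    intro i j
    have hd : DifferentiableAt ℝ (fderiv ℝ u) z :=
      ((hu.fderiv_of_isOpen hU (m := ∞) (by simp)).contDiffAt (hU.mem_nhds hz)).differentiableAt
        (by simp)
    change fderiv ℝ (fun z => fderiv ℝ u z (Pi.single j 1)) z _ = _
    rw [fderiv_clm_apply hd (differentiableAt_const _)]
    simp
  rw [h, h]
  exact (hu.contDiffAt (hU.mem_nhds hz)).isSymmSndFDerivAt
    (by simpa using WithTop.coe_le_coe.2 (le_top : (2 : ℕ∞) ≤ ⊤)) _ _

end PartialDerivatives

/-! ### The Berwald connection of a local Finsler function -/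

section LocalFinsler

open Sum

variable {p : ℕ}

/-- The point obtained from `z = (t, s)` by multiplying `s` by `c`. -/
def fiberScale (c : ℝ) (z : TIdx p → ℝ) : TIdx p → ℝ :=
  Sum.elim (fun α => z (inl α)) (fun a => c * z (inr a))

/-- A function which, on the open set `U` of the coordinate domain of `TM`, has the properties of
a Finsler function. -/
structure IsLocalFinsler (f : (TIdx p → ℝ) → ℝ) (U : Set (TIdx p → ℝ)) : Prop where
  isOpen : IsOpen U
  smooth : ContDiffOn ℝ ∞ f U
  homog : ∀ z ∈ U, ∀ c, 0 < c → f (fiberScale c z) = c * f z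
  det_ne_zero : ∀ z ∈ U, (Matrix.of fun α β => metric f α β z).det ≠ 0

/-- The Christoffel symbols of the first kind `γ_{μαβ}`. -/
def lowerChr (f : (TIdx p → ℝ) → ℝ) (μ α β : Fin p) (z : TIdx p → ℝ) : ℝ :=
  1 / 2 * (pd (inl β) (metric f μ α) z + pd (inl α) (metric f μ β) z - pd (inl μ) (metric f α β) z)

/-- The coefficients `G^μ = (1/2) γ^μ_{αβ} s^α s^β` of the geodesic spray. -/
def spray (f : (TIdx p → ℝ) → ℝ) (μ : Fin p) (z : TIdx p → ℝ) : ℝ :=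
  1 / 2 * ∑ α, ∑ β, formalChr f μ α β z * z (inr α) * z (inr β)

theorem formalChr_eq_sum (f : (TIdx p → ℝ) → ℝ) (μ α β : Fin p) (z : TIdx p → ℝ) :
    formalChr f μ α β z = ∑ ε, metricInv f μ ε z * lowerChr f ε α β z := by
  refine Finset.sum_congr rfl fun ε _ => ?_
  rw [lowerChr]
  ring

theorem nonlin_eq (f : (TIdx p → ℝ) → ℝ) (β α : Fin p) (z : TIdx p → ℝ) :
    nonlin f β α z = ∑ ε, formalChr f β α ε z * z (inr ε)
      - 2 * ∑ ε, cartanUp f β α ε z * spray f ε z := by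
  rw [nonlin, Finset.mul_sum]
  congr 1
  refine Finset.sum_congr rfl fun ε _ => ?_
  simp only [spray, Finset.mul_sum]
  refine Finset.sum_congr rfl fun μ _ => Finset.sum_congr rfl fun ν _ => ?_
  ring

theorem pd_metric_inr (f : (TIdx p → ℝ) → ℝ) (α β γ : Fin p) (z : TIdx p → ℝ) :
    pd (inr γ) (metric f α β) z = 2 * cartan f α β γ z := by
  rw [cartan]; ring

theorem contDiffOn_coord {U : Set (TIdx p → ℝ)} (A : TIdx p) :
    ContDiffOn ℝ ∞ (fun z : TIdx p → ℝ => z A) U :=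
  (contDiff_apply ℝ ℝ A).contDiffOn

namespace IsLocalFinsler

variable {f : (TIdx p → ℝ) → ℝ} {U : Set (TIdx p → ℝ)} {z : TIdx p → ℝ}

theorem differentiableAt (hf : IsLocalFinsler f U) {u : (TIdx p → ℝ) → ℝ} (hu : ContDiffOn ℝ ∞ u U) (hz : z ∈ U) :
    DifferentiableAt ℝ u z :=
  ContDiffOn.differentiableAt_of_isOpen hu hf.isOpen hz

/-! #### Smoothness -/

theorem contDiffOn_pd (hf : IsLocalFinsler f U) {u : (TIdx p → ℝ) → ℝ} (hu : ContDiffOn ℝ ∞ u U) (A : TIdx p) :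
    ContDiffOn ℝ ∞ (pd A u) U :=
  ContDiffOn.pd hu hf.isOpen A

theorem contDiffOn_metric (hf : IsLocalFinsler f U) (α β : Fin p) : ContDiffOn ℝ ∞ (metric f α β) U :=
  contDiffOn_const.mul (hf.contDiffOn_pd (hf.contDiffOn_pd (hf.smooth.pow 2) _) _)

/-- By Cramer's rule an entry of the inverse is a determinant with one row replaced, divided by a
determinant without zeros on `U`; determinants are polynomials in the entries. -/
theorem contDiffOn_metricInv (hf : IsLocalFinsler f U) (α β : Fin p) : ContDiffOn ℝ ∞ (metricInv f α β) U := by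
  have hdet : ∀ A : (TIdx p → ℝ) → Matrix (Fin p) (Fin p) ℝ,
      (∀ i j, ContDiffOn ℝ ∞ (fun z => A z i j) U) → ContDiffOn ℝ ∞ (fun z => (A z).det) U := by
    intro A hA
    simp only [Matrix.det_apply']
    exact ContDiffOn.sum fun σ _ => contDiffOn_const.mul (contDiffOn_prod fun i _ => hA _ _)
  have h1 := hdet (fun z => Matrix.of fun α' β' => metric f α' β' z) fun i j =>
    hf.contDiffOn_metric i j
  have h2 := hdet (fun z => (Matrix.of fun α' β' => metric f α' β' z).updateRow β (Pi.single α 1))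
    fun i j => by
      by_cases h : i = β
      · subst h; simpa using contDiffOn_const
      · simpa [Matrix.updateRow_ne h] using hf.contDiffOn_metric i j
  refine (h1.inv hf.det_ne_zero).mul h2 |>.congr fun z _ => ?_
  simp [metricInv, Matrix.inv_def, Matrix.adjugate_apply]

theorem contDiffOn_cartan (hf : IsLocalFinsler f U) (α β γ : Fin p) : ContDiffOn ℝ ∞ (cartan f α β γ) U :=
  contDiffOn_const.mul (hf.contDiffOn_pd (hf.contDiffOn_metric _ _) _)

theorem contDiffOn_cartanUp (hf : IsLocalFinsler f U) (α β γ : Fin p) : ContDiffOn ℝ ∞ (cartanUp f α β γ) U :=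
  ContDiffOn.sum fun _ _ => (hf.contDiffOn_metricInv _ _).mul (hf.contDiffOn_cartan _ _ _)

theorem contDiffOn_lowerChr (hf : IsLocalFinsler f U) (α β γ : Fin p) : ContDiffOn ℝ ∞ (lowerChr f α β γ) U :=
  contDiffOn_const.mul (((hf.contDiffOn_pd (hf.contDiffOn_metric _ _) _).add
    (hf.contDiffOn_pd (hf.contDiffOn_metric _ _) _)).sub
    (hf.contDiffOn_pd (hf.contDiffOn_metric _ _) _))

theorem contDiffOn_formalChr (hf : IsLocalFinsler f U) (α β γ : Fin p) : ContDiffOn ℝ ∞ (formalChr f α β γ) U :=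
  (ContDiffOn.sum fun _ _ => (hf.contDiffOn_metricInv _ _).mul
    (hf.contDiffOn_lowerChr _ _ _)).congr fun z _ => formalChr_eq_sum f α β γ z

theorem contDiffOn_spray (hf : IsLocalFinsler f U) (α : Fin p) : ContDiffOn ℝ ∞ (spray f α) U :=
  contDiffOn_const.mul (ContDiffOn.sum fun _ _ => ContDiffOn.sum fun _ _ =>
    ((hf.contDiffOn_formalChr _ _ _).mul (contDiffOn_coord _)).mul (contDiffOn_coord _))

theorem contDiffOn_nonlin (hf : IsLocalFinsler f U) (α β : Fin p) : ContDiffOn ℝ ∞ (nonlin f α β) U :=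
  ((ContDiffOn.sum fun _ _ => (hf.contDiffOn_formalChr _ _ _).mul (contDiffOn_coord _)).sub
    (contDiffOn_const.mul (ContDiffOn.sum fun _ _ => (hf.contDiffOn_cartanUp _ _ _).mul
      (hf.contDiffOn_spray _)))).congr fun z _ => nonlin_eq f α β z

/-! #### Symmetry and homogeneity -/

theorem metric_comm (hf : IsLocalFinsler f U) (hz : z ∈ U) (α β : Fin p) : metric f α β z = metric f β α z := by
  rw [metric, metric, pd_comm hf.isOpen (hf.smooth.pow 2) hz]

theorem pd_metric_comm (hf : IsLocalFinsler f U) (hz : z ∈ U) (A : TIdx p) (α β : Fin p) :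
    pd A (metric f α β) z = pd A (metric f β α) z :=
  pd_congr_of_eqOn hf.isOpen hz (fun _ hz => hf.metric_comm hz α β) A

theorem cartan_comm_left (hf : IsLocalFinsler f U) (hz : z ∈ U) (α β γ : Fin p) :
    cartan f α β γ z = cartan f β α γ z := by
  rw [cartan, cartan, hf.pd_metric_comm hz]

theorem cartan_eq (hf : IsLocalFinsler f U) (hz : z ∈ U) (α β γ : Fin p) :
    cartan f α β γ z = 1 / 4 * pd (inr γ) (pd (inr α) (pd (inr β) fun z => f z ^ 2)) z := by
  have h := pd_const_mul (hf.differentiableAt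
    (hf.contDiffOn_pd (hf.contDiffOn_pd (hf.smooth.pow 2) (inr β)) (inr α)) hz) (1 / 2) (inr γ)
  rw [cartan]
  change _ * pd (inr γ) (fun z => 1 / 2 * pd (inr α) (pd (inr β) fun z => f z ^ 2) z) z = _
  rw [h]
  ring

/-- C is a quarter of the third fibre derivative of F², so its symmetry in all indices is the
commutation of partial derivatives. -/
theorem cartan_comm_right (hf : IsLocalFinsler f U) (hz : z ∈ U) (α β γ : Fin p) :
    cartan f α β γ z = cartan f α γ β z := by
  rw [hf.cartan_comm_left hz α β, hf.cartan_comm_left hz α γ, hf.cartan_eq hz, hf.cartan_eq hz,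
    pd_comm hf.isOpen (hf.contDiffOn_pd (hf.smooth.pow 2) _) hz,
    pd_congr_of_eqOn hf.isOpen hz
      (fun _ hz => pd_comm hf.isOpen (hf.smooth.pow 2) hz (inr γ) (inr α)) (inr β),
    pd_comm hf.isOpen (hf.contDiffOn_pd (hf.smooth.pow 2) _) hz]

end IsLocalFinsler

end LocalFinsler

/-! ### Homogeneity, lowering of indices, and N as the fibre derivative of the spray. -/

section LocalFinsler

open Sum

variable {p : ℕ}

namespace IsLocalFinsler

variable {f : (TIdx p → ℝ) → ℝ} {U : Set (TIdx p → ℝ)} {z : TIdx p → ℝ}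

/-- Euler's identity. -/
theorem sum_mul_pd (hf : IsLocalFinsler f U) (hz : z ∈ U) :
    ∑ a, z (inr a) * pd (inr a) f z = f z := by
  have h1 : fiberScale 1 z = z := by
    funext A; rcases A with α | a <;> simp [fiberScale]
  have hs : HasDerivAt (fun c : ℝ => fiberScale c z)
      (Sum.elim (fun _ => 0) fun a => z (inr a)) 1 := by
    refine hasDerivAt_pi.2 fun A => ?_
    rcases A with α | a
    · simpa [fiberScale] using hasDerivAt_const (1 : ℝ) (z (inl α))
    · simpa [fiberScale] using (hasDerivAt_id (1 : ℝ)).mul_const (z (inr a))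
  have hd := hf.differentiableAt hf.smooth hz
  have h2 : HasDerivAt (fun c : ℝ => f (fiberScale c z))
      (fderiv ℝ f z (Sum.elim (fun _ => 0) fun a => z (inr a))) 1 := by
    rw [← h1] at hd
    have := hd.hasFDerivAt.comp_hasDerivAt (1 : ℝ) hs
    rwa [h1] at this
  have h3 : HasDerivAt (fun c : ℝ => f (fiberScale c z)) (f z) 1 := by
    have : HasDerivAt (fun c : ℝ => c * f z) (f z) 1 := by
      simpa using (hasDerivAt_id (1 : ℝ)).mul_const (f z)
    refine this.congr_of_eventuallyEq ?_
    filter_upwards [lt_mem_nhds (zero_lt_one' ℝ)] with c hc using hf.homog z hz c hc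
  have h4 := h2.unique h3
  rw [fderiv_apply_eq_sum_pd] at h4
  simpa [Fintype.sum_sum_type] using h4

/-- Differentiating Euler's relation of degree k in s^b yields Euler's relation of degree k − 1 for
∂u/∂s^b. -/
theorem sum_mul_pd_pd (hf : IsLocalFinsler f U) {u : (TIdx p → ℝ) → ℝ} {k : ℝ}
    (hu : ContDiffOn ℝ ∞ u U) (h : ∀ z ∈ U, ∑ a, z (inr a) * pd (inr a) u z = k * u z)
    (hz : z ∈ U) (b : Fin p) :
    ∑ a, z (inr a) * pd (inr a) (pd (inr b) u) z = (k - 1) * pd (inr b) u z := by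
  have h1 := pd_congr_of_eqOn hf.isOpen hz (u := fun z => ∑ a, z (inr a) * pd (inr a) u z)
    (v := fun z => k * u z) h (inr b)
  have hc : ∀ a : Fin p, DifferentiableAt ℝ (fun z : TIdx p → ℝ => z (inr a)) z := fun a =>
    hf.differentiableAt (contDiffOn_coord _) hz
  have hd : ∀ a : Fin p, DifferentiableAt ℝ (pd (inr a) u) z := fun a =>
    hf.differentiableAt (hf.contDiffOn_pd hu _) hz
  rw [pd_sum (fun a _ => (hc a).fun_mul (hd a)), pd_const_mul (hf.differentiableAt hu hz)] at h1
  simp only [pd_mul (hc _) (hd _), pd_coord, inr.injEq, Finset.sum_add_distrib, ite_mul, one_mul,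
    zero_mul, Finset.sum_ite_eq', Finset.mem_univ, if_true] at h1
  simp only [pd_comm hf.isOpen hu hz (inr _) (inr b)]
  linarith

/-- F² has degree two in s, hence its second fibre derivatives have degree zero. -/
theorem sum_cartan_mul (hf : IsLocalFinsler f U) (hz : z ∈ U) (α β : Fin p) :
    ∑ γ, cartan f α β γ z * z (inr γ) = 0 := by
  have hq := hf.smooth.pow 2
  have h0 : ∀ z ∈ U, ∑ a, z (inr a) * pd (inr a) (fun z => f z ^ 2) z = 2 * f z ^ 2 := by
    intro z hz
    have hd := hf.differentiableAt hf.smooth hz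
    have : ∀ A, pd A (fun z => f z ^ 2) z = 2 * f z * pd A f z := by
      intro A
      simp only [sq, pd_mul hd hd]
      ring
    simp only [this]
    calc _ = 2 * f z * ∑ a, z (inr a) * pd (inr a) f z := by
          rw [Finset.mul_sum]
          exact Finset.sum_congr rfl fun a _ => by ring
      _ = 2 * f z ^ 2 := by rw [hf.sum_mul_pd hz]; ring
  have h1 := fun z hz => hf.sum_mul_pd_pd hq h0 (z := z) hz β
  have h2 := hf.sum_mul_pd_pd (hf.contDiffOn_pd hq _) h1 hz α
  simp only [hf.cartan_eq hz, mul_assoc]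
  rw [← Finset.mul_sum]
  simp only [mul_comm _ (z _)]
  rw [h2]
  ring

theorem sum_pd_cartan_mul (hf : IsLocalFinsler f U) (hz : z ∈ U) (α β δ : Fin p) :
    ∑ γ, pd (inl δ) (cartan f α β γ) z * z (inr γ) = 0 := by
  have h1 := pd_congr_of_eqOn hf.isOpen hz (u := fun z => ∑ γ, cartan f α β γ z * z (inr γ))
    (v := fun _ => 0) (fun z hz => hf.sum_cartan_mul hz α β) (inl δ)
  have hc : ∀ a : Fin p, DifferentiableAt ℝ (fun z : TIdx p → ℝ => z (inr a)) z := fun a =>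
    hf.differentiableAt (contDiffOn_coord _) hz
  have hd : ∀ γ, DifferentiableAt ℝ (cartan f α β γ) z := fun a =>
    hf.differentiableAt (hf.contDiffOn_cartan _ _ _) hz
  rw [pd_sum (fun a _ => (hd a).fun_mul (hc a)), pd_const] at h1
  simpa [pd_mul (hd _) (hc _), pd_coord] using h1

theorem pd_cartan_comm_right (hf : IsLocalFinsler f U) (hz : z ∈ U) (A : TIdx p)
    (α β γ : Fin p) : pd A (cartan f α β γ) z = pd A (cartan f α γ β) z :=
  pd_congr_of_eqOn hf.isOpen hz (fun _ hz => hf.cartan_comm_right hz α β γ) A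

theorem sum_pd_cartan_mul' (hf : IsLocalFinsler f U) (hz : z ∈ U) (α β δ : Fin p) :
    ∑ γ, pd (inl δ) (cartan f α γ β) z * z (inr γ) = 0 := by
  simp only [hf.pd_cartan_comm_right hz _ α _ β, hf.sum_pd_cartan_mul hz]

theorem sum_cartanUp_mul (hf : IsLocalFinsler f U) (hz : z ∈ U) (α β : Fin p) :
    ∑ γ, cartanUp f α γ β z * z (inr γ) = 0 := by
  simp only [cartanUp, Finset.sum_mul]
  rw [Finset.sum_comm]
  refine Finset.sum_eq_zero fun l _ => ?_
  simp only [hf.cartan_comm_right hz l _ β, mul_assoc]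
  rw [← Finset.mul_sum, hf.sum_cartan_mul hz, mul_zero]

theorem sum_metric_mul_metricInv (hf : IsLocalFinsler f U) (hz : z ∈ U) (α γ : Fin p) :
    ∑ β, metric f α β z * metricInv f β γ z = if α = γ then 1 else 0 := by
  have h := Matrix.mul_nonsing_inv (Matrix.of fun α β => metric f α β z)
    (isUnit_iff_ne_zero.2 (hf.det_ne_zero z hz))
  have h2 := congrFun (congrFun h α) γ
  rw [Matrix.mul_apply, Matrix.one_apply] at h2
  exact h2

theorem sum_metric_mul_sum (hf : IsLocalFinsler f U) (hz : z ∈ U) (α : Fin p) (a : Fin p → ℝ) :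
    ∑ β, metric f α β z * ∑ γ, metricInv f β γ z * a γ = a α := by
  simp only [Finset.mul_sum, ← mul_assoc]
  rw [Finset.sum_comm]
  simp [← Finset.sum_mul, hf.sum_metric_mul_metricInv hz]

/-- Vectors with the same lowered components are equal. -/
theorem eq_of_sum_metric_mul (hf : IsLocalFinsler f U) (hz : z ∈ U) {a b : Fin p → ℝ}
    (h : ∀ α, ∑ β, metric f α β z * a β = ∑ β, metric f α β z * b β) : a = b :=
  Matrix.mulVec_injective_of_isUnit ((Matrix.isUnit_iff_isUnit_det _).2
    (isUnit_iff_ne_zero.2 (hf.det_ne_zero z hz))) (funext h)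

theorem sum_metric_mul_cartanUp (hf : IsLocalFinsler f U) (hz : z ∈ U) (α β γ : Fin p) :
    ∑ ν, metric f α ν z * cartanUp f ν β γ z = cartan f α β γ z :=
  hf.sum_metric_mul_sum hz α fun l => cartan f l β γ z

theorem sum_metric_mul_formalChr (hf : IsLocalFinsler f U) (hz : z ∈ U) (α β γ : Fin p) :
    ∑ ν, metric f α ν z * formalChr f ν β γ z = lowerChr f α β γ z := by
  simp only [formalChr_eq_sum]
  exact hf.sum_metric_mul_sum hz α fun l => lowerChr f l β γ z

/-- In the lowered form no inverse metric is visible on the right, so the identity can be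
differentiated in s using only ∂g/∂s = 2C. `sum_metric_mul_nonlin` serves the same purpose for N. -/
theorem sum_metric_mul_spray (hf : IsLocalFinsler f U) (hz : z ∈ U) (μ : Fin p) :
    ∑ ν, metric f μ ν z * spray f ν z =
      1 / 2 * ∑ α, ∑ β, lowerChr f μ α β z * z (inr α) * z (inr β) := by
  simp only [← hf.sum_metric_mul_formalChr hz, spray, Finset.mul_sum, Finset.sum_mul]
  rw [Finset.sum_comm]
  refine Finset.sum_congr rfl fun α _ => ?_
  rw [Finset.sum_comm]
  refine Finset.sum_congr rfl fun β _ => Finset.sum_congr rfl fun ν _ => ?_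
  ring

theorem sum_metric_mul_nonlin (hf : IsLocalFinsler f U) (hz : z ∈ U) (μ α : Fin p) :
    ∑ ν, metric f μ ν z * nonlin f ν α z = ∑ ε, lowerChr f μ α ε z * z (inr ε)
      - 2 * ∑ ε, cartan f μ α ε z * spray f ε z := by
  simp only [← hf.sum_metric_mul_formalChr hz, ← hf.sum_metric_mul_cartanUp hz μ, nonlin_eq,
    mul_sub, Finset.sum_sub_distrib, Finset.mul_sum, Finset.sum_mul]
  congr 1
  · rw [Finset.sum_comm]
    refine Finset.sum_congr rfl fun α _ => Finset.sum_congr rfl fun ν _ => ?_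
    ring
  · rw [Finset.sum_comm]
    refine Finset.sum_congr rfl fun α _ => Finset.sum_congr rfl fun ν _ => ?_
    ring

theorem lowerChr_comm (hf : IsLocalFinsler f U) (hz : z ∈ U) (μ α β : Fin p) :
    lowerChr f μ α β z = lowerChr f μ β α z := by
  rw [lowerChr, lowerChr, hf.pd_metric_comm hz _ α β]
  ring

/-- Metric compatibility of the Christoffel symbols of the first kind. -/
theorem lowerChr_add_lowerChr (hf : IsLocalFinsler f U) (hz : z ∈ U) (γ ν μ : Fin p) :
    lowerChr f γ ν μ z + lowerChr f ν γ μ z = pd (inl μ) (metric f γ ν) z := by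
  rw [lowerChr, lowerChr, hf.pd_metric_comm hz _ ν γ, hf.pd_metric_comm hz _ γ μ,
    hf.pd_metric_comm hz _ ν μ]
  ring

theorem pd_lowerChr (hf : IsLocalFinsler f U) (hz : z ∈ U) (μ α β ε : Fin p) :
    pd (inr ε) (lowerChr f μ α β) z = pd (inl β) (cartan f μ α ε) z
      + pd (inl α) (cartan f μ β ε) z - pd (inl μ) (cartan f α β ε) z := by
  have h : ∀ α β γ, pd (inr ε) (pd (inl γ) (metric f α β)) z =
      2 * pd (inl γ) (cartan f α β ε) z := by
    intro α β γ
    rw [pd_comm hf.isOpen (hf.contDiffOn_metric _ _) hz,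
      ← pd_const_mul (hf.differentiableAt (hf.contDiffOn_cartan _ _ _) hz)]
    exact congrArg (fun u => pd (inl γ) u z) (funext fun z => pd_metric_inr f α β ε z)
  have hd : ∀ α β γ, DifferentiableAt ℝ (pd (inl γ) (metric f α β)) z := fun α β γ =>
    hf.differentiableAt (hf.contDiffOn_pd (hf.contDiffOn_metric _ _) _) hz
  change pd (inr ε) (fun z => 1 / 2 * (pd (inl β) (metric f μ α) z + pd (inl α) (metric f μ β) z
    - pd (inl μ) (metric f α β) z)) z = _
  rw [pd_const_mul (((hd _ _ _).fun_add (hd _ _ _)).fun_sub (hd _ _ _)),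
    pd_sub ((hd _ _ _).fun_add (hd _ _ _)) (hd _ _ _), pd_add (hd _ _ _) (hd _ _ _), h, h, h]
  ring

/-- The fibre derivatives of the spray coefficients are the coefficients of the nonlinear Cartan
connection. -/
theorem pd_spray (hf : IsLocalFinsler f U) (hz : z ∈ U) (β α : Fin p) :
    pd (inr α) (spray f β) z = nonlin f β α z := by
  have hc : ∀ a : Fin p, DifferentiableAt ℝ (fun z : TIdx p → ℝ => z (inr a)) z := fun a =>
    hf.differentiableAt (contDiffOn_coord _) hz
  have hm : ∀ α β, DifferentiableAt ℝ (metric f α β) z := fun _ _ =>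
    hf.differentiableAt (hf.contDiffOn_metric _ _) hz
  have hs : ∀ α, DifferentiableAt ℝ (spray f α) z := fun _ =>
    hf.differentiableAt (hf.contDiffOn_spray _) hz
  have hl : ∀ μ α β, DifferentiableAt ℝ (lowerChr f μ α β) z := fun _ _ _ =>
    hf.differentiableAt (hf.contDiffOn_lowerChr _ _ _) hz
  refine congrFun (hf.eq_of_sum_metric_mul hz (a := fun β => pd (inr α) (spray f β) z)
    (b := fun β => nonlin f β α z) fun μ => ?_) β
  -- On the left, the derivative of g_{μν} contributes 2 C_{μνα} G^ν, which is exactly the Cartan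
  -- correction in the lowered N.
  have h1 := pd_congr_of_eqOn hf.isOpen hz
    (fun z hz => hf.sum_metric_mul_spray hz μ) (inr α)
  rw [pd_sum (fun a _ => (hm _ _).fun_mul (hs _)), pd_const_mul (DifferentiableAt.fun_sum fun _ _ =>
    DifferentiableAt.fun_sum fun _ _ => ((hl _ _ _).fun_mul (hc _)).fun_mul (hc _)), pd_sum (fun _ _ =>
    DifferentiableAt.fun_sum fun _ _ => ((hl _ _ _).fun_mul (hc _)).fun_mul (hc _))] at h1
  simp only [pd_sum (fun _ _ => ((hl μ _ _).fun_mul (hc _)).fun_mul (hc _)),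
    pd_mul ((hl μ _ _).fun_mul (hc _)) (hc _), pd_mul (hl μ _ _) (hc _), pd_mul (hm _ _) (hs _),
    pd_coord, hf.pd_lowerChr hz, pd_metric_inr, inr.injEq] at h1
  -- Each term of ∂γ_{μab}/∂s^α s^a s^b contracts an index of a t-derivative of C with s, and such a
  -- contraction vanishes because C_{αβγ}s^γ = 0 for all t.
  have e1 : ∀ γ, ∑ a, ∑ b, pd (inl γ) (cartan f a b α) z * z (inr a) * z (inr b) = 0 := fun γ => by
    refine Finset.sum_eq_zero fun a _ => ?_
    simp only [mul_right_comm _ (z (inr a)), ← Finset.sum_mul, hf.sum_pd_cartan_mul' hz, zero_mul]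
  have e2 : ∑ a, ∑ b, pd (inl a) (cartan f μ b α) z * z (inr a) * z (inr b) = 0 := by
    refine Finset.sum_eq_zero fun a _ => ?_
    simp only [mul_right_comm _ (z (inr a)), ← Finset.sum_mul, hf.sum_pd_cartan_mul' hz, zero_mul]
  have e3 : ∑ a, ∑ b, pd (inl b) (cartan f μ a α) z * z (inr a) * z (inr b) = 0 := by
    rw [Finset.sum_comm, ← e2]
    exact Finset.sum_congr rfl fun a _ => Finset.sum_congr rfl fun b _ => by ring
  simp only [add_mul, sub_mul, Finset.sum_add_distrib, Finset.sum_sub_distrib, e1, e2, e3, mul_ite,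
    ite_mul, mul_one, mul_zero, zero_mul, Finset.sum_ite_eq', Finset.mem_univ, if_true,
    Finset.sum_const_zero, Finset.sum_ite_irrel, hf.lowerChr_comm hz μ _ α,
    hf.cartan_comm_right hz μ _ α, mul_assoc (2 : ℝ), ← Finset.mul_sum] at h1
  rw [hf.sum_metric_mul_nonlin hz]
  linarith

end IsLocalFinsler

end LocalFinsler

/-! ### The Rund connection, B as the fibre derivative of N, and the symmetries of B and P. -/

section LocalFinsler

open Sum

variable {p : ℕ}

theorem hder_eq_fderiv (f u : (TIdx p → ℝ) → ℝ) (α : Fin p) (z : TIdx p → ℝ) :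
    hder f α u z = fderiv ℝ u z (adaptedFrame f (inl α) z) := by
  rw [fderiv_apply_eq_sum_pd, Fintype.sum_sum_type]
  simp [adaptedFrame_apply_inl, adaptedFrame_apply_inr, hder, sub_eq_add_neg]

theorem hder_mul {f u v : (TIdx p → ℝ) → ℝ} {z : TIdx p → ℝ} (hu : DifferentiableAt ℝ u z)
    (hv : DifferentiableAt ℝ v z) (α : Fin p) :
    hder f α (fun z => u z * v z) z = hder f α u z * v z + u z * hder f α v z := by
  simp [hder_eq_fderiv, fderiv_fun_mul hu hv]
  ring

theorem hder_sum {f : (TIdx p → ℝ) → ℝ} {κ : Type} {s : Finset κ} {u : κ → (TIdx p → ℝ) → ℝ}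
    {z : TIdx p → ℝ} (hu : ∀ k ∈ s, DifferentiableAt ℝ (u k) z) (α : Fin p) :
    hder f α (fun z => ∑ k ∈ s, u k z) z = ∑ k ∈ s, hder f α (u k) z := by
  simp [hder_eq_fderiv, fderiv_fun_sum hu]

namespace IsLocalFinsler

variable {f : (TIdx p → ℝ) → ℝ} {U : Set (TIdx p → ℝ)} {z : TIdx p → ℝ}

/-- The Cartan correction of N is contracted with s and drops out. -/
theorem sum_nonlin_mul (hf : IsLocalFinsler f U) (hz : z ∈ U) (ε : Fin p) :
    ∑ μ, nonlin f ε μ z * z (inr μ) = 2 * spray f ε z := by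
  simp only [nonlin_eq, sub_mul, Finset.sum_sub_distrib]
  have h : ∑ μ, (2 * ∑ ν, cartanUp f ε μ ν z * spray f ν z) * z (inr μ) = 0 := by
    simp only [Finset.mul_sum, Finset.sum_mul]
    rw [Finset.sum_comm]
    refine Finset.sum_eq_zero fun ν _ => ?_
    calc _ = 2 * spray f ν z * ∑ μ, cartanUp f ε μ ν z * z (inr μ) := by
          rw [Finset.mul_sum]
          exact Finset.sum_congr rfl fun a _ => by ring
      _ = 0 := by rw [hf.sum_cartanUp_mul hz, mul_zero]
  rw [h, spray, sub_zero, ← mul_assoc]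
  norm_num [Finset.sum_mul]
  exact Finset.sum_congr rfl fun a _ => Finset.sum_congr rfl fun b _ => by ring

/-- Contracted with s, the derivations δ/δt^μ give the geodesic spray s^μ ∂/∂t^μ − 2 G^ε ∂/∂s^ε. -/
theorem sum_mul_hder (hf : IsLocalFinsler f U) (hz : z ∈ U) (u : (TIdx p → ℝ) → ℝ) :
    ∑ μ, z (inr μ) * hder f μ u z =
      ∑ μ, z (inr μ) * pd (inl μ) u z - 2 * ∑ ε, spray f ε z * pd (inr ε) u z := by
  simp only [hder, mul_sub, Finset.sum_sub_distrib, Finset.mul_sum, ← mul_assoc,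
    ← hf.sum_nonlin_mul hz, Finset.sum_mul]
  rw [Finset.sum_comm (γ := Fin p)]
  congr 1
  exact Finset.sum_congr rfl fun a _ => Finset.sum_congr rfl fun b _ => by ring

theorem hder_metric (f : (TIdx p → ℝ) → ℝ) (α β γ : Fin p) (z : TIdx p → ℝ) :
    hder f γ (metric f α β) z =
      pd (inl γ) (metric f α β) z - 2 * ∑ ε, nonlin f ε γ z * cartan f α β ε z := by
  rw [hder, Finset.mul_sum]
  congr 1
  exact Finset.sum_congr rfl fun a _ => by rw [pd_metric_inr]; ring

theorem sum_mul_hder_metric (hf : IsLocalFinsler f U) (hz : z ∈ U) (α γ : Fin p) :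
    ∑ μ, z (inr μ) * hder f α (metric f γ μ) z =
      ∑ μ, z (inr μ) * pd (inl α) (metric f γ μ) z := by
  simp only [hder_metric, mul_sub, Finset.sum_sub_distrib]
  rw [sub_eq_self]
  simp only [Finset.mul_sum]
  rw [Finset.sum_comm]
  refine Finset.sum_eq_zero fun ε _ => ?_
  calc _ = 2 * nonlin f ε α z * ∑ μ, cartan f γ ε μ z * z (inr μ) := by
        rw [Finset.mul_sum]
        exact Finset.sum_congr rfl fun a _ => by rw [hf.cartan_comm_right hz γ ε a]; ring
    _ = 0 := by rw [hf.sum_cartan_mul hz, mul_zero]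

theorem sum_metric_mul_rund (hf : IsLocalFinsler f U) (hz : z ∈ U) (γ α β : Fin p) :
    ∑ ν, metric f γ ν z * rund f ν α β z = 1 / 2 * (hder f β (metric f γ α) z
      + hder f α (metric f γ β) z - hder f γ (metric f α β) z) := by
  rw [← hf.sum_metric_mul_sum hz γ fun μ => 1 / 2 * (hder f β (metric f μ α) z
      + hder f α (metric f μ β) z - hder f μ (metric f α β) z)]
  refine Finset.sum_congr rfl fun ν _ => ?_
  rw [rund]
  congr 1
  exact Finset.sum_congr rfl fun a _ => by ring

/-- The nonlinear Cartan connection is the deflection of the Rund connection. -/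
theorem sum_rund_mul (hf : IsLocalFinsler f U) (hz : z ∈ U) (γ α : Fin p) :
    ∑ μ, rund f γ α μ z * z (inr μ) = nonlin f γ α z := by
  refine congrFun (hf.eq_of_sum_metric_mul hz (a := fun γ => ∑ μ, rund f γ α μ z * z (inr μ))
    (b := fun γ => nonlin f γ α z) fun γ => ?_) γ
  calc _ = ∑ μ, (∑ ν, metric f γ ν z * rund f ν α μ z) * z (inr μ) := by
        simp only [Finset.mul_sum, Finset.sum_mul]
        rw [Finset.sum_comm]
        exact Finset.sum_congr rfl fun a _ => Finset.sum_congr rfl fun b _ => by ring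
    _ = 1 / 2 * (∑ μ, z (inr μ) * hder f μ (metric f γ α) z
          + ∑ μ, z (inr μ) * hder f α (metric f γ μ) z
          - ∑ μ, z (inr μ) * hder f γ (metric f α μ) z) := by
        simp only [hf.sum_metric_mul_rund hz, ← Finset.sum_add_distrib, ← Finset.sum_sub_distrib,
          Finset.mul_sum]
        exact Finset.sum_congr rfl fun a _ => by ring
    _ = _ := by
        -- Only the derivative along the spray keeps a fibre term, −2 G^ε ∂g_{γα}/∂s^ε; with ∂g/∂s =
        -- 2C it becomes the Cartan correction of N.
        rw [hf.sum_mul_hder hz, hf.sum_mul_hder_metric hz, hf.sum_mul_hder_metric hz,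
          hf.sum_metric_mul_nonlin hz]
        simp only [lowerChr, pd_metric_inr, Finset.mul_sum, ← Finset.sum_add_distrib,
          ← Finset.sum_sub_distrib]
        exact Finset.sum_congr rfl fun a _ => by ring

/-- Lowering an index does not commute with δ/δt^μ: the product rule leaves a term with δg/δt^μ,
which is later absorbed by the connection terms of C_{|μ}. -/
theorem sum_metric_mul_hder_cartanUp (hf : IsLocalFinsler f U) (hz : z ∈ U) (γ α β μ : Fin p) :
    ∑ ν, metric f γ ν z * hder f μ (cartanUp f ν α β) z = hder f μ (cartan f γ α β) z
      - ∑ ν, hder f μ (metric f γ ν) z * cartanUp f ν α β z := by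
  have hm : ∀ α β, DifferentiableAt ℝ (metric f α β) z := fun _ _ =>
    hf.differentiableAt (hf.contDiffOn_metric _ _) hz
  have hc : ∀ α β γ, DifferentiableAt ℝ (cartanUp f α β γ) z := fun _ _ _ =>
    hf.differentiableAt (hf.contDiffOn_cartanUp _ _ _) hz
  have h1 : hder f μ (fun z => ∑ ν, metric f γ ν z * cartanUp f ν α β z) z =
      hder f μ (cartan f γ α β) z := by
    rw [hder_eq_fderiv, hder_eq_fderiv, Filter.EventuallyEq.fderiv_eq]
    filter_upwards [hf.isOpen.mem_nhds hz] with z hz using hf.sum_metric_mul_cartanUp hz γ α β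
  rw [← h1, hder_sum fun ν _ => (hm _ _).fun_mul (hc _ _ _), ← Finset.sum_sub_distrib]
  refine Finset.sum_congr rfl fun ν _ => ?_
  rw [hder_mul (hm _ _) (hc _ _ _)]
  ring

/-- Along the spray the metric varies by the symmetrised lowered N; this is `lowerChr_add_lowerChr`
contracted with s, the fibre terms being the Cartan corrections. -/
theorem sum_mul_hder_metric_eq (hf : IsLocalFinsler f U) (hz : z ∈ U) (γ ν : Fin p) :
    ∑ μ, z (inr μ) * hder f μ (metric f γ ν) z =
      ∑ ε, metric f γ ε z * nonlin f ε ν z + ∑ ε, metric f ν ε z * nonlin f ε γ z := by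
  rw [hf.sum_mul_hder hz, hf.sum_metric_mul_nonlin hz, hf.sum_metric_mul_nonlin hz]
  simp only [← hf.lowerChr_add_lowerChr hz, pd_metric_inr, Finset.mul_sum,
    ← Finset.sum_add_distrib, ← Finset.sum_sub_distrib, hf.cartan_comm_left hz ν γ]
  exact Finset.sum_congr rfl fun a _ => by ring

/-- Contraction with s turns each Rund coefficient into N by `sum_rund_mul`. -/
theorem sum_cartanCov_mul (hf : IsLocalFinsler f U) (hz : z ∈ U) (ν α β : Fin p) :
    ∑ μ, cartanCov f ν α β μ z * z (inr μ) = ∑ μ, z (inr μ) * hder f μ (cartanUp f ν α β) z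
      + ∑ ε, cartanUp f ε α β z * nonlin f ν ε z - ∑ ε, cartanUp f ν ε β z * nonlin f ε α z
      - ∑ ε, cartanUp f ν α ε z * nonlin f ε β z := by
  simp only [cartanCov, add_mul, sub_mul, Finset.sum_add_distrib, Finset.sum_sub_distrib,
    ← hf.sum_rund_mul hz, Finset.mul_sum, Finset.sum_mul, mul_comm (z _), mul_assoc]
  rw [Finset.sum_comm, Finset.sum_comm (f := fun x i => cartanUp f ν i β z * _),
    Finset.sum_comm (f := fun x i => cartanUp f ν α i z * _)]

theorem sum_metric_mul_sum_cartanCov (hf : IsLocalFinsler f U) (hz : z ∈ U) (γ α β : Fin p) :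
    ∑ ν, metric f γ ν z * ∑ μ, cartanCov f ν α β μ z * z (inr μ) =
      ∑ μ, z (inr μ) * hder f μ (cartan f γ α β) z - ∑ ε, cartan f ε α β z * nonlin f ε γ z
      - ∑ ε, cartan f γ ε β z * nonlin f ε α z - ∑ ε, cartan f γ α ε z * nonlin f ε β z := by
  have h1 : ∑ ν, metric f γ ν z * ∑ μ, z (inr μ) * hder f μ (cartanUp f ν α β) z =
      ∑ μ, z (inr μ) * hder f μ (cartan f γ α β) z
        - ∑ ν, (∑ ε, metric f γ ε z * nonlin f ε ν z) * cartanUp f ν α β z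
        - ∑ ε, cartan f ε α β z * nonlin f ε γ z := by
    calc _ = ∑ μ, z (inr μ) * ∑ ν, metric f γ ν z * hder f μ (cartanUp f ν α β) z := by
          simp only [Finset.mul_sum]
          rw [Finset.sum_comm]
          exact Finset.sum_congr rfl fun a _ => Finset.sum_congr rfl fun b _ => by ring
      _ = ∑ μ, z (inr μ) * hder f μ (cartan f γ α β) z
          - ∑ ν, (∑ μ, z (inr μ) * hder f μ (metric f γ ν) z) * cartanUp f ν α β z := by
          simp only [hf.sum_metric_mul_hder_cartanUp hz, mul_sub, Finset.sum_sub_distrib,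
            Finset.mul_sum, Finset.sum_mul]
          rw [Finset.sum_comm (f := fun x i => z (inr x) * (_ * _))]
          simp only [mul_assoc]
      _ = _ := by
          simp only [hf.sum_mul_hder_metric_eq hz, add_mul, Finset.sum_add_distrib]
          rw [sub_add_eq_sub_sub]
          congr 1
          simp only [← hf.sum_metric_mul_cartanUp hz, Finset.sum_mul]
          rw [Finset.sum_comm]
          exact Finset.sum_congr rfl fun a _ => Finset.sum_congr rfl fun b _ => by
            rw [hf.metric_comm hz a b]; ring
  -- This is the middle term of `h1`. The two cancel, and with them the last occurrence of C with a
  -- raised index.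
  have h2 : ∑ ν, metric f γ ν z * ∑ ε, cartanUp f ε α β z * nonlin f ν ε z =
      ∑ ν, (∑ ε, metric f γ ε z * nonlin f ε ν z) * cartanUp f ν α β z := by
    simp only [Finset.mul_sum, Finset.sum_mul]
    rw [Finset.sum_comm]
    exact Finset.sum_congr rfl fun a _ => Finset.sum_congr rfl fun b _ => by ring
  have h3 : ∑ ν, metric f γ ν z * ∑ ε, cartanUp f ν ε β z * nonlin f ε α z =
      ∑ ε, cartan f γ ε β z * nonlin f ε α z := by
    simp only [← hf.sum_metric_mul_cartanUp hz, Finset.mul_sum, Finset.sum_mul]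
    rw [Finset.sum_comm]
    exact Finset.sum_congr rfl fun a _ => Finset.sum_congr rfl fun b _ => by ring
  have h4 : ∑ ν, metric f γ ν z * ∑ ε, cartanUp f ν α ε z * nonlin f ε β z =
      ∑ ε, cartan f γ α ε z * nonlin f ε β z := by
    simp only [← hf.sum_metric_mul_cartanUp hz, Finset.mul_sum, Finset.sum_mul]
    rw [Finset.sum_comm]
    exact Finset.sum_congr rfl fun a _ => Finset.sum_congr rfl fun b _ => by ring
  simp only [hf.sum_cartanCov_mul hz, mul_add, mul_sub, Finset.sum_add_distrib,
    Finset.sum_sub_distrib, h1, h2, h3, h4]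
  ring

theorem pd_cartan_inr_comm (hf : IsLocalFinsler f U) (hz : z ∈ U) (γ α β ε : Fin p) :
    pd (inr β) (cartan f γ α ε) z = pd (inr ε) (cartan f γ α β) z := by
  have h : ∀ β ε, pd (inr β) (cartan f γ α ε) z =
      1 / 2 * pd (inr β) (pd (inr ε) (metric f γ α)) z := fun β ε =>
    pd_const_mul (hf.differentiableAt (hf.contDiffOn_pd (hf.contDiffOn_metric _ _) _) hz) _ _
  rw [h, h, pd_comm hf.isOpen (hf.contDiffOn_metric _ _) hz]

/-- The fibre derivatives of the nonlinear Cartan connection are the Berwald components. -/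
theorem pd_nonlin (hf : IsLocalFinsler f U) (hz : z ∈ U) (ν α β : Fin p) :
    pd (inr β) (nonlin f ν α) z = berwald f ν α β z := by
  have hc : ∀ a : Fin p, DifferentiableAt ℝ (fun z : TIdx p → ℝ => z (inr a)) z := fun a =>
    hf.differentiableAt (contDiffOn_coord _) hz
  have hm : ∀ α β, DifferentiableAt ℝ (metric f α β) z := fun _ _ =>
    hf.differentiableAt (hf.contDiffOn_metric _ _) hz
  have hs : ∀ α, DifferentiableAt ℝ (spray f α) z := fun _ =>
    hf.differentiableAt (hf.contDiffOn_spray _) hz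
  have hl : ∀ μ α β, DifferentiableAt ℝ (lowerChr f μ α β) z := fun _ _ _ =>
    hf.differentiableAt (hf.contDiffOn_lowerChr _ _ _) hz
  have hC : ∀ μ α β, DifferentiableAt ℝ (cartan f μ α β) z := fun _ _ _ =>
    hf.differentiableAt (hf.contDiffOn_cartan _ _ _) hz
  have hN : ∀ α β, DifferentiableAt ℝ (nonlin f α β) z := fun _ _ =>
    hf.differentiableAt (hf.contDiffOn_nonlin _ _) hz
  refine congrFun (hf.eq_of_sum_metric_mul hz (a := fun ν => pd (inr β) (nonlin f ν α) z)
    (b := fun ν => berwald f ν α β z) fun γ => ?_) ν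
  -- Differentiating the lowered N gives γ_{γαβ}, a t-derivative of C along s, a term ∂C·G and terms
  -- C·N. The symmetry of ∂C/∂s turns ∂C_{γαε}/∂s^β G^ε into ∂C_{γαβ}/∂s^ε G^ε, so that the
  -- derivative of C_{γαβ} along the spray appears.
  have h1 := pd_congr_of_eqOn hf.isOpen hz
    (fun z hz => hf.sum_metric_mul_nonlin hz γ α) (inr β)
  rw [pd_sum (fun a _ => (hm _ _).fun_mul (hN _ _)), pd_sub
    (DifferentiableAt.fun_sum fun _ _ => (hl _ _ _).fun_mul (hc _))
    ((DifferentiableAt.fun_sum fun _ _ => (hC _ _ _).fun_mul (hs _)).const_mul _),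
    pd_sum fun _ _ => (hl _ _ _).fun_mul (hc _),
    pd_const_mul (DifferentiableAt.fun_sum fun _ _ => (hC _ _ _).fun_mul (hs _)),
    pd_sum fun _ _ => (hC _ _ _).fun_mul (hs _)] at h1
  simp only [pd_mul (hl γ _ _) (hc _), pd_mul (hm _ _) (hN _ _), pd_mul (hC _ _ _) (hs _),
    hf.pd_lowerChr hz, pd_metric_inr, pd_coord, inr.injEq, hf.pd_spray hz, add_mul, sub_mul,
    Finset.sum_add_distrib, Finset.sum_sub_distrib, hf.sum_pd_cartan_mul' hz, mul_ite, mul_one,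
    mul_zero, Finset.sum_ite_eq', Finset.mem_univ, if_true, mul_assoc (2 : ℝ),
    ← Finset.mul_sum, hf.pd_cartan_inr_comm hz γ α β] at h1
  -- In the lowered B, the terms with N^ε_γ coming from Γ and from C_{|μ}s^μ cancel, while those
  -- with N^ε_α and N^ε_β double.
  simp only [berwald, mul_add, Finset.sum_add_distrib, hf.sum_metric_mul_sum_cartanCov hz,
    hf.sum_metric_mul_rund hz, hder_metric, hf.sum_mul_hder hz]
  have e : ∀ a b c : Fin p, ∑ ε, nonlin f ε a z * cartan f b c ε z =
    ∑ ε, cartan f b c ε z * nonlin f ε a z := fun a b c =>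
    Finset.sum_congr rfl fun _ _ => mul_comm _ _
  have e1 : ∑ ε, cartan f ε α β z * nonlin f ε γ z = ∑ ε, cartan f α β ε z * nonlin f ε γ z :=
    Finset.sum_congr rfl fun ε _ => by
      rw [hf.cartan_comm_left hz ε, hf.cartan_comm_right hz α ε]
  have e2 : ∑ ε, cartan f γ ε β z * nonlin f ε α z = ∑ ε, cartan f γ β ε z * nonlin f ε α z :=
    Finset.sum_congr rfl fun ε _ => by rw [hf.cartan_comm_right hz γ ε]
  have e3 : ∑ μ, z (inr μ) * pd (inl μ) (cartan f γ α β) z =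
    ∑ μ, pd (inl μ) (cartan f γ α β) z * z (inr μ) :=
    Finset.sum_congr rfl fun _ _ => mul_comm _ _
  have e4 : ∑ ε, spray f ε z * pd (inr ε) (cartan f γ α β) z =
    ∑ ε, pd (inr ε) (cartan f γ α β) z * spray f ε z :=
    Finset.sum_congr rfl fun _ _ => mul_comm _ _
  simp only [e, e1, e2, e3, e4] at h1 ⊢
  rw [lowerChr] at h1
  linarith

theorem contDiffOn_berwald (hf : IsLocalFinsler f U) (γ α β : Fin p) :
    ContDiffOn ℝ ∞ (berwald f γ α β) U :=
  (hf.contDiffOn_pd (hf.contDiffOn_nonlin γ α) (inr β)).congr fun _ hz => (hf.pd_nonlin hz _ _ _).symm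

/-- B is the fibre Hessian of the spray coefficients; this is the source of its symmetry. -/
theorem berwald_eq_pd_pd_spray (hf : IsLocalFinsler f U) (hz : z ∈ U) (γ α β : Fin p) :
    berwald f γ α β z = pd (inr β) (pd (inr α) (spray f γ)) z := by
  rw [← hf.pd_nonlin hz]
  exact pd_congr_of_eqOn hf.isOpen hz (fun _ hz => (hf.pd_spray hz _ _).symm) _

theorem berwald_comm (hf : IsLocalFinsler f U) (hz : z ∈ U) (γ α β : Fin p) :
    berwald f γ α β z = berwald f γ β α z := by
  rw [hf.berwald_eq_pd_pd_spray hz, hf.berwald_eq_pd_pd_spray hz,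
    pd_comm hf.isOpen (hf.contDiffOn_spray _) hz]

theorem pd_berwald_comm (hf : IsLocalFinsler f U) (hz : z ∈ U) (A : TIdx p) (γ α β : Fin p) :
    pd A (berwald f γ α β) z = pd A (berwald f γ β α) z :=
  pd_congr_of_eqOn hf.isOpen hz (fun _ hz => hf.berwald_comm hz γ α β) A

/-- P is a second fibre derivative of N. Together with `berwaldP_comm_left` this makes P symmetric
in all three lower indices. -/
theorem berwaldP_comm_right (hf : IsLocalFinsler f U) (hz : z ∈ U) (γ α β ε : Fin p) :
    berwaldP f γ α β ε z = berwaldP f γ α ε β z := by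
  rw [berwaldP, berwaldP,
    pd_congr_of_eqOn hf.isOpen hz (fun _ hz => (hf.pd_nonlin hz γ α β).symm),
    pd_congr_of_eqOn hf.isOpen hz (fun _ hz => (hf.pd_nonlin hz γ α ε).symm),
    pd_comm hf.isOpen (hf.contDiffOn_nonlin _ _) hz]

theorem berwaldP_comm_left (hf : IsLocalFinsler f U) (hz : z ∈ U) (γ α β ε : Fin p) :
    berwaldP f γ α β ε z = berwaldP f γ β α ε z :=
  hf.pd_berwald_comm hz (inr ε) γ α β

end IsLocalFinsler

end LocalFinsler

/-! ### The jet adapted frame and the reduction of the curvature to diagonal blocks. -/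

section JetCurvature

open Sum

variable {p n : ℕ} (f : (TIdx p → ℝ) → ℝ) (h : (TIdx n → ℝ) → ℝ)

theorem sum_JIdx {α : Type*} [AddCommMonoid α] (u : JIdx p n → α) :
    ∑ k, u k = ∑ A, u (jT A) + (∑ i, u (jx i) + ∑ A, ∑ i, u (jX A i)) :=
  (Fintype.sum_sum_type u).trans (congrArg₂ _ rfl
    ((Fintype.sum_sum_type _).trans (congrArg₂ _ rfl (Fintype.sum_prod_type _))))

theorem jetFrame_jT_jT (A B : TIdx p) (w : JIdx p n → ℝ) :
    jetFrame f h (jT A) w (jT B) = if B = A then 1 else 0 := by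
  simp [jetFrame, Pi.single_apply]

theorem jetFrame_jT_jx (A : TIdx p) (i : Fin n) (w : JIdx p n → ℝ) :
    jetFrame f h (jT A) w (jx i) = 0 := by
  simp [jetFrame, Pi.single_apply]

theorem jetFrame_jT_jX (A B : TIdx p) (j : Fin n) (w : JIdx p n → ℝ) :
    jetFrame f h (jT A) w (jX B j) = -temporal f j B A w := by
  simp [jetFrame, Pi.single_apply, ite_and, -Fintype.sum_sum_type]

theorem jetFrame_jx_jT (B : TIdx p) (i : Fin n) (w : JIdx p n → ℝ) :
    jetFrame f h (jx i) w (jT B) = 0 := by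
  simp [jetFrame, Pi.single_apply]

theorem jetFrame_jx_jx (i j : Fin n) (w : JIdx p n → ℝ) :
    jetFrame f h (jx i) w (jx j) = if j = i then 1 else 0 := by
  simp [jetFrame, Pi.single_apply]

theorem jetFrame_jx_jX (i : Fin n) (B : TIdx p) (j : Fin n) (w : JIdx p n → ℝ) :
    jetFrame f h (jx i) w (jX B j) = -spatial h j B i w := by
  simp [jetFrame, Pi.single_apply, ite_and, -Fintype.sum_sum_type]

theorem jetFrame_jX (A : TIdx p) (i : Fin n) (w : JIdx p n → ℝ) :
    jetFrame f h (jX A i) w = Pi.single (jX A i) 1 := rfl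

theorem jetFrame_jX_jT (A B : TIdx p) (i : Fin n) (w : JIdx p n → ℝ) :
    jetFrame f h (jX A i) w (jT B) = 0 := by
  simp [jetFrame]

theorem jetFrame_jX_jx (A : TIdx p) (i j : Fin n) (w : JIdx p n → ℝ) :
    jetFrame f h (jX A i) w (jx j) = 0 := by
  simp [jetFrame]

theorem jetFrame_jX_jX (A B : TIdx p) (i j : Fin n) (w : JIdx p n → ℝ) :
    jetFrame f h (jX A i) w (jX B j) = if B = A ∧ j = i then 1 else 0 := by
  simp [jetFrame, Pi.single_apply]

theorem isUnit_frameMatrix_jetFrame (w : JIdx p n → ℝ) :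
    IsUnit (frameMatrix (jetFrame f h) w) := by
  rw [← Matrix.mulVec_injective_iff_isUnit, ← Matrix.coe_mulVecLin, ← LinearMap.ker_eq_bot,
    LinearMap.ker_eq_bot']
  intro a ha
  simp only [Matrix.mulVecLin_apply, frameMatrix_mulVec, sum_JIdx] at ha
  have h1 : ∀ A, a (jT A) = 0 := fun A => by
    have := congrFun ha (jT A)
    simpa [jetFrame_jT_jT, jetFrame_jx_jT, jetFrame_jX_jT, -Fintype.sum_sum_type] using this
  have h2 : ∀ i, a (jx i) = 0 := fun i => by
    have := congrFun ha (jx i)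
    simpa [jetFrame_jT_jx, jetFrame_jx_jx, jetFrame_jX_jx] using this
  have h3 : ∀ A i, a (jX A i) = 0 := fun A i => by
    have := congrFun ha (jX A i)
    simpa [h1, h2, jetFrame_jX_jX, ite_and, -Fintype.sum_sum_type] using this
  funext k
  rcases k with A | i | ⟨A, i⟩
  exacts [h1 A, h2 i, h3 A i]

/-- A vector field without components along `∂/∂T` and `∂/∂x` is a combination of the `∂/∂X`. -/
theorem frameComp_jetFrame_of_vertical {V : (JIdx p n → ℝ) → (JIdx p n → ℝ)} {w : JIdx p n → ℝ}
    (hT : ∀ A, V w (jT A) = 0) (hx : ∀ i, V w (jx i) = 0) (k : JIdx p n) :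
    frameComp (jetFrame f h) V k w = V w k := by
  refine frameComp_eq_of_eq_sum (isUnit_frameMatrix_jetFrame f h w) ?_ k
  funext k
  rw [sum_JIdx]
  rcases k with A | i | ⟨A, i⟩
  · simp [hT, hx, jetFrame_jX_jT]
  · simp [hT, hx, jetFrame_jX_jx]
  · simp [hT, hx, jetFrame_jX_jX, ite_and, -Fintype.sum_sum_type]

theorem lieBracket_jetFrame_jT (b c : JIdx p n) (A : TIdx p) (w : JIdx p n → ℝ) :
    VectorField.lieBracket ℝ (jetFrame f h c) (jetFrame f h b) w (jT A) = 0 := by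
  have : ∀ b : JIdx p n, ∃ v : ℝ, ∀ w, jetFrame f h b w (jT A) = v := by
    rintro (B | i | ⟨B, i⟩)
    exacts [⟨_, jetFrame_jT_jT f h B A⟩, ⟨_, jetFrame_jx_jT f h A i⟩, ⟨_, jetFrame_jX_jT f h B A i⟩]
  obtain ⟨v, hv⟩ := this c
  obtain ⟨v', hv'⟩ := this b
  exact lieBracket_apply_of_const hv hv' w

theorem lieBracket_jetFrame_jx (b c : JIdx p n) (i : Fin n) (w : JIdx p n → ℝ) :
    VectorField.lieBracket ℝ (jetFrame f h c) (jetFrame f h b) w (jx i) = 0 := by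
  have : ∀ b : JIdx p n, ∃ v : ℝ, ∀ w, jetFrame f h b w (jx i) = v := by
    rintro (B | j | ⟨B, j⟩)
    exacts [⟨_, jetFrame_jT_jx f h B i⟩, ⟨_, jetFrame_jx_jx f h j i⟩, ⟨_, jetFrame_jX_jx f h B j i⟩]
  obtain ⟨v, hv⟩ := this c
  obtain ⟨v', hv'⟩ := this b
  exact lieBracket_apply_of_const hv hv' w

/-- The curvature of the jet Berwald linear d-connection. The torsion of the adapted frame does not
contribute, because it is vertical and the vertical covariant derivatives of the frame vanish. -/
theorem jetCurv_eq (d a b c : JIdx p n) (w : JIdx p n → ℝ) :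
    jetCurv f h d a b c w = fderiv ℝ (jetCoeff f h d a b) w (jetFrame f h c w)
      - fderiv ℝ (jetCoeff f h d a c) w (jetFrame f h b w)
      + ∑ m, jetCoeff f h m a b w * jetCoeff f h d m c w
      - ∑ m, jetCoeff f h m a c w * jetCoeff f h d m b w := by
  rw [jetCurv, curvComp_eq (isUnit_frameMatrix_jetFrame f h), sub_eq_self]
  refine Finset.sum_eq_zero fun m _ => ?_
  rw [frameComp_jetFrame_of_vertical f h (fun A => lieBracket_jetFrame_jT f h b c A w)
    (fun i => lieBracket_jetFrame_jx f h b c i w)]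
  rcases m with A | i | ⟨A, i⟩
  · rw [lieBracket_jetFrame_jT, mul_zero]
  · rw [lieBracket_jetFrame_jx, mul_zero]
  · rcases d with D | d | ⟨D, d⟩ <;> rcases a with E | a | ⟨E, a⟩ <;> simp [jetCoeff]

theorem jetCurv_swap (d a b c : JIdx p n) (w : JIdx p n → ℝ) :
    jetCurv f h d a c b w = -jetCurv f h d a b c w := by
  rw [jetCurv_eq, jetCurv_eq]
  ring

/-- The curvature components with given first two indices vanish in the directions in which the
connection components vanish. -/
theorem jetCurv_eq_zero_of_coeff {d a b c : JIdx p n} (w : JIdx p n → ℝ)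
    (hb : jetCoeff f h d a b = fun _ => 0) (hc : jetCoeff f h d a c = fun _ => 0)
    (h1 : ∀ m, jetCoeff f h m a b w * jetCoeff f h d m c w = 0)
    (h2 : ∀ m, jetCoeff f h m a c w * jetCoeff f h d m b w = 0) :
    jetCurv f h d a b c w = 0 := by
  simp [jetCurv_eq, hb, hc, h1, h2]

/-- D preserves the spans of the δ/δT, of the δ/δx and of the ∂/∂X, so curvature has no component
from one span to another. The next five lemmas hold for the same reason. -/
theorem jetCurv_jT_jx (A i b c) (w : JIdx p n → ℝ) : jetCurv f h (jT A) (jx i) b c w = 0 := by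
  apply jetCurv_eq_zero_of_coeff <;> try rintro (m | m | m)
  all_goals simp [jetCoeff]

theorem jetCurv_jT_jX (A B i b c) (w : JIdx p n → ℝ) : jetCurv f h (jT A) (jX B i) b c w = 0 := by
  apply jetCurv_eq_zero_of_coeff <;> try rintro (m | m | m)
  all_goals simp [jetCoeff]

theorem jetCurv_jx_jT (A i b c) (w : JIdx p n → ℝ) : jetCurv f h (jx i) (jT A) b c w = 0 := by
  apply jetCurv_eq_zero_of_coeff <;> try rintro (m | m | m)
  all_goals simp [jetCoeff]

theorem jetCurv_jx_jX (B j i b c) (w : JIdx p n → ℝ) : jetCurv f h (jx j) (jX B i) b c w = 0 := by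
  apply jetCurv_eq_zero_of_coeff <;> try rintro (m | m | m)
  all_goals simp [jetCoeff]

theorem jetCurv_jX_jT (A B i b c) (w : JIdx p n → ℝ) : jetCurv f h (jX B i) (jT A) b c w = 0 := by
  apply jetCurv_eq_zero_of_coeff <;> try rintro (m | m | m)
  all_goals simp [jetCoeff]

theorem jetCurv_jX_jx (B j i b c) (w : JIdx p n → ℝ) : jetCurv f h (jX B i) (jx j) b c w = 0 := by
  apply jetCurv_eq_zero_of_coeff <;> try rintro (m | m | m)
  all_goals simp [jetCoeff]

/-! #### Derivatives of source and target objects -/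

theorem fderiv_comp_srcPt {u : (TIdx p → ℝ) → ℝ} {w : JIdx p n → ℝ}
    (hu : DifferentiableAt ℝ u (srcPt w)) (v : JIdx p n → ℝ) :
    fderiv ℝ (fun w : JIdx p n → ℝ => u (srcPt w)) w v =
      ∑ A, v (jT A) * pd A u (srcPt w) := by
  have hs : HasFDerivAt (srcPt : (JIdx p n → ℝ) → TIdx p → ℝ)
      (ContinuousLinearMap.pi fun A => (ContinuousLinearMap.proj (jT A) : (JIdx p n → ℝ) →L[ℝ] ℝ))
      w :=
    (ContinuousLinearMap.pi fun A =>
      (ContinuousLinearMap.proj (jT A) : (JIdx p n → ℝ) →L[ℝ] ℝ)).hasFDerivAt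
  rw [show (fun w : JIdx p n → ℝ => u (srcPt w)) = u ∘ srcPt from rfl,
    (hu.hasFDerivAt.comp w hs).fderiv, ContinuousLinearMap.comp_apply, fderiv_apply_eq_sum_pd]
  rfl

/-- The target velocity y_a s^a is bilinear, so it varies both with y and with s; the coordinates
x^i_α do not enter. -/
theorem fderiv_comp_tgtPt {u : (TIdx n → ℝ) → ℝ} {w : JIdx p n → ℝ}
    (hu : DifferentiableAt ℝ u (tgtPt w)) (v : JIdx p n → ℝ) :
    fderiv ℝ (fun w : JIdx p n → ℝ => u (tgtPt w)) w v =
      ∑ l, v (jx l) * pd (inl l) u (tgtPt w)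
        + ∑ l, (∑ a, (v (jy a l) * w (js a) + w (jy a l) * v (js a))) *
          pd (inr l) u (tgtPt w) := by
  have hs : HasFDerivAt (tgtPt : (JIdx p n → ℝ) → TIdx n → ℝ)
      (ContinuousLinearMap.pi (Sum.elim (fun l => ContinuousLinearMap.proj (jx l))
        (fun l => ∑ a, (w (jy a l) • (ContinuousLinearMap.proj (js a) : (JIdx p n → ℝ) →L[ℝ] ℝ)
          + w (js a) • (ContinuousLinearMap.proj (jy a l) : (JIdx p n → ℝ) →L[ℝ] ℝ))))) w := by
    refine (hasFDerivAt_pi (φ := fun A w => tgtPt w A)).2 fun A => ?_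
    rcases A with l | l
    · exact hasFDerivAt_apply (jx l) w
    · change HasFDerivAt (fun w : JIdx p n → ℝ => ∑ a, w (jy a l) * w (js a)) _ w
      exact HasFDerivAt.fun_sum fun a _ =>
        (hasFDerivAt_apply (𝕜 := ℝ) (jy a l) w).fun_mul (hasFDerivAt_apply (𝕜 := ℝ) (js a) w)
  rw [show (fun w : JIdx p n → ℝ => u (tgtPt w)) = u ∘ tgtPt from rfl,
    (hu.hasFDerivAt.comp w hs).fderiv, ContinuousLinearMap.comp_apply, fderiv_apply_eq_sum_pd,
    Fintype.sum_sum_type]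
  congr 1
  refine Finset.sum_congr rfl fun l _ => ?_
  congr 1
  simp only [ContinuousLinearMap.coe_pi', Sum.elim_inr, _root_.sum_apply,
    add_apply, smul_apply, ContinuousLinearMap.proj_apply,
    smul_eq_mul]
  exact Finset.sum_congr rfl fun a _ => by ring

end JetCurvature

/-! ### The three diagonal blocks of the curvature. -/

section JetCurvature

open Sum

variable {p n : ℕ}

/-- On functions of (t, s) the derivation δ/δT^A is ∂/∂T^A. -/
theorem jetFrame_comp_jT (f : (TIdx p → ℝ) → ℝ) (h : (TIdx n → ℝ) → ℝ) (A : TIdx p)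
    (w : JIdx p n → ℝ) (u : TIdx p → ℝ) :
    ∑ B, jetFrame f h (jT A) w (jT B) * u B = u A := by
  simp [jetFrame_jT_jT, -Fintype.sum_sum_type]

/-- The curvature of the linear connection on `TM` with the coefficients `Γ` in the coordinate
frame. -/
def coordCurv (Γ : TIdx p → TIdx p → TIdx p → (TIdx p → ℝ) → ℝ) (D A B C : TIdx p)
    (z : TIdx p → ℝ) : ℝ :=
  pd C (Γ D A B) z - pd B (Γ D A C) z + ∑ M, Γ M A B z * Γ D M C z - ∑ M, Γ M A C z * Γ D M B z

theorem IsLocalFinsler.contDiffOn_normalCoeff {f : (TIdx p → ℝ) → ℝ} {U : Set (TIdx p → ℝ)}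
    (hf : IsLocalFinsler f U) (C A B : TIdx p) : ContDiffOn ℝ ∞ (normalCoeff f C A B) U := by
  rcases C with γ | c <;> rcases A with α | a <;> rcases B with β | b
  · rw [normalCoeff_inl_inl_inl]; exact hf.contDiffOn_berwald _ _ _
  · rw [normalCoeff_inr_right]; exact contDiffOn_const
  · rw [normalCoeff_inl_inr_inl]; exact contDiffOn_const
  · rw [normalCoeff_inr_right]; exact contDiffOn_const
  · rw [normalCoeff_inr_inl_inl]
    exact ((hf.contDiffOn_pd (hf.contDiffOn_nonlin _ _) _).add (ContDiffOn.sum fun _ _ =>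
      (hf.contDiffOn_nonlin _ _).mul (hf.contDiffOn_berwald _ _ _))).sub (ContDiffOn.sum fun _ _ =>
      (hf.contDiffOn_nonlin _ _).mul (hf.contDiffOn_berwald _ _ _))
  · rw [normalCoeff_inr_inl_inr]; exact hf.contDiffOn_pd (hf.contDiffOn_nonlin _ _) _
  · rw [normalCoeff_inr_inr_inl]; exact hf.contDiffOn_berwald _ _ _
  · rw [normalCoeff_inr_inr_inr]; exact contDiffOn_const

variable {f : (TIdx p → ℝ) → ℝ} {h : (TIdx n → ℝ) → ℝ} {w : JIdx p n → ℝ}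

/-! #### The curvature on `δ/δT` -/

theorem jetCurv_jT_jT (hΓ : ∀ D A B, DifferentiableAt ℝ (normalCoeff f D A B) (srcPt w))
    (D A B C : TIdx p) :
    jetCurv f h (jT D) (jT A) (jT B) (jT C) w = coordCurv (normalCoeff f) D A B C (srcPt w) := by
  have h0 : ∀ D A B, jetCoeff f h (jT D) (jT A) (jT B) = fun w => normalCoeff f D A B (srcPt w) :=
    fun _ _ _ => rfl
  rw [jetCurv_eq, h0, h0, fderiv_comp_srcPt (hΓ _ _ _), fderiv_comp_srcPt (hΓ _ _ _),
    jetFrame_comp_jT, jetFrame_comp_jT, coordCurv, sum_JIdx, sum_JIdx]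
  simp [jetCoeff, -Fintype.sum_sum_type]

theorem jetCurv_jT_jT_jx (hΓ : ∀ D A B, DifferentiableAt ℝ (normalCoeff f D A B) (srcPt w))
    (D A : TIdx p) (b : JIdx p n) (k : Fin n) :
    jetCurv f h (jT D) (jT A) b (jx k) w = 0 := by
  rcases b with B | i | ⟨B, i⟩
  · have h0 : jetCoeff f h (jT D) (jT A) (.inl B) = fun w => normalCoeff f D A B (srcPt w) := rfl
    rw [jetCurv_eq, h0, fderiv_comp_srcPt (hΓ _ _ _), sum_JIdx, sum_JIdx]
    simp [jetCoeff, jetFrame_jx_jT, -Fintype.sum_sum_type]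
  all_goals
    rw [jetCurv_eq, sum_JIdx, sum_JIdx]
    simp [jetCoeff]

theorem jetCurv_jT_jT_jX (hΓ : ∀ D A B, DifferentiableAt ℝ (normalCoeff f D A B) (srcPt w))
    (D A C : TIdx p) (b : JIdx p n) (k : Fin n) :
    jetCurv f h (jT D) (jT A) b (jX C k) w = 0 := by
  rcases b with B | i | ⟨B, i⟩
  · have h0 : jetCoeff f h (jT D) (jT A) (.inl B) = fun w => normalCoeff f D A B (srcPt w) := rfl
    rw [jetCurv_eq, h0, fderiv_comp_srcPt (hΓ _ _ _), sum_JIdx, sum_JIdx]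
    simp [jetCoeff, jetFrame_jX_jT, -Fintype.sum_sum_type]
  all_goals
    rw [jetCurv_eq, sum_JIdx, sum_JIdx]
    simp [jetCoeff]

/-! #### The curvature on `δ/δx` -/

theorem jetCurv_jx_jx_jT_jT (l i : Fin n) (B C : TIdx p) :
    jetCurv f h (jx l) (jx i) (jT B) (jT C) w = 0 := by
  rw [jetCurv_eq, sum_JIdx, sum_JIdx]
  simp [jetCoeff]

theorem jetCurv_jx_jx_jT_jX (l i k : Fin n) (B C : TIdx p) :
    jetCurv f h (jx l) (jx i) (jT B) (jX C k) w = 0 := by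
  rw [jetCurv_eq, sum_JIdx, sum_JIdx]
  simp [jetCoeff]

theorem jetCurv_jx_jx_jX_jX (l i j k : Fin n) (B C : TIdx p) :
    jetCurv f h (jx l) (jx i) (jX B j) (jX C k) w = 0 := by
  rw [jetCurv_eq, sum_JIdx, sum_JIdx]
  simp [jetCoeff]

theorem jetCurv_jx_jx_jT_jx (l i k : Fin n) (B : TIdx p) :
    jetCurv f h (jx l) (jx i) (jT B) (jx k) w =
      -fderiv ℝ (fun w : JIdx p n → ℝ => berwald h l i k (tgtPt w)) w (jetFrame f h (jT B) w) := by
  rw [jetCurv_eq, sum_JIdx, sum_JIdx]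
  simp [jetCoeff]

theorem jetCurv_jx_jx_jx_jx (l i j k : Fin n) :
    jetCurv f h (jx l) (jx i) (jx j) (jx k) w =
      fderiv ℝ (fun w : JIdx p n → ℝ => berwald h l i j (tgtPt w)) w (jetFrame f h (jx k) w)
      - fderiv ℝ (fun w : JIdx p n → ℝ => berwald h l i k (tgtPt w)) w (jetFrame f h (jx j) w)
      + ∑ m, berwald h m i j (tgtPt w) * berwald h l m k (tgtPt w)
      - ∑ m, berwald h m i k (tgtPt w) * berwald h l m j (tgtPt w) := by
  rw [jetCurv_eq, sum_JIdx, sum_JIdx]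
  simp [jetCoeff]

theorem jetCurv_jx_jx_jx_jX (l i j k : Fin n) (C : TIdx p) :
    jetCurv f h (jx l) (jx i) (jx j) (jX C k) w =
      fderiv ℝ (fun w : JIdx p n → ℝ => berwald h l i j (tgtPt w)) w (Pi.single (jX C k) 1) := by
  rw [jetCurv_eq, sum_JIdx, sum_JIdx]
  simp [jetCoeff, jetFrame_jX]

/-! #### The curvature on `∂/∂X` -/

theorem fderiv_ite_const (P : Prop) [Decidable P] (u : (JIdx p n → ℝ) → ℝ) (v : JIdx p n → ℝ) :
    fderiv ℝ (fun w => if P then u w else 0) w v = if P then fderiv ℝ u w v else 0 := by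
  split_ifs <;> simp

/-- Along δ/δT the coefficients on ∂/∂X are those of the dual of the connection with transposed
lower indices. Passing to a dual connection exchanges the two frame indices of the curvature and
changes its sign. -/
theorem jetCurv_jX_jX (hΓ : ∀ D A B, DifferentiableAt ℝ (normalCoeff f D A B) (srcPt w))
    (D A B C : TIdx p) (l i : Fin n) :
    jetCurv f h (jX D l) (jX A i) (jT B) (jT C) w =
      -(if l = i then 1 else 0) * coordCurv (fun D A B => normalCoeff f D B A) A D B C (srcPt w) := by
  have h0 : ∀ D A B, jetCoeff f h (jX D l) (jX A i) (jT B) =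
      fun w => if l = i then -normalCoeff f A B D (srcPt w) else 0 :=
    fun _ _ _ => rfl
  have h1 : ∀ D A B v, fderiv ℝ (fun w : JIdx p n → ℝ => -normalCoeff f D A B (srcPt w)) w v =
      -∑ A', v (jT A') * pd A' (normalCoeff f D A B) (srcPt w) := fun D A B v => by
    rw [fderiv_fun_neg, neg_apply, fderiv_comp_srcPt (hΓ _ _ _)]
  rw [jetCurv_eq, h0, h0, fderiv_ite_const, fderiv_ite_const, h1, h1,
    jetFrame_comp_jT, jetFrame_comp_jT, coordCurv, sum_JIdx, sum_JIdx]
  by_cases hli : l = i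
  · subst hli
    simp [jetCoeff, -Fintype.sum_sum_type, mul_comm]
    ring
  · simp [jetCoeff, -Fintype.sum_sum_type, hli]

theorem jetCurv_jX_jX_jT_jX (hΓ : ∀ D A B, DifferentiableAt ℝ (normalCoeff f D A B) (srcPt w))
    (D A B C : TIdx p) (l i k : Fin n) :
    jetCurv f h (jX D l) (jX A i) (jT B) (jX C k) w = 0 := by
  have h0 : ∀ D A B, jetCoeff f h (jX D l) (jX A i) (jT B) =
      fun w => if l = i then -normalCoeff f A B D (srcPt w) else 0 :=
    fun _ _ _ => rfl
  rw [jetCurv_eq, h0, fderiv_ite_const, sum_JIdx, sum_JIdx, fderiv_fun_neg,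
    neg_apply, fderiv_comp_srcPt (hΓ _ _ _)]
  simp [jetCoeff, -Fintype.sum_sum_type, jetFrame_jX_jT]

theorem jetCurv_jX_jX_jX_jX (D A B C : TIdx p) (l i j k : Fin n) :
    jetCurv f h (jX D l) (jX A i) (jX B j) (jX C k) w = 0 := by
  rw [jetCurv_eq, sum_JIdx, sum_JIdx]
  simp [jetCoeff]

/-- Along δ/δT the coefficients act on the index A, along δ/δx on the index i, so the quadratic
terms cancel. Since δ/δx annihilates functions of (t, s), only the derivative of B̃ along δ/δT
survives. -/
theorem jetCurv_jX_jX_jT_jx (hΓ : ∀ D A B, DifferentiableAt ℝ (normalCoeff f D A B) (srcPt w))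
    (D A B : TIdx p) (l i k : Fin n) :
    jetCurv f h (jX D l) (jX A i) (jT B) (jx k) w =
      (if A = D then 1 else 0) * jetCurv f h (jx l) (jx i) (jT B) (jx k) w := by
  have h0 : ∀ D A B, jetCoeff f h (jX D l) (jX A i) (jT B) =
      fun w => if l = i then -normalCoeff f A B D (srcPt w) else 0 :=
    fun _ _ _ => rfl
  have h2 : ∀ D A k, jetCoeff f h (jX D l) (jX A i) (jx k) =
      fun w => if D = A then berwald h l i k (tgtPt w) else 0 :=
    fun _ _ _ => rfl
  rw [jetCurv_jx_jx_jT_jx, jetCurv_eq, h0, h2, fderiv_ite_const, fderiv_ite_const, sum_JIdx,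
    sum_JIdx, fderiv_fun_neg, neg_apply, fderiv_comp_srcPt (hΓ _ _ _)]
  simp [jetCoeff, -Fintype.sum_sum_type, jetFrame_jx_jT, mul_comm, eq_comm]

theorem jetCurv_jX_jX_jx_jx (D A : TIdx p) (l i j k : Fin n) :
    jetCurv f h (jX D l) (jX A i) (jx j) (jx k) w =
      (if A = D then 1 else 0) * jetCurv f h (jx l) (jx i) (jx j) (jx k) w := by
  have h2 : ∀ D A k, jetCoeff f h (jX D l) (jX A i) (jx k) =
      fun w => if D = A then berwald h l i k (tgtPt w) else 0 :=
    fun _ _ _ => rfl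
  rw [jetCurv_jx_jx_jx_jx, jetCurv_eq, h2, h2, fderiv_ite_const, fderiv_ite_const, sum_JIdx,
    sum_JIdx]
  by_cases hAD : A = D
  · subst hAD
    simp [jetCoeff, -Fintype.sum_sum_type]
  · simp [jetCoeff, -Fintype.sum_sum_type, hAD, Ne.symm hAD]

theorem jetCurv_jX_jX_jx_jX (D A C : TIdx p) (l i j k : Fin n) :
    jetCurv f h (jX D l) (jX A i) (jx j) (jX C k) w =
      (if A = D then 1 else 0) * jetCurv f h (jx l) (jx i) (jx j) (jX C k) w := by
  have h2 : ∀ D A k, jetCoeff f h (jX D l) (jX A i) (jx k) =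
      fun w => if D = A then berwald h l i k (tgtPt w) else 0 :=
    fun _ _ _ => rfl
  rw [jetCurv_jx_jx_jx_jX, jetCurv_eq, h2, fderiv_ite_const, sum_JIdx, sum_JIdx]
  simp [jetCoeff, -Fintype.sum_sum_type, jetFrame_jX, eq_comm]

end JetCurvature

/-! ### The Berwald curvature in the coordinate frame of TM, and that of the transposed
coefficients. -/

section CurvatureFormulas

open Sum

variable {p n : ℕ}

namespace IsLocalFinsler

variable {f : (TIdx p → ℝ) → ℝ} {U : Set (TIdx p → ℝ)} {z : TIdx p → ℝ}

theorem normalCoeff_apply (hf : IsLocalFinsler f U) (hz : z ∈ U) (c α b : Fin p) :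
    normalCoeff f (inr c) (inl α) (inr b) z = berwald f c α b z := by
  rw [normalCoeff_inr_inl_inr, hf.pd_nonlin hz]

theorem pd_normalCoeff (hf : IsLocalFinsler f U) (hz : z ∈ U) (A : TIdx p) (c α b : Fin p) :
    pd A (normalCoeff f (inr c) (inl α) (inr b)) z = pd A (berwald f c α b) z :=
  pd_congr_of_eqOn hf.isOpen hz (fun _ hz => hf.normalCoeff_apply hz c α b) A

/-- Replacing ∂/∂t by δ/δt + N ∂/∂s is the origin of the P·N terms accompanying R. -/
theorem pd_inl_berwald (f : (TIdx p → ℝ) → ℝ) (α β γ ε : Fin p) (z : TIdx p → ℝ) :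
    pd (inl ε) (berwald f α β γ) z =
      hder f ε (berwald f α β γ) z + ∑ c, berwaldP f α β γ c z * nonlin f c ε z := by
  rw [hder, sub_add_eq_add_sub, eq_sub_iff_add_eq]
  congr 1
  exact Finset.sum_congr rfl fun c _ => by rw [berwaldP, mul_comm]

/-! #### The curvature of the Berwald connection in the coordinate frame -/

theorem coordCurv_tttt (f : (TIdx p → ℝ) → ℝ) (z : TIdx p → ℝ) (δ α β γ : Fin p) :
    coordCurv (normalCoeff f) (inl δ) (inl α) (inl β) (inl γ) z = berwaldR f δ α β γ z
      + ∑ c, berwaldP f δ α β c z * nonlin f c γ z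
      - ∑ c, berwaldP f δ α γ c z * nonlin f c β z := by
  simp [coordCurv, normalCoeff_inl_inl_inl, normalCoeff_inl_inr_inl, pd_inl_berwald, berwaldR]
  ring

theorem coordCurv_sttt (f : (TIdx p → ℝ) → ℝ) (z : TIdx p → ℝ) (d α β γ : Fin p) :
    coordCurv (normalCoeff f) (inr d) (inl α) (inl β) (inl γ) z =
      alt (fun β γ => pd (inl γ) (nonlinCov f d α β) z
        + ∑ c, nonlinCov f c α β z * berwald f d c γ z
        - ∑ μ, nonlinCov f d μ β z * berwald f μ α γ z) β γ := by
  simp [coordCurv, normalCoeff_inl_inl_inl, normalCoeff_inr_inl_inl, normalCoeff_inr_inr_inl, alt,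
    mul_comm]
  ring

theorem coordCurv_ttts (f : (TIdx p → ℝ) → ℝ) (z : TIdx p → ℝ) (δ α β c : Fin p) :
    coordCurv (normalCoeff f) (inl δ) (inl α) (inl β) (inr c) z = berwaldP f δ α β c z := by
  simp [coordCurv, normalCoeff_inl_inl_inl, normalCoeff_inl_inr_inl, normalCoeff_inr_right,
    pd_const, berwaldP]

theorem coordCurv_stts (hf : IsLocalFinsler f U) (hz : z ∈ U) (d α β c : Fin p) :
    coordCurv (normalCoeff f) (inr d) (inl α) (inl β) (inr c) z =
      pd (inr c) (nonlinCov f d α β) z - pd (inl β) (berwald f d α c) z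
        + ∑ μ, berwald f μ α β z * berwald f d μ c z
        - ∑ e, berwald f e α c z * berwald f d e β z := by
  simp [coordCurv, normalCoeff_inl_inl_inl, normalCoeff_inr_inl_inl, normalCoeff_inr_inr_inl,
    normalCoeff_inr_right, normalCoeff_inr_inr_inr, hf.pd_normalCoeff hz, hf.normalCoeff_apply hz]

theorem coordCurv_sstt (f : (TIdx p → ℝ) → ℝ) (z : TIdx p → ℝ) (d a β γ : Fin p) :
    coordCurv (normalCoeff f) (inr d) (inr a) (inl β) (inl γ) z = berwaldR f d a β γ z
      + ∑ c, berwaldP f d a β c z * nonlin f c γ z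
      - ∑ c, berwaldP f d a γ c z * nonlin f c β z := by
  simp [coordCurv, normalCoeff_inr_inr_inl, normalCoeff_inl_inr_inl, pd_inl_berwald, berwaldR]
  ring

theorem coordCurv_ssts (f : (TIdx p → ℝ) → ℝ) (z : TIdx p → ℝ) (d a β c : Fin p) :
    coordCurv (normalCoeff f) (inr d) (inr a) (inl β) (inr c) z = berwaldP f d a β c z := by
  simp [coordCurv, normalCoeff_inr_inr_inl, normalCoeff_inl_inr_inl, normalCoeff_inr_right,
    normalCoeff_inr_inr_inr, pd_const, berwaldP]

/-- The Berwald connection preserves the vertical distribution. -/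
theorem coordCurv_ts (f : (TIdx p → ℝ) → ℝ) (z : TIdx p → ℝ) (δ a : Fin p) (B C : TIdx p) :
    coordCurv (normalCoeff f) (inl δ) (inr a) B C z = 0 := by
  rcases B with β | b <;> rcases C with γ | c <;>
  simp [coordCurv, normalCoeff_inl_inr_inl, normalCoeff_inr_right, pd_const]

/-- The only coefficient with last index of kind s that need not vanish is ∂N^d_α/∂s^b = B^d_{αb},
and its antisymmetrised fibre derivative vanishes by the symmetry of P. -/
theorem coordCurv_ss_right (hf : IsLocalFinsler f U) (hz : z ∈ U) (D A : TIdx p) (b c : Fin p) :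
    coordCurv (normalCoeff f) D A (inr b) (inr c) z = 0 := by
  rcases D with δ | d <;> rcases A with α | a
  · simp [coordCurv, normalCoeff_inr_right, pd_const]
  · simp [coordCurv, normalCoeff_inr_right, pd_const]
  · have := hf.berwaldP_comm_right hz d α b c
    simp [coordCurv, normalCoeff_inr_right, normalCoeff_inr_inr_inr, pd_const,
      hf.pd_normalCoeff hz]
    exact sub_eq_zero.2 this
  · simp [coordCurv, normalCoeff_inr_right, normalCoeff_inr_inr_inr, pd_const]

/-! #### The curvature of the transposed coefficients -/

/-- Transposition is harmless here because B is symmetric. -/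
theorem coordCurv_flip_tttt (hf : IsLocalFinsler f U) (hz : z ∈ U) (δ α β γ : Fin p) :
    coordCurv (fun D A B => normalCoeff f D B A) (inl δ) (inl α) (inl β) (inl γ) z =
      coordCurv (normalCoeff f) (inl δ) (inl α) (inl β) (inl γ) z := by
  simp [coordCurv, normalCoeff_inl_inl_inl, normalCoeff_inl_inr_inl, normalCoeff_inr_right,
    hf.pd_berwald_comm hz _ δ _ α, hf.berwald_comm hz _ _ α, hf.berwald_comm hz δ _ _]

theorem coordCurv_flip_ttts (hf : IsLocalFinsler f U) (hz : z ∈ U) (δ α β c : Fin p) :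
    coordCurv (fun D A B => normalCoeff f D B A) (inl δ) (inl α) (inl β) (inr c) z =
      berwaldP f δ α β c z := by
  simp [coordCurv, normalCoeff_inl_inl_inl, normalCoeff_inl_inr_inl, normalCoeff_inr_right,
    pd_const, hf.pd_berwald_comm hz _ δ β α, berwaldP, hf.normalCoeff_apply hz]

/-- N^a_{α:β} is not symmetric in its lower indices, so here transposition gives a genuinely
different expression, with N_{β:ε} in place of N_{ε:β}. -/
theorem coordCurv_flip_sttt (hf : IsLocalFinsler f U) (hz : z ∈ U) (a ε β γ : Fin p) :
    coordCurv (fun D A B => normalCoeff f D B A) (inr a) (inl ε) (inl β) (inl γ) z =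
      alt (fun β γ => pd (inl γ) (nonlinCov f a β ε) z
        + ∑ c, nonlinCov f c β ε z * berwald f a c γ z
        - ∑ μ, nonlinCov f a β μ z * berwald f μ ε γ z) β γ := by
  simp [coordCurv, normalCoeff_inl_inl_inl, normalCoeff_inr_inl_inl, normalCoeff_inr_inr_inl, alt,
    hf.normalCoeff_apply hz, hf.berwald_comm hz _ _ ε]
  simp only [hf.berwald_comm hz a γ, hf.berwald_comm hz a β, mul_comm (berwald f _ ε _ z)]
  ring

theorem coordCurv_flip_stts (hf : IsLocalFinsler f U) (hz : z ∈ U) (a ε β c : Fin p) :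
    coordCurv (fun D A B => normalCoeff f D B A) (inr a) (inl ε) (inl β) (inr c) z =
      pd (inr c) (nonlinCov f a β ε) z - pd (inl β) (berwald f a c ε) z
        + ∑ μ, berwald f μ β ε z * berwald f a μ c z
        - ∑ d, berwald f d c ε z * berwald f a d β z := by
  simp [coordCurv, normalCoeff_inl_inl_inl, normalCoeff_inr_inl_inl, normalCoeff_inr_inr_inl,
    normalCoeff_inr_right, normalCoeff_inr_inr_inr, hf.pd_normalCoeff hz, hf.normalCoeff_apply hz,
    normalCoeff_inl_inr_inl]
  simp only [hf.berwald_comm hz a c, hf.berwald_comm hz a β]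

/-- The transposed coefficient is ᵇΓ^d_{βa} = ∂N^d_β/∂s^a, which is again B; so the s-block repeats
the t-block. -/
theorem coordCurv_flip_sstt (hf : IsLocalFinsler f U) (hz : z ∈ U) (d a β γ : Fin p) :
    coordCurv (fun D A B => normalCoeff f D B A) (inr d) (inr a) (inl β) (inl γ) z =
      coordCurv (normalCoeff f) (inl d) (inl a) (inl β) (inl γ) z := by
  simp [coordCurv, normalCoeff_inr_inr_inl, normalCoeff_inl_inr_inl, normalCoeff_inl_inl_inl,
    hf.pd_normalCoeff hz, hf.normalCoeff_apply hz, normalCoeff_inr_right]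
  simp only [hf.berwald_comm hz d β, hf.berwald_comm hz d γ, hf.berwald_comm hz _ β a,
    hf.berwald_comm hz _ γ a, hf.pd_berwald_comm hz _ d β, hf.pd_berwald_comm hz _ d γ]

theorem coordCurv_flip_ssts (hf : IsLocalFinsler f U) (hz : z ∈ U) (d a β c : Fin p) :
    coordCurv (fun D A B => normalCoeff f D B A) (inr d) (inr a) (inl β) (inr c) z =
      berwaldP f d a β c z := by
  simp [coordCurv, normalCoeff_inr_inr_inl, normalCoeff_inl_inr_inl, normalCoeff_inr_right,
    normalCoeff_inr_inr_inr, pd_const, berwaldP, hf.pd_normalCoeff hz,  hf.pd_berwald_comm hz _ d β a]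

theorem coordCurv_flip_ts (f : (TIdx p → ℝ) → ℝ) (z : TIdx p → ℝ) (δ a : Fin p) (B C : TIdx p) :
    coordCurv (fun D A B => normalCoeff f D B A) (inl δ) (inr a) B C z = 0 := by
  rcases B with β | b <;> rcases C with γ | c <;>
  simp [coordCurv, normalCoeff_inl_inr_inl, normalCoeff_inr_right, pd_const]

theorem coordCurv_flip_ss_right (hf : IsLocalFinsler f U) (hz : z ∈ U) (D A : TIdx p)
    (b c : Fin p) :
    coordCurv (fun D A B => normalCoeff f D B A) D A (inr b) (inr c) z = 0 := by
  rcases D with δ | d <;> rcases A with α | a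
  · simp [coordCurv, normalCoeff_inl_inr_inl, normalCoeff_inr_right, pd_const]
  · simp [coordCurv, normalCoeff_inr_right, pd_const]
  · have := hf.berwaldP_comm_right hz d α b c
    rw [hf.berwaldP_comm_left hz d α b, hf.berwaldP_comm_left hz d α c] at this
    simp [coordCurv, normalCoeff_inl_inr_inl, normalCoeff_inr_inr_inr, pd_const,
      normalCoeff_inr_inr_inl]
    exact sub_eq_zero.2 this
  · simp [coordCurv, normalCoeff_inr_right, normalCoeff_inr_inr_inr, pd_const]

end IsLocalFinsler

end CurvatureFormulas

/-! ### Derivatives of the target objects along the jet frame, and the vanishing of all unlisted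
types. -/

section CurvatureFormulas

open Sum

variable {p n : ℕ}

theorem temporal_inr_inr (f : (TIdx p → ℝ) → ℝ) (j : Fin n) (a b : Fin p) (w : JIdx p n → ℝ) :
    temporal f j (inr a) (inr b) w = 0 := by
  simp [temporal, normalCoeff_inr_inr_inr, normalCoeff_inr_right]

theorem IsLocalFinsler.temporal_inr_inl {f : (TIdx p → ℝ) → ℝ} {U : Set (TIdx p → ℝ)}
    {w : JIdx p n → ℝ} (hf : IsLocalFinsler f U) (hw : srcPt w ∈ U) (j : Fin n) (a β : Fin p) :
    temporal f j (inr a) (inl β) w = -∑ c, berwald f c β a (srcPt w) * w (jy c j) := by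
  simp [temporal, normalCoeff_inr_right, hf.normalCoeff_apply hw]

variable {f : (TIdx p → ℝ) → ℝ} {h : (TIdx n → ℝ) → ℝ} {U : Set (TIdx p → ℝ)}
  {V : Set (TIdx n → ℝ)} {w : JIdx p n → ℝ}

/-- The vector δ/δt^β fixes x and s and moves y_a by B^c_{βa} y_c, hence the target velocity by
B^c_{βa} s^a y_c. -/
theorem jetCurv_jx_jx_jt_jx (hf : IsLocalFinsler f U) (hh : IsLocalFinsler h V)
    (hw : srcPt w ∈ U) (hw' : tgtPt w ∈ V) (l i k : Fin n) (β : Fin p) :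
    jetCurv f h (jx l) (jx i) (jt β) (jx k) w = -∑ j, ∑ a, ∑ c,
      berwaldP h l i k j (tgtPt w) * berwald f c β a (srcPt w) * w (js a) * w (jy c j) := by
  rw [jetCurv_jx_jx_jT_jx,
    fderiv_comp_tgtPt (hh.differentiableAt (hh.contDiffOn_berwald _ _ _) hw')]
  simp only [jetFrame_jT_jx, jetFrame_jT_jX, jetFrame_jT_jT, hf.temporal_inr_inl hw, zero_mul,
    Finset.sum_const_zero, zero_add, reduceCtorEq, if_false, mul_zero, add_zero, neg_neg, berwaldP,
    Finset.sum_mul]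
  congr 1
  exact Finset.sum_congr rfl fun j _ => Finset.sum_congr rfl fun a _ =>
    Finset.sum_congr rfl fun c _ => by ring

/-- By `temporal_inr_inr` the vector δ/δs^b leaves y fixed, so it moves the target velocity only
through s^b, by y_b. -/
theorem jetCurv_jx_jx_js_jx (f : (TIdx p → ℝ) → ℝ) (hh : IsLocalFinsler h V)
    (hw' : tgtPt w ∈ V) (l i k : Fin n) (b : Fin p) :
    jetCurv f h (jx l) (jx i) (js b) (jx k) w =
      -∑ j, berwaldP h l i k j (tgtPt w) * w (jy b j) := by
  rw [jetCurv_jx_jx_jT_jx,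
    fderiv_comp_tgtPt (hh.differentiableAt (hh.contDiffOn_berwald _ _ _) hw')]
  simp only [jetFrame_jT_jx, jetFrame_jT_jX, jetFrame_jT_jT, temporal_inr_inr, inr.injEq,
    zero_mul, Finset.sum_const_zero, zero_add, neg_zero, mul_ite, mul_one, mul_zero,
    Finset.sum_ite_eq', Finset.mem_univ, if_true, berwaldP]
  congr 1
  exact Finset.sum_congr rfl fun j _ => mul_comm _ _

/-- The vector δ/δx^k moves x^k and moves the target velocity by −B̃^r_{kq} y^q_b s^b; the
derivative ∂/∂x^k is then split as δ/δx^k + Ñ ∂/∂y. By homogeneity B̃^r_{kq} contracted with the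
velocity is Ñ^r_k, so the two corrections cancel; they are kept to match the shape of the stated
formula. -/
theorem fderiv_berwald_jetFrame_jx (f : (TIdx p → ℝ) → ℝ) (hh : IsLocalFinsler h V)
    (hw' : tgtPt w ∈ V) (l i j k : Fin n) :
    fderiv ℝ (fun w : JIdx p n → ℝ => berwald h l i j (tgtPt w)) w (jetFrame f h (jx k) w) =
      hder h k (berwald h l i j) (tgtPt w)
      + ∑ r, berwaldP h l i j r (tgtPt w) * nonlin h r k (tgtPt w)
      - ∑ q, ∑ b, (∑ r, berwaldP h l i j r (tgtPt w) * berwald h r k q (tgtPt w))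
          * w (jy b q) * w (js b) := by
  rw [fderiv_comp_tgtPt (hh.differentiableAt (hh.contDiffOn_berwald _ _ _) hw'),
    ← IsLocalFinsler.pd_inl_berwald]
  simp only [jetFrame_jx_jx, jetFrame_jx_jX, jetFrame_jx_jT, ite_mul, one_mul, zero_mul,
    Finset.sum_ite_eq', Finset.mem_univ, if_true, mul_zero, add_zero, spatial, neg_mul,
    Finset.sum_neg_distrib, ← sub_eq_add_neg]
  congr 1
  simp only [Finset.sum_mul, berwaldP]
  rw [Finset.sum_comm]
  calc _ = ∑ b, ∑ q, ∑ r, _ := Finset.sum_congr rfl fun b _ => Finset.sum_comm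
    _ = ∑ q, ∑ b, ∑ r, _ := Finset.sum_comm
    _ = _ := Finset.sum_congr rfl fun q _ => Finset.sum_congr rfl fun b _ =>
        Finset.sum_congr rfl fun r _ => by ring

theorem jetCurv_jx (f : (TIdx p → ℝ) → ℝ) (hh : IsLocalFinsler h V)
    (hw' : tgtPt w ∈ V) (l i j k : Fin n) :
    jetCurv f h (jx l) (jx i) (jx j) (jx k) w = berwaldR h l i j k (tgtPt w)
      + ∑ r, berwaldP h l i j r (tgtPt w) * nonlin h r k (tgtPt w)
      - ∑ r, berwaldP h l i k r (tgtPt w) * nonlin h r j (tgtPt w)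
      + ∑ q, ∑ b, (∑ r, berwaldP h l i k r (tgtPt w) * berwald h r j q (tgtPt w)
          - ∑ r, berwaldP h l i j r (tgtPt w) * berwald h r k q (tgtPt w))
          * w (jy b q) * w (js b) := by
  rw [jetCurv_jx_jx_jx_jx, fderiv_berwald_jetFrame_jx f hh hw', fderiv_berwald_jetFrame_jx f hh hw']
  simp only [sub_mul, Finset.sum_sub_distrib, berwaldR]
  ring

theorem jetCurv_jx_jx_jx_jy (f : (TIdx p → ℝ) → ℝ) (hh : IsLocalFinsler h V)
    (hw' : tgtPt w ∈ V) (l i j k : Fin n) (c : Fin p) :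
    jetCurv f h (jx l) (jx i) (jx j) (jy c k) w = berwaldP h l i j k (tgtPt w) * w (js c) := by
  rw [jetCurv_jx_jx_jx_jX,
    fderiv_comp_tgtPt (hh.differentiableAt (hh.contDiffOn_berwald _ _ _) hw')]
  simp [Pi.single_apply, ite_and, berwaldP, mul_comm]

theorem jetCurv_jx_jx_jx_jxt (f : (TIdx p → ℝ) → ℝ) (hh : IsLocalFinsler h V)
    (hw' : tgtPt w ∈ V) (l i j k : Fin n) (γ : Fin p) :
    jetCurv f h (jx l) (jx i) (jx j) (jxt γ k) w = 0 := by
  rw [jetCurv_jx_jx_jx_jX,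
    fderiv_comp_tgtPt (hh.differentiableAt (hh.contDiffOn_berwald _ _ _) hw')]
  simp

theorem IsLocalFinsler.coordCurv_eq_zero (hf : IsLocalFinsler f U) {z : TIdx p → ℝ} (hw : z ∈ U)
    (D A B C : TIdx p)
    (h1 : (kind (n := n) (jT D), kind (n := n) (jT A), kind (n := n) (jT B), kind (n := n) (jT C))
      ∉ curvTypes) :
    coordCurv (normalCoeff f) D A B C z = 0 := by
  rcases D with δ | d
  · rcases A with α | a
    · rcases B with β | b <;> rcases C with γ | c
      -- In goal 4 both directions are of kind s; the other three combinations belong to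
      -- `curvTypes`.
      on_goal 4 => exact hf.coordCurv_ss_right hw _ _ _ _
      all_goals exact (h1 (by simp only [kind]; decide)).elim
    · exact IsLocalFinsler.coordCurv_ts _ _ _ _ _ _
  · rcases B with β | b <;> rcases C with γ | c
    on_goal 4 => exact hf.coordCurv_ss_right hw _ _ _ _
    all_goals rcases A with α | a
    all_goals exact (h1 (by simp only [kind]; decide)).elim

theorem IsLocalFinsler.coordCurv_flip_eq_zero (hf : IsLocalFinsler f U) {z : TIdx p → ℝ}
    (hw : z ∈ U) (A D B C : TIdx p) (l i : Fin n)
    (h1 : (kind (jX D l), kind (jX A i), kind (n := n) (jT B), kind (n := n) (jT C)) ∉ curvTypes) :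
    coordCurv (fun D A B => normalCoeff f D B A) A D B C z = 0 := by
  rcases A with α | a
  · rcases D with δ | d
    · rcases B with β | b <;> rcases C with γ | c
      on_goal 4 => exact hf.coordCurv_flip_ss_right hw _ _ _ _
      all_goals exact (h1 (by simp only [kind]; decide)).elim
    · exact IsLocalFinsler.coordCurv_flip_ts _ _ _ _ _ _
  · rcases B with β | b <;> rcases C with γ | c
    on_goal 4 => exact hf.coordCurv_flip_ss_right hw _ _ _ _
    all_goals rcases D with α | a
    all_goals exact (h1 (by simp only [kind]; decide)).elim

theorem jetCurv_jx_jx_eq_zero (f : (TIdx p → ℝ) → ℝ) (hh : IsLocalFinsler h V)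
    (hw' : tgtPt w ∈ V) (l i : Fin n) (b c : JIdx p n)
    (h1 : (kind (p := p) (jx l), kind (p := p) (jx i), kind b, kind c) ∉ curvTypes)
    (h2 : (kind (p := p) (jx l), kind (p := p) (jx i), kind c, kind b) ∉ curvTypes) :
    jetCurv f h (jx l) (jx i) b c w = 0 := by
  rcases b with B | j | ⟨B, j⟩ <;> rcases c with C | k | ⟨C, k⟩
  · exact jetCurv_jx_jx_jT_jT _ _ _ _
  · rcases B with β | b <;> exact (h1 (by simp only [kind]; decide)).elim
  · exact jetCurv_jx_jx_jT_jX _ _ _ _ _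
  · rcases C with β | b <;> exact (h2 (by simp only [kind]; decide)).elim
  · exact (h1 (by simp only [kind]; decide)).elim
  · rcases C with β | b
    · exact jetCurv_jx_jx_jx_jxt f hh hw' _ _ _ _ _
    · exact (h1 (by simp only [kind]; decide)).elim
  · rw [jetCurv_swap, jetCurv_jx_jx_jT_jX, neg_zero]
  · rw [jetCurv_swap]
    rcases B with β | b
    · rw [jetCurv_jx_jx_jx_jxt f hh hw', neg_zero]
    · exact (h2 (by simp only [kind]; decide)).elim
  · exact jetCurv_jx_jx_jX_jX _ _ _ _ _ _

theorem jetCurv_jX_jX_eq_zero (hf : IsLocalFinsler f U) (hh : IsLocalFinsler h V)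
    (hw : srcPt w ∈ U) (hw' : tgtPt w ∈ V) (D A : TIdx p) (l i : Fin n) (b c : JIdx p n)
    (h1 : (kind (jX D l), kind (jX A i), kind b, kind c) ∉ curvTypes)
    (h2 : (kind (jX D l), kind (jX A i), kind c, kind b) ∉ curvTypes) :
    jetCurv f h (jX D l) (jX A i) b c w = 0 := by
  have hΓ : ∀ D A B, DifferentiableAt ℝ (normalCoeff f D A B) (srcPt w) := fun _ _ _ =>
    hf.differentiableAt (hf.contDiffOn_normalCoeff _ _ _) hw
  rcases b with B | j | ⟨B, j⟩ <;> rcases c with C | k | ⟨C, k⟩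
  · rw [jetCurv_jX_jX hΓ]
    exact mul_eq_zero_of_right _ (hf.coordCurv_flip_eq_zero hw A D B C l i h1)
  · rw [jetCurv_jX_jX_jT_jx hΓ]
    -- When A and D have the same kind the type is listed; otherwise the Kronecker factor is zero.
    rcases D with δ | d <;> rcases A with α | a <;> rcases B with β | b <;>
    first
    | exact (h1 (by simp only [kind]; decide)).elim
    | simp
  · exact jetCurv_jX_jX_jT_jX hΓ _ _ _ _ _ _ _
  · rw [jetCurv_swap, jetCurv_jX_jX_jT_jx hΓ]
    rcases D with δ | d <;> rcases A with α | a <;> rcases C with β | b <;>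
    first
    | exact (h2 (by simp only [kind]; decide)).elim
    | simp
  · rw [jetCurv_jX_jX_jx_jx]
    rcases D with δ | d <;> rcases A with α | a <;>
    first
    | exact (h1 (by simp only [kind]; decide)).elim
    | simp
  · rw [jetCurv_jX_jX_jx_jX]
    rcases C with γ | c
    · rw [jetCurv_jx_jx_jx_jxt f hh hw', mul_zero]
    · rcases D with δ | d <;> rcases A with α | a <;>
      first
      | exact (h1 (by simp only [kind]; decide)).elim
      | simp
  · rw [jetCurv_swap, jetCurv_jX_jX_jT_jX hΓ, neg_zero]
  · rw [jetCurv_swap, jetCurv_jX_jX_jx_jX]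
    rcases B with γ | c
    · rw [jetCurv_jx_jx_jx_jxt f hh hw', mul_zero, neg_zero]
    · rcases D with δ | d <;> rcases A with α | a <;>
      first
      | exact (h2 (by simp only [kind]; decide)).elim
      | simp
  · exact jetCurv_jX_jX_jX_jX _ _ _ _ _ _ _ _

theorem jetCurv_eq_zero (hf : IsLocalFinsler f U) (hh : IsLocalFinsler h V)
    (hw : srcPt w ∈ U) (hw' : tgtPt w ∈ V) (d a b c : JIdx p n)
    (h1 : (kind d, kind a, kind b, kind c) ∉ curvTypes)
    (h2 : (kind d, kind a, kind c, kind b) ∉ curvTypes) : jetCurv f h d a b c w = 0 := by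
  have hΓ : ∀ D A B, DifferentiableAt ℝ (normalCoeff f D A B) (srcPt w) := fun _ _ _ =>
    hf.differentiableAt (hf.contDiffOn_normalCoeff _ _ _) hw
  rcases d with D | l | ⟨D, l⟩
  · rcases a with A | i | ⟨A, i⟩
    · rcases c with C | k | ⟨C, k⟩
      · rcases b with B | j | ⟨B, j⟩
        · rw [jetCurv_jT_jT hΓ]
          exact hf.coordCurv_eq_zero hw D A B C h1
        · rw [jetCurv_swap, jetCurv_jT_jT_jx hΓ, neg_zero]
        · rw [jetCurv_swap, jetCurv_jT_jT_jX hΓ, neg_zero]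
      · exact jetCurv_jT_jT_jx hΓ _ _ _ _
      · exact jetCurv_jT_jT_jX hΓ _ _ _ _ _
    · exact jetCurv_jT_jx _ _ _ _ _ _ _
    · exact jetCurv_jT_jX _ _ _ _ _ _ _ _
  · rcases a with A | i | ⟨A, i⟩
    · exact jetCurv_jx_jT _ _ _ _ _ _ _
    · exact jetCurv_jx_jx_eq_zero f hh hw' l i b c h1 h2
    · exact jetCurv_jx_jX _ _ _ _ _ _ _ _
  · rcases a with A | i | ⟨A, i⟩
    · exact jetCurv_jX_jT _ _ _ _ _ _ _ _
    · exact jetCurv_jX_jx _ _ _ _ _ _ _ _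
    · exact jetCurv_jX_jX_eq_zero hf hh hw hw' D A l i b c h1 h2

end CurvatureFormulas

/-! ### From a Finsler manifold with a chart to a local Finsler function. -/

section ManifoldToLocal

open Sum

variable {p : ℕ} {M : Type*} [TopologicalSpace M] [ChartedSpace (EuclideanSpace ℝ (Fin p)) M]

/-- The coordinate domain of `TM ∖ 0` over a chart. -/
def slitDomain (φ : OpenPartialHomeomorph M (EuclideanSpace ℝ (Fin p))) : Set (TIdx p → ℝ) :=
  {z | (WithLp.toLp 2 fun α => z (inl α)) ∈ φ.target ∧ (fun a => z (inr a)) ≠ 0}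

theorem contDiff_base : ContDiff ℝ ∞ fun z : TIdx p → ℝ =>
    (WithLp.toLp 2 fun α => z (inl α) : EuclideanSpace ℝ (Fin p)) :=
  contDiff_euclidean.2 fun α => contDiff_apply ℝ ℝ (inl α)

theorem contDiff_fiber : ContDiff ℝ ∞ fun z : TIdx p → ℝ =>
    (WithLp.toLp 2 fun a => z (inr a) : EuclideanSpace ℝ (Fin p)) :=
  contDiff_euclidean.2 fun a => contDiff_apply ℝ ℝ (inr a)

theorem isOpen_slitDomain (φ : OpenPartialHomeomorph M (EuclideanSpace ℝ (Fin p))) :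
    IsOpen (slitDomain φ) :=
  (φ.open_target.preimage contDiff_base.continuous).inter
    (isOpen_ne.preimage (continuous_pi fun a => continuous_apply (inr a)))

theorem toLp_ne_zero {s : Fin p → ℝ} (hs : s ≠ 0) :
    (WithLp.toLp 2 s : EuclideanSpace ℝ (Fin p)) ≠ 0 := by
  simpa using hs

variable [IsManifold (𝓡 p) ∞ M]

/-- The derivative of the inverse of a chart, as a linear equivalence. -/
theorem exists_mfderiv_symm_equiv {φ : OpenPartialHomeomorph M (EuclideanSpace ℝ (Fin p))}
    (hφ : φ ∈ IsManifold.maximalAtlas (𝓡 p) ∞ M) {x : EuclideanSpace ℝ (Fin p)}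
    (hx : x ∈ φ.target) :
    ∃ A : EuclideanSpace ℝ (Fin p) ≃L[ℝ] EuclideanSpace ℝ (Fin p),
      ∀ v : EuclideanSpace ℝ (Fin p), mfderiv (𝓡 p) (𝓡 p) φ.symm x v = A v := by
  have hd : φ.MDifferentiable (𝓡 p) (𝓡 p) :=
    ⟨(contMDiffOn_of_mem_maximalAtlas hφ).mdifferentiableOn (by simp),
      (contMDiffOn_symm_of_mem_maximalAtlas hφ).mdifferentiableOn (by simp)⟩
  exact ⟨hd.symm.mfderiv hx, fun v => rfl⟩

/-- The map is the tangent map of the inverse chart, precomposed with the identification of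
coordinate space with the model of TM. -/
theorem contMDiffOn_vecOfCoords {φ : OpenPartialHomeomorph M (EuclideanSpace ℝ (Fin p))}
    (hφ : φ ∈ IsManifold.maximalAtlas (𝓡 p) ∞ M) :
    ContMDiffOn 𝓘(ℝ, TIdx p → ℝ) (𝓡 p).tangent ∞ (vecOfCoords φ) (slitDomain φ) := by
  have h1 := (contMDiffOn_symm_of_mem_maximalAtlas hφ).contMDiffOn_tangentMapWithin (m := ∞)
    (by simp) φ.open_target.uniqueMDiffOn
  have h2 : ContMDiff 𝓘(ℝ, TIdx p → ℝ) (𝓡 p).tangent ∞ fun z : TIdx p → ℝ =>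
      (tangentBundleModelSpaceHomeomorph (𝓡 p)).symm
        ((WithLp.toLp 2 fun α => z (inl α) : EuclideanSpace ℝ (Fin p)),
        (WithLp.toLp 2 fun a => z (inr a) : EuclideanSpace ℝ (Fin p))) :=
    (contMDiff_tangentBundleModelSpaceHomeomorph_symm (I := 𝓡 p) (n := ∞)).comp (by
      have h := (contDiff_base (p := p)).contMDiff.prodMk (contDiff_fiber (p := p)).contMDiff
      -- The product of two model spaces carries two charted space structures, as a product and as a
      -- model space; they must be identified.
      rw [chartedSpaceSelf_prod] at h
      exact h)
  refine (h1.comp h2.contMDiffOn (s := slitDomain φ) fun z hz => hz.1).congr fun z hz => ?_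
  change _ = (⟨φ.symm (WithLp.toLp 2 fun α => z (inl α)),
    mfderivWithin (𝓡 p) (𝓡 p) φ.symm φ.target (WithLp.toLp 2 fun α => z (inl α))
      (WithLp.toLp 2 fun a => z (inr a) : EuclideanSpace ℝ (Fin p))⟩ : TangentBundle (𝓡 p) M)
  rw [mfderivWithin_of_isOpen φ.open_target hz.1]
  rfl

variable (F : FinslerStructure p M)

theorem FinslerStructure.contDiffOn_inChart
    {φ : OpenPartialHomeomorph M (EuclideanSpace ℝ (Fin p))}
    (hφ : φ ∈ IsManifold.maximalAtlas (𝓡 p) ∞ M) :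
    ContDiffOn ℝ ∞ (F.inChart φ) (slitDomain φ) := by
  refine (F.smooth.comp (contMDiffOn_vecOfCoords hφ) fun z hz => ?_).contDiffOn
  obtain ⟨A, hA⟩ := exists_mfderiv_symm_equiv hφ hz.1
  change mfderiv (𝓡 p) (𝓡 p) φ.symm _ _ ≠ 0
  rw [hA]
  exact A.map_ne_zero_iff.2 (toLp_ne_zero hz.2)

/-- The second fibre derivative of the squared Finsler function in coordinates. -/
theorem sum_metric_eq_fderiv_fderiv {f : (TIdx p → ℝ) → ℝ} {U : Set (TIdx p → ℝ)}
    (hU : IsOpen U) (hf : ContDiffOn ℝ ∞ f U) {z : TIdx p → ℝ} (hz : z ∈ U) (u : Fin p → ℝ) :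
    ∑ α, u α * ∑ β, metric f α β z * u β =
      1 / 2 * fderiv ℝ (fun v₁ : EuclideanSpace ℝ (Fin p) =>
        fderiv ℝ (fun v₂ : EuclideanSpace ℝ (Fin p) => f (Sum.elim (fun α => z (inl α)) v₂) ^ 2) v₁
          (WithLp.toLp 2 u)) (WithLp.toLp 2 fun a => z (inr a)) (WithLp.toLp 2 u) := by
  have hq : ContDiffOn ℝ ∞ (fun z => f z ^ 2) U := hf.pow 2
  set q : (TIdx p → ℝ) → ℝ := fun z => f z ^ 2 with hqdef
  set j : EuclideanSpace ℝ (Fin p) → TIdx p → ℝ := fun v => Sum.elim (fun α => z (inl α)) v with hj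
  set û : TIdx p → ℝ := Sum.elim (fun _ => 0) u with hû
  have hjd : ∀ v, ∃ L : EuclideanSpace ℝ (Fin p) →L[ℝ] (TIdx p → ℝ), HasFDerivAt j L v ∧
      ∀ u : Fin p → ℝ, L (WithLp.toLp 2 u) = Sum.elim (fun _ => 0) u := by
    intro v
    refine ⟨ContinuousLinearMap.pi (Sum.elim (fun _ => 0) fun a => EuclideanSpace.proj a),
      hasFDerivAt_pi.2 fun A => ?_, fun u => ?_⟩
    · rcases A with α | a
      · exact hasFDerivAt_const _ _
      · exact (EuclideanSpace.proj (𝕜 := ℝ) a : EuclideanSpace ℝ (Fin p) →L[ℝ] ℝ).hasFDerivAt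
    · funext A
      rcases A with α | a <;> simp
  have hjz : j (WithLp.toLp 2 fun a => z (inr a)) = z := by
    funext A; rcases A with α | a <;> rfl
  have hcomp : ∀ (g : (TIdx p → ℝ) → ℝ) v, DifferentiableAt ℝ g (j v) →
      fderiv ℝ (fun v => g (j v)) v (WithLp.toLp 2 u) = fderiv ℝ g (j v) û := by
    intro g v hg
    obtain ⟨L, hL, hLu⟩ := hjd v
    rw [hû, ← hLu, show (fun v => g (j v)) = g ∘ j from rfl, (hg.hasFDerivAt.comp v hL).fderiv]
    rfl
  have hdd : ∀ A, DifferentiableAt ℝ (pd A q) z := fun A =>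
    ContDiffOn.differentiableAt_of_isOpen (ContDiffOn.pd hq hU A) hU hz
  have hd2 : DifferentiableAt ℝ (fun z => fderiv ℝ q z û) z := by
    simp only [fderiv_apply_eq_sum_pd]
    exact DifferentiableAt.fun_sum fun A _ => (hdd A).const_mul _
  -- The inner derivative can be rewritten only near the given point, because `q` is known to be
  -- smooth only on `U`.
  have hev : (fun v => fderiv ℝ (fun v => q (j v)) v (WithLp.toLp 2 u)) =ᶠ[nhds
      (WithLp.toLp 2 fun a => z (inr a))] fun v => fderiv ℝ q (j v) û := by
    have hjc : ContinuousAt j (WithLp.toLp 2 fun a => z (inr a)) :=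
      (hjd _).choose_spec.1.continuousAt
    filter_upwards [hjc.preimage_mem_nhds (hU.mem_nhds (by rwa [hjz]))] with v hv
    exact hcomp q v (ContDiffOn.differentiableAt_of_isOpen hq hU hv)
  change _ = 1 / 2 * fderiv ℝ (fun v => fderiv ℝ (fun v => q (j v)) v (WithLp.toLp 2 u)) _ _
  rw [hev.fderiv_eq, hcomp (fun z => fderiv ℝ q z û) _ (by rwa [hjz]), hjz, fderiv_apply_eq_sum_pd]
  have hpd : ∀ α : Fin p, pd (inr α) (fun z => fderiv ℝ q z û) z =
      ∑ β, u β * pd (inr α) (pd (inr β) q) z := by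
    intro α
    simp only [fderiv_apply_eq_sum_pd]
    rw [pd_sum fun A _ => (hdd A).const_mul _]
    simp only [pd_const_mul (hdd _)]
    simp [Fintype.sum_sum_type, hû]
  simp only [Fintype.sum_sum_type, hû, Sum.elim_inl, Sum.elim_inr, zero_mul,
    Finset.sum_const_zero, zero_add]
  simp only [← hû, hpd, Finset.mul_sum, metric]
  exact Finset.sum_congr rfl fun α _ => Finset.sum_congr rfl fun β _ => by ring

/-- Homogeneity passes to coordinates because the derivative `A` of the inverse chart is linear on
each fibre. If the metric matrix had a kernel vector u, the second fibre derivative of F² in the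
direction A u would vanish, contradicting `posDef`, since A is injective. -/
theorem FinslerStructure.isLocalFinsler {φ : OpenPartialHomeomorph M (EuclideanSpace ℝ (Fin p))}
    (hφ : φ ∈ IsManifold.maximalAtlas (𝓡 p) ∞ M) :
    IsLocalFinsler (F.inChart φ) (slitDomain φ) where
  isOpen := isOpen_slitDomain φ
  smooth := F.contDiffOn_inChart hφ
  homog := by
    intro z hz c hc
    obtain ⟨A, hA⟩ := exists_mfderiv_symm_equiv hφ hz.1
    change F.F ⟨_, mfderiv (𝓡 p) (𝓡 p) φ.symm (WithLp.toLp 2 fun α => z (inl α))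
      (c • (WithLp.toLp 2 fun a => z (inr a) : EuclideanSpace ℝ (Fin p)))⟩ = c * F.F ⟨_,
      mfderiv (𝓡 p) (𝓡 p) φ.symm (WithLp.toLp 2 fun α => z (inl α)) (WithLp.toLp 2 fun a => z (inr a))⟩
    rw [hA, hA, map_smul]
    exact F.homog _ _ c hc
  det_ne_zero := by
    intro z hz hdet
    obtain ⟨A, hA⟩ := exists_mfderiv_symm_equiv hφ hz.1
    obtain ⟨u, hu, hu0⟩ := Matrix.exists_mulVec_eq_zero_iff.2 hdet
    have h0 : ∑ α, u α * ∑ β, metric (F.inChart φ) α β z * u β = 0 :=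
      Finset.sum_eq_zero fun α _ => mul_eq_zero_of_right _ (congrFun hu0 α)
    rw [sum_metric_eq_fderiv_fderiv (isOpen_slitDomain φ) (F.contDiffOn_inChart hφ) hz] at h0
    have hpos := F.posDef (φ.symm (WithLp.toLp 2 fun α => z (inl α)))
      (A (WithLp.toLp 2 fun a => z (inr a))) (A (WithLp.toLp 2 u))
      (A.map_ne_zero_iff.2 (toLp_ne_zero hz.2)) (A.map_ne_zero_iff.2 (toLp_ne_zero hu))
    set Q : EuclideanSpace ℝ (Fin p) → ℝ := fun v =>
      F.F ⟨φ.symm (WithLp.toLp 2 fun α => z (inl α)), v⟩ ^ 2 with hQ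
    have h1 : (fun v₂ : EuclideanSpace ℝ (Fin p) =>
        F.inChart φ (Sum.elim (fun α => z (inl α)) v₂) ^ 2) = Q ∘ A := by
      funext v
      change F.F ⟨_, mfderiv (𝓡 p) (𝓡 p) φ.symm (WithLp.toLp 2 fun α => z (inl α)) v⟩ ^ 2 = _
      rw [hA]
      rfl
    have h2 : (fun v₁ => fderiv ℝ (Q ∘ A) v₁ (WithLp.toLp 2 u)) =
        (fun v₁ => fderiv ℝ Q v₁ (A (WithLp.toLp 2 u))) ∘ A := by
      funext v
      rw [A.comp_right_fderiv]
      rfl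
    rw [h1, h2, A.comp_right_fderiv] at h0
    exact hpos.ne' h0

end ManifoldToLocal

/-! ### The components on δ/δT and ∂/∂X along directions of M, type by type. -/

section CurvatureFormulas

open Sum

variable {p n : ℕ} {f : (TIdx p → ℝ) → ℝ} {h : (TIdx n → ℝ) → ℝ} {U : Set (TIdx p → ℝ)}
  {w : JIdx p n → ℝ}

namespace IsLocalFinsler

theorem differentiableAt_normalCoeff (hf : IsLocalFinsler f U) (hw : srcPt w ∈ U)
    (D A B : TIdx p) : DifferentiableAt ℝ (normalCoeff f D A B) (srcPt w) :=
  hf.differentiableAt (hf.contDiffOn_normalCoeff _ _ _) hw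

theorem jetCurv_jT (hf : IsLocalFinsler f U) (hw : srcPt w ∈ U) (h : (TIdx n → ℝ) → ℝ)
    (D A B C : TIdx p) :
    jetCurv f h (jT D) (jT A) (jT B) (jT C) w = coordCurv (normalCoeff f) D A B C (srcPt w) :=
  jetCurv_jT_jT (hf.differentiableAt_normalCoeff hw) D A B C

theorem jetCurv_jX (hf : IsLocalFinsler f U) (hw : srcPt w ∈ U) (h : (TIdx n → ℝ) → ℝ)
    (D A B C : TIdx p) (l i : Fin n) :
    jetCurv f h (jX D l) (jX A i) (jT B) (jT C) w =
      -(if l = i then 1 else 0) * coordCurv (fun D A B => normalCoeff f D B A) A D B C (srcPt w) :=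
  jetCurv_jX_jX (hf.differentiableAt_normalCoeff hw) D A B C l i

theorem jetCurv_tttt (hf : IsLocalFinsler f U) (hw : srcPt w ∈ U) (h : (TIdx n → ℝ) → ℝ)
    (δ α β γ : Fin p) :
    jetCurv f h (jt δ) (jt α) (jt β) (jt γ) w = berwaldR f δ α β γ (srcPt w)
      + ∑ c, berwaldP f δ α β c (srcPt w) * nonlin f c γ (srcPt w)
      - ∑ c, berwaldP f δ α γ c (srcPt w) * nonlin f c β (srcPt w) :=
  (hf.jetCurv_jT hw h _ _ _ _).trans (coordCurv_tttt _ _ _ _ _ _)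

theorem jetCurv_sttt (hf : IsLocalFinsler f U) (hw : srcPt w ∈ U) (h : (TIdx n → ℝ) → ℝ)
    (d α β γ : Fin p) :
    jetCurv f h (js d) (jt α) (jt β) (jt γ) w =
      alt (fun β γ => pd (inl γ) (nonlinCov f d α β) (srcPt w)
        + ∑ c, nonlinCov f c α β (srcPt w) * berwald f d c γ (srcPt w)
        - ∑ μ, nonlinCov f d μ β (srcPt w) * berwald f μ α γ (srcPt w)) β γ :=
  (hf.jetCurv_jT hw h _ _ _ _).trans (coordCurv_sttt _ _ _ _ _ _)

theorem jetCurv_ttts (hf : IsLocalFinsler f U) (hw : srcPt w ∈ U) (h : (TIdx n → ℝ) → ℝ)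
    (δ α β c : Fin p) :
    jetCurv f h (jt δ) (jt α) (jt β) (js c) w = berwaldP f δ α β c (srcPt w) :=
  (hf.jetCurv_jT hw h _ _ _ _).trans (coordCurv_ttts _ _ _ _ _ _)

theorem jetCurv_stts (hf : IsLocalFinsler f U) (hw : srcPt w ∈ U) (h : (TIdx n → ℝ) → ℝ)
    (d α β c : Fin p) :
    jetCurv f h (js d) (jt α) (jt β) (js c) w =
      pd (inr c) (nonlinCov f d α β) (srcPt w) - pd (inl β) (berwald f d α c) (srcPt w)
        + ∑ μ, berwald f μ α β (srcPt w) * berwald f d μ c (srcPt w)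
        - ∑ e, berwald f e α c (srcPt w) * berwald f d e β (srcPt w) :=
  (hf.jetCurv_jT hw h _ _ _ _).trans (hf.coordCurv_stts hw _ _ _ _)

/-- Antisymmetry gives −P with its last two indices exchanged; the symmetry of P restores their
order. -/
theorem jetCurv_ttst (hf : IsLocalFinsler f U) (hw : srcPt w ∈ U) (h : (TIdx n → ℝ) → ℝ)
    (δ α b γ : Fin p) :
    jetCurv f h (jt δ) (jt α) (js b) (jt γ) w = -berwaldP f δ α b γ (srcPt w) := by
  rw [jetCurv_swap, hf.jetCurv_ttts hw, hf.berwaldP_comm_right hw]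

theorem jetCurv_stst (hf : IsLocalFinsler f U) (hw : srcPt w ∈ U) (h : (TIdx n → ℝ) → ℝ)
    (d α b γ : Fin p) :
    jetCurv f h (js d) (jt α) (js b) (jt γ) w =
      pd (inl γ) (berwald f d α b) (srcPt w) - pd (inr b) (nonlinCov f d α γ) (srcPt w)
        + ∑ c, berwald f c α b (srcPt w) * berwald f d c γ (srcPt w)
        - ∑ μ, berwald f μ α γ (srcPt w) * berwald f d μ b (srcPt w) := by
  rw [jetCurv_swap, hf.jetCurv_stts hw]
  ring

theorem jetCurv_sstt (hf : IsLocalFinsler f U) (hw : srcPt w ∈ U) (h : (TIdx n → ℝ) → ℝ)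
    (d a β γ : Fin p) :
    jetCurv f h (js d) (js a) (jt β) (jt γ) w = berwaldR f d a β γ (srcPt w)
      + ∑ c, berwaldP f d a β c (srcPt w) * nonlin f c γ (srcPt w)
      - ∑ c, berwaldP f d a γ c (srcPt w) * nonlin f c β (srcPt w) :=
  (hf.jetCurv_jT hw h _ _ _ _).trans (coordCurv_sstt _ _ _ _ _ _)

theorem jetCurv_ssts (hf : IsLocalFinsler f U) (hw : srcPt w ∈ U) (h : (TIdx n → ℝ) → ℝ)
    (d a β c : Fin p) :
    jetCurv f h (js d) (js a) (jt β) (js c) w = berwaldP f d a β c (srcPt w) :=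
  (hf.jetCurv_jT hw h _ _ _ _).trans (coordCurv_ssts _ _ _ _ _ _)

theorem jetCurv_ssst (hf : IsLocalFinsler f U) (hw : srcPt w ∈ U) (h : (TIdx n → ℝ) → ℝ)
    (d a b γ : Fin p) :
    jetCurv f h (js d) (js a) (js b) (jt γ) w = -berwaldP f d a b γ (srcPt w) := by
  rw [jetCurv_swap, hf.jetCurv_ssts hw, hf.berwaldP_comm_right hw]

theorem jetCurv_jX_tttt (hf : IsLocalFinsler f U) (hw : srcPt w ∈ U) (h : (TIdx n → ℝ) → ℝ)
    (ε : Fin p) (l : Fin n) (α : Fin p) (i : Fin n) (β γ : Fin p) :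
    jetCurv f h (jxt ε l) (jxt α i) (jt β) (jt γ) w =
      -(if l = i then 1 else 0) * jetCurv f h (jt α) (jt ε) (jt β) (jt γ) w := by
  rw [hf.jetCurv_jX hw, hf.jetCurv_jT hw, hf.coordCurv_flip_tttt hw]

theorem jetCurv_jX_ttts (hf : IsLocalFinsler f U) (hw : srcPt w ∈ U) (h : (TIdx n → ℝ) → ℝ)
    (ε : Fin p) (l : Fin n) (α : Fin p) (i : Fin n) (β c : Fin p) :
    jetCurv f h (jxt ε l) (jxt α i) (jt β) (js c) w =
      -(if l = i then 1 else 0) * berwaldP f α ε β c (srcPt w) := by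
  rw [hf.jetCurv_jX hw, hf.coordCurv_flip_ttts hw]

theorem jetCurv_jX_ttst (hf : IsLocalFinsler f U) (hw : srcPt w ∈ U) (h : (TIdx n → ℝ) → ℝ)
    (ε : Fin p) (l : Fin n) (α : Fin p) (i : Fin n) (b γ : Fin p) :
    jetCurv f h (jxt ε l) (jxt α i) (js b) (jt γ) w =
      (if l = i then 1 else 0) * berwaldP f α ε b γ (srcPt w) := by
  rw [jetCurv_swap, hf.jetCurv_jX_ttts hw, neg_mul, neg_neg, hf.berwaldP_comm_right hw]

theorem jetCurv_jX_tstt (hf : IsLocalFinsler f U) (hw : srcPt w ∈ U) (h : (TIdx n → ℝ) → ℝ)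
    (ε : Fin p) (l : Fin n) (a : Fin p) (i : Fin n) (β γ : Fin p) :
    jetCurv f h (jxt ε l) (jy a i) (jt β) (jt γ) w = -(if l = i then 1 else 0) *
      alt (fun β γ => pd (inl γ) (nonlinCov f a β ε) (srcPt w)
        + ∑ c, nonlinCov f c β ε (srcPt w) * berwald f a c γ (srcPt w)
        - ∑ μ, nonlinCov f a β μ (srcPt w) * berwald f μ ε γ (srcPt w)) β γ := by
  rw [hf.jetCurv_jX hw, hf.coordCurv_flip_sttt hw]

theorem jetCurv_jX_tsts (hf : IsLocalFinsler f U) (hw : srcPt w ∈ U) (h : (TIdx n → ℝ) → ℝ)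
    (ε : Fin p) (l : Fin n) (a : Fin p) (i : Fin n) (β c : Fin p) :
    jetCurv f h (jxt ε l) (jy a i) (jt β) (js c) w = -(if l = i then 1 else 0) *
      (pd (inr c) (nonlinCov f a β ε) (srcPt w) - pd (inl β) (berwald f a c ε) (srcPt w)
        + ∑ μ, berwald f μ β ε (srcPt w) * berwald f a μ c (srcPt w)
        - ∑ d, berwald f d c ε (srcPt w) * berwald f a d β (srcPt w)) := by
  rw [hf.jetCurv_jX hw, hf.coordCurv_flip_stts hw]

theorem jetCurv_jX_tsst (hf : IsLocalFinsler f U) (hw : srcPt w ∈ U) (h : (TIdx n → ℝ) → ℝ)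
    (ε : Fin p) (l : Fin n) (a : Fin p) (i : Fin n) (b γ : Fin p) :
    jetCurv f h (jxt ε l) (jy a i) (js b) (jt γ) w = -(if l = i then 1 else 0) *
      (pd (inl γ) (berwald f a b ε) (srcPt w) - pd (inr b) (nonlinCov f a γ ε) (srcPt w)
        + ∑ c, berwald f c b ε (srcPt w) * berwald f a c γ (srcPt w)
        - ∑ μ, berwald f μ γ ε (srcPt w) * berwald f a μ b (srcPt w)) := by
  rw [jetCurv_swap, hf.jetCurv_jX_tsts hw]
  ring

theorem jetCurv_jX_sstt (hf : IsLocalFinsler f U) (hw : srcPt w ∈ U) (h : (TIdx n → ℝ) → ℝ)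
    (d : Fin p) (l : Fin n) (a : Fin p) (i : Fin n) (β γ : Fin p) :
    jetCurv f h (jy d l) (jy a i) (jt β) (jt γ) w =
      -(if l = i then 1 else 0) * jetCurv f h (js a) (js d) (jt β) (jt γ) w := by
  rw [hf.jetCurv_jX hw, hf.coordCurv_flip_sstt hw, hf.jetCurv_sstt hw, coordCurv_tttt]

theorem jetCurv_jX_ssts (hf : IsLocalFinsler f U) (hw : srcPt w ∈ U) (h : (TIdx n → ℝ) → ℝ)
    (d : Fin p) (l : Fin n) (a : Fin p) (i : Fin n) (β c : Fin p) :
    jetCurv f h (jy d l) (jy a i) (jt β) (js c) w =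
      -(if l = i then 1 else 0) * berwaldP f a d β c (srcPt w) := by
  rw [hf.jetCurv_jX hw, hf.coordCurv_flip_ssts hw]

theorem jetCurv_jX_ssst (hf : IsLocalFinsler f U) (hw : srcPt w ∈ U) (h : (TIdx n → ℝ) → ℝ)
    (d : Fin p) (l : Fin n) (a : Fin p) (i : Fin n) (b γ : Fin p) :
    jetCurv f h (jy d l) (jy a i) (js b) (jt γ) w =
      (if l = i then 1 else 0) * berwaldP f a d b γ (srcPt w) := by
  rw [jetCurv_swap, hf.jetCurv_jX_ssts hw, neg_mul, neg_neg, hf.berwaldP_comm_right hw]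

theorem jetCurv_jX_jT_jx (hf : IsLocalFinsler f U) (hw : srcPt w ∈ U) (h : (TIdx n → ℝ) → ℝ)
    (D A B : TIdx p) (l i k : Fin n) :
    jetCurv f h (jX D l) (jX A i) (jT B) (jx k) w =
      (if A = D then 1 else 0) * jetCurv f h (jx l) (jx i) (jT B) (jx k) w :=
  jetCurv_jX_jX_jT_jx (hf.differentiableAt_normalCoeff hw) D A B l i k

end IsLocalFinsler

end CurvatureFormulas

/-! ### Finsler structures on coordinate spaces -/

section CoordinateSpace

open Sum

variable {p n : ℕ}

/-- The Finsler structure on a coordinate space with a given Finsler function of position and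
velocity. -/
def FinslerStructure.ofFun (G : EuclideanSpace ℝ (Fin p) → EuclideanSpace ℝ (Fin p) → ℝ)
    (nonneg : ∀ x v, 0 ≤ G x v)
    (smooth : ∀ x v, v ≠ 0 → ContDiffAt ℝ ∞
      (fun q : EuclideanSpace ℝ (Fin p) × EuclideanSpace ℝ (Fin p) => G q.1 q.2) (x, v))
    (homog : ∀ x v (c : ℝ), 0 < c → G x (c • v) = c * G x v)
    (posDef : ∀ x v u, v ≠ 0 → u ≠ 0 → 0 < (1 / 2) * fderiv ℝ
      (fun v₁ => fderiv ℝ (fun v₂ => G x v₂ ^ 2) v₁ u) v u) :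
    FinslerStructure p (EuclideanSpace ℝ (Fin p)) where
  F := fun v => G v.1 v.2
  nonneg := fun v => nonneg _ _
  smooth := by
    intro v hv
    have h1 : ContMDiff (𝓡 p).tangent (𝓡 p).tangent ∞ (tangentBundleModelSpaceHomeomorph (𝓡 p)) :=
      contMDiff_tangentBundleModelSpaceHomeomorph
    have h2 : ContMDiffAt 𝓘(ℝ, EuclideanSpace ℝ (Fin p) × EuclideanSpace ℝ (Fin p)) 𝓘(ℝ, ℝ) ∞
        (fun q : EuclideanSpace ℝ (Fin p) × EuclideanSpace ℝ (Fin p) => G q.1 q.2)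
        (v.1, v.2) := (smooth v.1 v.2 hv).contMDiffAt
    rw [modelWithCornersSelf_prod] at h2
    exact (h2.comp v h1.contMDiffAt).contMDiffWithinAt
  homog := fun m v c hc => homog m v c hc
  posDef := fun m v u hv hu => posDef m v u hv hu

theorem FinslerStructure.ofFun_inChart
    {G : EuclideanSpace ℝ (Fin p) → EuclideanSpace ℝ (Fin p) → ℝ} {h1 h2 h3 h4} :
    (FinslerStructure.ofFun G h1 h2 h3 h4).inChart (OpenPartialHomeomorph.refl _) = fun z =>
      G (WithLp.toLp 2 fun α => z (inl α)) (WithLp.toLp 2 fun a => z (inr a)) := by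
  funext z
  change G _ (mfderiv (𝓡 p) (𝓡 p) (id : EuclideanSpace ℝ (Fin p) → EuclideanSpace ℝ (Fin p)) _ _) = _
  rw [mfderiv_id]
  rfl

theorem refl_mem_maximalAtlas : OpenPartialHomeomorph.refl (EuclideanSpace ℝ (Fin p)) ∈
    IsManifold.maximalAtlas (𝓡 p) ∞ (EuclideanSpace ℝ (Fin p)) :=
  IsManifold.subset_maximalAtlas rfl

theorem mem_slitDomain_refl (z : TIdx p → ℝ) :
    z ∈ slitDomain (OpenPartialHomeomorph.refl (EuclideanSpace ℝ (Fin p))) ↔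
      (fun a => z (inr a)) ≠ 0 := by
  simp [slitDomain]

/-- The point of the jet space with `t = 0`, `x = 0` and `X = (0, id)`. -/
def jetPoint (s : Fin p → ℝ) : JIdx p p → ℝ
  | .inl (.inl _) => 0
  | .inl (.inr a) => s a
  | .inr (.inl _) => 0
  | .inr (.inr (.inl _, _)) => 0
  | .inr (.inr (.inr a, i)) => if a = i then 1 else 0

theorem srcPt_jetPoint (s : Fin p → ℝ) : srcPt (jetPoint s) = Sum.elim (fun _ => 0) s := by
  funext A
  rcases A with α | a <;> rfl

/-- With y the identity matrix, source and target points coincide, so one computation of the Berwald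
objects serves both sides. -/
theorem tgtPt_jetPoint (s : Fin p → ℝ) : tgtPt (jetPoint s) = Sum.elim (fun _ => 0) s := by
  funext A
  rcases A with α | a
  · rfl
  · simp [tgtPt, jetPoint]

theorem jetPoint_mem_jetDomain {s : Fin p → ℝ} (hs : s ≠ 0) :
    jetPoint s ∈ jetDomain (OpenPartialHomeomorph.refl (EuclideanSpace ℝ (Fin p)))
      (OpenPartialHomeomorph.refl (EuclideanSpace ℝ (Fin p))) := by
  refine ⟨trivial, hs, trivial, ?_⟩
  simpa [jetPoint] using hs

end CoordinateSpace

/-! ### The hyperbolic plane -/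

section HyperbolicPlane

open Sum

theorem hasFDerivAt_coord (i : Fin 2) (v : EuclideanSpace ℝ (Fin 2)) :
    HasFDerivAt (fun v : EuclideanSpace ℝ (Fin 2) => v i)
      (EuclideanSpace.proj i : EuclideanSpace ℝ (Fin 2) →L[ℝ] ℝ) v :=
  (EuclideanSpace.proj (𝕜 := ℝ) i : EuclideanSpace ℝ (Fin 2) →L[ℝ] ℝ).hasFDerivAt

theorem ne_zero_iff_coord {v : EuclideanSpace ℝ (Fin 2)} : v ≠ 0 ↔ 0 < v 0 ^ 2 + v 1 ^ 2 := by
  constructor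
  · intro h
    by_contra hc
    refine h ?_
    have h0 : v 0 = 0 := by nlinarith [sq_nonneg (v 0), sq_nonneg (v 1)]
    have h1 : v 1 = 0 := by nlinarith [sq_nonneg (v 0), sq_nonneg (v 1)]
    ext i
    fin_cases i <;> simp [h0, h1]
  · rintro h rfl
    simp at h

theorem sq_add_mul_sq_pos {v : EuclideanSpace ℝ (Fin 2)} (hv : v ≠ 0) {c : ℝ} (hc : 0 < c) :
    0 < v 0 ^ 2 + c * v 1 ^ 2 := by
  have h := ne_zero_iff_coord.1 hv
  rcases eq_or_ne (v 1) 0 with h1 | h1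
  · simpa [h1] using h
  · positivity

/-- The Finsler structure of the Riemannian metric `dx₀² + e^{2 x₀} dx₁²`. -/
def hyperbolic : FinslerStructure 2 (EuclideanSpace ℝ (Fin 2)) :=
  FinslerStructure.ofFun (fun x v => √(v 0 ^ 2 + Real.exp (2 * x 0) * v 1 ^ 2))
    (fun _ _ => Real.sqrt_nonneg _)
    (by
      intro x v hv
      refine ContDiffAt.sqrt ?_ (sq_add_mul_sq_pos hv (Real.exp_pos _)).ne'
      fun_prop)
    (by
      intro x v c hc
      have : (c • v) 0 ^ 2 + Real.exp (2 * x 0) * (c • v) 1 ^ 2 =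
          c ^ 2 * (v 0 ^ 2 + Real.exp (2 * x 0) * v 1 ^ 2) := by
        simp only [PiLp.smul_apply, smul_eq_mul]
        ring
      rw [this, Real.sqrt_mul (sq_nonneg c), Real.sqrt_sq hc.le])
    (by
      intro x v u _ hu
      have hsq : ∀ v : EuclideanSpace ℝ (Fin 2), √(v 0 ^ 2 + Real.exp (2 * x 0) * v 1 ^ 2) ^ 2 =
          v 0 ^ 2 + Real.exp (2 * x 0) * v 1 ^ 2 := fun v => Real.sq_sqrt (by positivity)
      simp only [hsq]
      have h1 : ∀ v : EuclideanSpace ℝ (Fin 2),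
          fderiv ℝ (fun v : EuclideanSpace ℝ (Fin 2) => v 0 ^ 2 + Real.exp (2 * x 0) * v 1 ^ 2) v u =
            2 * v 0 * u 0 + Real.exp (2 * x 0) * (2 * v 1 * u 1) := fun v => by
        rw [(((hasFDerivAt_coord 0 v).pow 2).fun_add
          (((hasFDerivAt_coord 1 v).pow 2).const_mul (Real.exp (2 * x 0)))).fderiv]
        simp
      have h2 : fderiv ℝ (fun v : EuclideanSpace ℝ (Fin 2) =>
          2 * v 0 * u 0 + Real.exp (2 * x 0) * (2 * v 1 * u 1)) v u =
            2 * u 0 * u 0 + Real.exp (2 * x 0) * (2 * u 1 * u 1) := by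
        rw [((((hasFDerivAt_coord 0 v).const_mul 2).mul_const (u 0)).fun_add
          ((((hasFDerivAt_coord 1 v).const_mul 2).mul_const (u 1)).const_mul
            (Real.exp (2 * x 0)))).fderiv]
        simp
        ring
      simp only [h1, h2]
      linarith [sq_add_mul_sq_pos hu (Real.exp_pos (2 * x 0))])

end HyperbolicPlane

/-! ### The Berwald objects of the hyperbolic plane and its nonvanishing components. -/

section HyperbolicPlane

open Sum

/-- F² is smooth on the whole coordinate space, so the identities drawn from it below hold at every
point, including s = 0. -/
theorem hyperbolic_inChart_sq (z : TIdx 2 → ℝ) :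
    hyperbolic.inChart (OpenPartialHomeomorph.refl _) z ^ 2 =
      z (inr 0) * z (inr 0) + Real.exp (2 * z (inl 0)) * (z (inr 1) * z (inr 1)) := by
  rw [hyperbolic, FinslerStructure.ofFun_inChart]
  refine (Real.sq_sqrt (by positivity)).trans ?_
  simp only [sq]

theorem pd_exp (A : TIdx 2) (z : TIdx 2 → ℝ) :
    pd A (fun z => Real.exp (2 * z (inl 0))) z =
      if A = inl 0 then 2 * Real.exp (2 * z (inl 0)) else 0 := by
  have h : HasFDerivAt (fun z : TIdx 2 → ℝ => Real.exp (2 * z (inl 0)))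
      (Real.exp (2 * z (inl 0)) • ((2 : ℝ) • (ContinuousLinearMap.proj (inl 0) :
        (TIdx 2 → ℝ) →L[ℝ] ℝ))) z :=
    ((hasFDerivAt_apply (𝕜 := ℝ) (inl 0) z).const_mul 2).exp
  rw [pd, h.fderiv]
  by_cases hA : A = inl 0
  · simp [hA, mul_comm]
  · simp [hA, Ne.symm hA]

/-- The Finsler function of the hyperbolic plane in the standard coordinates. -/
abbrev hyperbolicFun : (TIdx 2 → ℝ) → ℝ := hyperbolic.inChart (OpenPartialHomeomorph.refl _)

theorem metric_hyperbolic (α β : Fin 2) : metric hyperbolicFun α β =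
    fun z => if α = β then (if α = 0 then 1 else Real.exp (2 * z (inl 0))) else 0 := by
  have hd : ∀ (A : TIdx 2) (z : TIdx 2 → ℝ), DifferentiableAt ℝ (fun z : TIdx 2 → ℝ => z A) z :=
    fun A z => differentiableAt_apply A z
  have he : ∀ z : TIdx 2 → ℝ, DifferentiableAt ℝ
    (fun z : TIdx 2 → ℝ => Real.exp (2 * z (inl 0))) z := fun z => by fun_prop
  have h0 : pd (inr 0) (fun z => hyperbolicFun z ^ 2) = fun z => 2 * z (inr 0) := by
    funext z
    simp only [hyperbolic_inChart_sq]
    rw [pd_add (by fun_prop) (by fun_prop), pd_mul (hd _ z) (hd _ z),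
      pd_mul (he z) (by fun_prop), pd_mul (hd _ z) (hd _ z), pd_exp]
    simp [pd_coord]
    ring
  have h1 : pd (inr 1) (fun z => hyperbolicFun z ^ 2) =
      fun z => 2 * (Real.exp (2 * z (inl 0)) * z (inr 1)) := by
    funext z
    simp only [hyperbolic_inChart_sq]
    rw [pd_add (by fun_prop) (by fun_prop), pd_mul (hd _ z) (hd _ z),
      pd_mul (he z) (by fun_prop), pd_mul (hd _ z) (hd _ z), pd_exp]
    simp [pd_coord]
    ring
  funext z
  fin_cases β <;> simp only [metric, Fin.zero_eta, Fin.mk_one, h0, h1]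
  · rw [pd_const_mul (hd _ z), pd_coord]
    fin_cases α <;> simp
  · rw [pd_const_mul (by fun_prop), pd_mul (he z) (hd _ z), pd_coord, pd_exp]
    fin_cases α <;> simp

theorem metricInv_hyperbolic (α β : Fin 2) : metricInv hyperbolicFun α β =
    fun z => if α = β then (if α = 0 then 1 else (Real.exp (2 * z (inl 0)))⁻¹) else 0 := by
  funext z
  have h : (Matrix.of fun α' β' => metric hyperbolicFun α' β' z) =
      Matrix.diagonal fun α => if α = 0 then 1 else Real.exp (2 * z (inl 0)) := by
    ext i j
    simp only [metric_hyperbolic, Matrix.of_apply, Matrix.diagonal_apply]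
  rw [metricInv, h, Matrix.inv_eq_left_inv (B := Matrix.diagonal fun α : Fin 2 =>
    if α = 0 then 1 else (Real.exp (2 * z (inl 0)))⁻¹)]
  · rw [Matrix.diagonal_apply]
  · rw [Matrix.diagonal_mul_diagonal, ← Matrix.diagonal_one]
    congr 1
    funext i
    have := (Real.exp_pos (2 * z (inl 0))).ne'
    fin_cases i <;> simp [this]

theorem pd_metric_hyperbolic (A : TIdx 2) (α β : Fin 2) (z : TIdx 2 → ℝ) :
    pd A (metric hyperbolicFun α β) z =
      if A = inl 0 ∧ α = 1 ∧ β = 1 then 2 * Real.exp (2 * z (inl 0)) else 0 := by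
  rw [metric_hyperbolic]
  fin_cases α <;> fin_cases β <;> simp [pd_const, pd_exp]

theorem cartan_hyperbolic (α β γ : Fin 2) : cartan hyperbolicFun α β γ = fun _ => 0 := by
  funext z
  simp [cartan, pd_metric_hyperbolic]

theorem cartanUp_hyperbolic (α β γ : Fin 2) : cartanUp hyperbolicFun α β γ = fun _ => 0 := by
  funext z
  simp [cartanUp, cartan_hyperbolic]

theorem formalChr_hyperbolic (γ α β : Fin 2) : formalChr hyperbolicFun γ α β =
    fun z => if γ = 0 then (if α = 1 ∧ β = 1 then -Real.exp (2 * z (inl 0)) else 0)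
      else (if α = β then 0 else 1) := by
  funext z
  have := (Real.exp_pos (2 * z (inl 0))).ne'
  fin_cases γ <;> fin_cases α <;> fin_cases β <;>
    simp [formalChr, metricInv_hyperbolic, pd_metric_hyperbolic] <;> field_simp

theorem nonlin_hyperbolic (β α : Fin 2) : nonlin hyperbolicFun β α =
    fun z => if β = 0 then (if α = 1 then -Real.exp (2 * z (inl 0)) * z (inr 1) else 0)
      else (if α = 0 then z (inr 1) else z (inr 0)) := by
  funext z
  fin_cases β <;> fin_cases α <;>
    simp [nonlin, cartanUp_hyperbolic, formalChr_hyperbolic]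

/-- The metric does not depend on s: C vanishes, δ/δt acts on g as ∂/∂t, and B reduces to the
Christoffel symbols. -/
theorem berwald_hyperbolic (γ α β : Fin 2) : berwald hyperbolicFun γ α β =
    fun z => if γ = 0 then (if α = 1 ∧ β = 1 then -Real.exp (2 * z (inl 0)) else 0)
      else (if α = β then 0 else 1) := by
  rw [← formalChr_hyperbolic]
  funext z
  have hm : ∀ α β γ, hder hyperbolicFun α (metric hyperbolicFun β γ) z = pd (inl α) (metric hyperbolicFun β γ) z := by
    intro α β γ
    simp [hder, pd_metric_hyperbolic]
  have h0 : ∀ α, hder hyperbolicFun α (fun _ => 0) z = 0 := fun α => by simp [hder, pd_const]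
  simp [berwald, rund, cartanCov, cartanUp_hyperbolic, hm, formalChr, h0]

theorem pd_neg_exp_mul (A : TIdx 2) (b : Fin 2) (z : TIdx 2 → ℝ) :
    pd A (fun z => -(Real.exp (2 * z (inl 0)) * z (inr b))) z =
      -((if A = inl 0 then 2 * Real.exp (2 * z (inl 0)) else 0) * z (inr b) +
        Real.exp (2 * z (inl 0)) * if A = inr b then 1 else 0) := by
  have : (fun z : TIdx 2 → ℝ => -(Real.exp (2 * z (inl 0)) * z (inr b))) =
      fun z => (-1) * (Real.exp (2 * z (inl 0)) * z (inr b)) := by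
    funext z
    ring
  rw [this, pd_const_mul (by fun_prop), pd_mul (by fun_prop) (by fun_prop), pd_exp, pd_coord]
  simp [eq_comm]

/-- In `Fin 2`, `1 - β` is the index other than β. -/
theorem nonlinCov_hyperbolic (γ α β : Fin 2) : nonlinCov hyperbolicFun γ α β =
    fun z => if γ = 0 then (if α = 1 then -(Real.exp (2 * z (inl 0)) * z (inr (1 - β))) else 0)
      else (if α = 1 then 0 else if β = 0 then z (inr 1) else -z (inr 0)) := by
  funext z
  fin_cases γ <;> fin_cases α <;> fin_cases β <;>
    simp [nonlinCov, nonlin_hyperbolic, berwald_hyperbolic, pd_const, pd_coord, pd_neg_exp_mul]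
  all_goals ring

theorem pd_berwald_hyperbolic (A : TIdx 2) (γ α β : Fin 2) (z : TIdx 2 → ℝ) :
    pd A (berwald hyperbolicFun γ α β) z = if A = inl 0 ∧ γ = 0 ∧ α = 1 ∧ β = 1 then
      -(2 * Real.exp (2 * z (inl 0))) else 0 := by
  have h : pd A (fun z => -Real.exp (2 * z (inl 0))) z =
      if A = inl 0 then -(2 * Real.exp (2 * z (inl 0))) else 0 := by
    have : (fun z : TIdx 2 → ℝ => -Real.exp (2 * z (inl 0))) =
        fun z => (-1) * Real.exp (2 * z (inl 0)) := by
      funext z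
      ring
    rw [this, pd_const_mul (by fun_prop), pd_exp]
    split_ifs <;> ring
  rw [berwald_hyperbolic]
  fin_cases γ <;> fin_cases α <;> fin_cases β <;> simp [pd_const, h]

theorem berwaldP_hyperbolic (δ α β c : Fin 2) (z : TIdx 2 → ℝ) :
    berwaldP hyperbolicFun δ α β c z = 0 := by
  simp [berwaldP, pd_berwald_hyperbolic]

theorem berwaldR_hyperbolic (z : TIdx 2 → ℝ) :
    berwaldR hyperbolicFun 0 1 0 1 z = Real.exp (2 * z (inl 0)) := by
  simp only [berwaldR, hder, pd_berwald_hyperbolic]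
  simp [berwald_hyperbolic]
  ring

open Kind in
/-- Types of components which do not vanish for the hyperbolic plane. -/
def hyperbolicTypes : Finset (Kind × Kind × Kind × Kind) :=
  {(t, t, t, t), (s, t, t, t), (s, s, t, t), (x, x, x, x), (xt, xt, t, t),
    (xt, y, t, t), (xt, y, t, s), (xt, y, s, t), (y, y, t, t), (xt, xt, x, x),
    (y, y, x, x)}

/-- With P = 0 the type (s, t, t, s) vanishes by `nonlinCov_curv`, but its counterpart (xt, y, t, s)
differs from it by ∂/∂s of N_{β:ε} − N_{ε:β}, and this is not zero here. -/
theorem hyperbolic_jetCurv_ne_zero {q : Kind × Kind × Kind × Kind}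
    (hq : q ∈ hyperbolicTypes) :
    ∃ d a b c : JIdx 2 2, (kind d, kind a, kind b, kind c) = q ∧
      jetCurv hyperbolicFun hyperbolicFun d a b c (jetPoint fun _ => 1) ≠ 0 := by
  have hf := hyperbolic.isLocalFinsler (refl_mem_maximalAtlas (p := 2))
  set w : JIdx 2 2 → ℝ := jetPoint fun _ => 1 with hw
  have hs : (fun _ : Fin 2 => (1 : ℝ)) ≠ 0 := fun h => one_ne_zero (congrFun h 0)
  have hz : srcPt w ∈ slitDomain (OpenPartialHomeomorph.refl (EuclideanSpace ℝ (Fin 2))) := by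
    rw [mem_slitDomain_refl, hw, srcPt_jetPoint]
    exact hs
  have hz' : tgtPt w ∈ slitDomain (OpenPartialHomeomorph.refl (EuclideanSpace ℝ (Fin 2))) := by
    rw [mem_slitDomain_refl, hw, tgtPt_jetPoint]
    exact hs
  have e0 : ∀ α : Fin 2, srcPt w (inl α) = 0 := fun α => by rw [hw, srcPt_jetPoint]; rfl
  have e1 : ∀ a : Fin 2, srcPt w (inr a) = 1 := fun a => by rw [hw, srcPt_jetPoint]; rfl
  have e2 : ∀ α : Fin 2, tgtPt w (inl α) = 0 := fun α => by rw [hw, tgtPt_jetPoint]; rfl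
  have hx : jetCurv hyperbolicFun hyperbolicFun (jx 0) (jx 1) (jx 0) (jx 1) w = 1 := by
    rw [jetCurv_jx _ hf hz']
    simp [berwaldP_hyperbolic, berwaldR_hyperbolic, e2]
  fin_cases hq
  · refine ⟨jt 0, jt 1, jt 0, jt 1, rfl, ?_⟩
    rw [hf.jetCurv_tttt hz]
    simp [berwaldP_hyperbolic, berwaldR_hyperbolic, e0]
  · refine ⟨js 0, jt 1, jt 0, jt 1, rfl, ?_⟩
    rw [hf.jetCurv_sttt hz]
    simp [alt, nonlinCov_hyperbolic, berwald_hyperbolic, e0, e1, pd_neg_exp_mul]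
    norm_num
  · refine ⟨js 0, js 1, jt 0, jt 1, rfl, ?_⟩
    rw [hf.jetCurv_sstt hz]
    simp [berwaldP_hyperbolic, berwaldR_hyperbolic, e0]
  · exact ⟨jx 0, jx 1, jx 0, jx 1, rfl, hx ▸ one_ne_zero⟩
  · refine ⟨jxt 1 0, jxt 0 0, jt 0, jt 1, rfl, ?_⟩
    rw [hf.jetCurv_jX_tttt hz, hf.jetCurv_tttt hz]
    simp [berwaldP_hyperbolic, berwaldR_hyperbolic, e0]
  · refine ⟨jxt 0 0, jy 0 0, jt 0, jt 1, rfl, ?_⟩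
    rw [hf.jetCurv_jX_tstt hz]
    simp [alt, nonlinCov_hyperbolic, berwald_hyperbolic, e0, e1, pd_neg_exp_mul, pd_const]
    norm_num
  · refine ⟨jxt 1 0, jy 0 0, jt 0, js 1, rfl, ?_⟩
    rw [hf.jetCurv_jX_tsts hz, pd_berwald_hyperbolic]
    simp [nonlinCov_hyperbolic, berwald_hyperbolic, e0, pd_const]
    norm_num
  · refine ⟨jxt 1 0, jy 0 0, js 1, jt 0, rfl, ?_⟩
    rw [hf.jetCurv_jX_tsst hz, pd_berwald_hyperbolic]
    simp [nonlinCov_hyperbolic, berwald_hyperbolic, e0, pd_const]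
    norm_num
  · refine ⟨jy 1 0, jy 0 0, jt 0, jt 1, rfl, ?_⟩
    rw [hf.jetCurv_jX_sstt hz, hf.jetCurv_sstt hz]
    simp [berwaldP_hyperbolic, berwaldR_hyperbolic, e0]
  · refine ⟨jxt 0 0, jxt 0 1, jx 0, jx 1, rfl, ?_⟩
    rw [jetCurv_jX_jX_jx_jx, hx]
    simp
  · refine ⟨jy 0 0, jy 0 1, jx 0, jx 1, rfl, ?_⟩
    rw [jetCurv_jX_jX_jx_jx, hx]
    simp

end HyperbolicPlane

/-! ### A Randers plane -/

section RandersPlane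

open Sum

theorem abs_coord_le_sqrt (v : EuclideanSpace ℝ (Fin 2)) : |v 1| ≤ √(v 0 ^ 2 + v 1 ^ 2) :=
  Real.abs_le_sqrt (by nlinarith [sq_nonneg (v 0)])

/-- It gives F ≥ |v|/2, which serves both the nonnegativity of F and the positivity of its
fundamental tensor. -/
theorem neg_le_randers {c : ℝ} (hc : |c| ≤ 1 / 2) (v : EuclideanSpace ℝ (Fin 2)) :
    -(1 / 2 * √(v 0 ^ 2 + v 1 ^ 2)) ≤ c * v 1 := by
  have h1 : |c * v 1| ≤ 1 / 2 * √(v 0 ^ 2 + v 1 ^ 2) := by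
    rw [abs_mul]
    exact mul_le_mul hc (abs_coord_le_sqrt v) (abs_nonneg _) (by norm_num)
  exact (abs_le.1 h1).1

theorem hasFDerivAt_sqrt_sq_add_sq {v : EuclideanSpace ℝ (Fin 2)} (hv : v ≠ 0) :
    HasFDerivAt (fun v : EuclideanSpace ℝ (Fin 2) => √(v 0 ^ 2 + v 1 ^ 2))
      ((√(v 0 ^ 2 + v 1 ^ 2))⁻¹ • (v 0 • (EuclideanSpace.proj 0 : EuclideanSpace ℝ (Fin 2) →L[ℝ] ℝ) +
        v 1 • (EuclideanSpace.proj 1 : EuclideanSpace ℝ (Fin 2) →L[ℝ] ℝ))) v := by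
  have h := (((hasFDerivAt_coord 0 v).pow 2).fun_add ((hasFDerivAt_coord 1 v).pow 2)).sqrt
    (ne_zero_iff_coord.1 hv).ne'
  refine h.congr_fderiv ?_
  ext u
  have := (Real.sqrt_pos.2 (ne_zero_iff_coord.1 hv)).ne'
  simp
  field_simp

theorem fderiv_randers_sq (c : ℝ) {v : EuclideanSpace ℝ (Fin 2)} (hv : v ≠ 0)
    (u : EuclideanSpace ℝ (Fin 2)) :
    fderiv ℝ (fun v : EuclideanSpace ℝ (Fin 2) => (√(v 0 ^ 2 + v 1 ^ 2) + c * v 1) ^ 2) v u =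
      2 * (√(v 0 ^ 2 + v 1 ^ 2) + c * v 1) *
        ((v 0 * u 0 + v 1 * u 1) * (√(v 0 ^ 2 + v 1 ^ 2))⁻¹ + c * u 1) := by
  rw [(((hasFDerivAt_sqrt_sq_add_sq hv).fun_add ((hasFDerivAt_coord 1 v).const_mul c)).pow 2).fderiv]
  simp
  ring

/-- The fundamental form is arranged as the square of dF(u) plus F/|v| times the square of the
component of u orthogonal to v, so that its positivity can be read off. -/
theorem fderiv_fderiv_randers_sq (c : ℝ) {v : EuclideanSpace ℝ (Fin 2)} (hv : v ≠ 0)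
    (u : EuclideanSpace ℝ (Fin 2)) :
    1 / 2 * fderiv ℝ (fun v => fderiv ℝ (fun v : EuclideanSpace ℝ (Fin 2) =>
      (√(v 0 ^ 2 + v 1 ^ 2) + c * v 1) ^ 2) v u) v u =
      ((v 0 * u 0 + v 1 * u 1) / √(v 0 ^ 2 + v 1 ^ 2) + c * u 1) ^ 2 +
        (√(v 0 ^ 2 + v 1 ^ 2) + c * v 1) / √(v 0 ^ 2 + v 1 ^ 2) *
          ((v 0 * u 1 - v 1 * u 0) / √(v 0 ^ 2 + v 1 ^ 2)) ^ 2 := by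
  have hr := ne_zero_iff_coord.1 hv
  have hr' := (Real.sqrt_pos.2 hr).ne'
  have he : (fun v => fderiv ℝ (fun v : EuclideanSpace ℝ (Fin 2) =>
      (√(v 0 ^ 2 + v 1 ^ 2) + c * v 1) ^ 2) v u) =ᶠ[nhds v] fun v =>
      2 * (√(v 0 ^ 2 + v 1 ^ 2) + c * v 1) *
        ((v 0 * u 0 + v 1 * u 1) * (√(v 0 ^ 2 + v 1 ^ 2))⁻¹ + c * u 1) := by
    filter_upwards [isOpen_ne.mem_nhds hv] with v hv using fderiv_randers_sq c hv u
  have hs := hasFDerivAt_sqrt_sq_add_sq hv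
  have h1 := (hs.fun_add ((hasFDerivAt_coord 1 v).const_mul c)).const_mul 2
  have h2 := ((((hasFDerivAt_coord 0 v).mul_const (u 0)).fun_add
    ((hasFDerivAt_coord 1 v).mul_const (u 1))).fun_mul ((hasDerivAt_inv hr').comp_hasFDerivAt v hs)).add_const (c * u 1)
  rw [he.fderiv_eq]
  refine (congrArg (fun L : EuclideanSpace ℝ (Fin 2) →L[ℝ] ℝ => 1 / 2 * L u)
    (h1.fun_mul h2).fderiv).trans ?_
  have hsq := Real.sq_sqrt hr.le
  simp
  generalize √(v 0 ^ 2 + v 1 ^ 2) = r at *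
  field_simp

  -- Lagrange's identity (v·u)² + (v₀u₁ − v₁u₀)² = |v|²|u|², with r² = |v|².
  linear_combination (r + c * v 1) * (u 0 ^ 2 + u 1 ^ 2) * hsq

/-- Here e and k are the components of u along v and orthogonal to v. If k ≠ 0 the second square is
positive, because F/|v| ≥ 1/2. If k = 0 then |e| = |u| exceeds |c u₁| ≤ |u|/2, so the first square
is positive. -/
theorem randers_posDef {c : ℝ} (hc : |c| ≤ 1 / 2) {v u : EuclideanSpace ℝ (Fin 2)} (hv : v ≠ 0)
    (hu : u ≠ 0) : 0 < ((v 0 * u 0 + v 1 * u 1) / √(v 0 ^ 2 + v 1 ^ 2) + c * u 1) ^ 2 +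
        (√(v 0 ^ 2 + v 1 ^ 2) + c * v 1) / √(v 0 ^ 2 + v 1 ^ 2) *
          ((v 0 * u 1 - v 1 * u 0) / √(v 0 ^ 2 + v 1 ^ 2)) ^ 2 := by
  have hr := Real.sqrt_pos.2 (ne_zero_iff_coord.1 hv)
  have hsq := Real.sq_sqrt (ne_zero_iff_coord.1 hv).le
  have hF := neg_le_randers hc v
  have hu' := ne_zero_iff_coord.1 hu
  generalize √(v 0 ^ 2 + v 1 ^ 2) = r at *
  set e := (v 0 * u 0 + v 1 * u 1) / r with he
  set k := (v 0 * u 1 - v 1 * u 0) / r with hk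
  have hek : e ^ 2 + k ^ 2 = u 0 ^ 2 + u 1 ^ 2 := by
    rw [he, hk, div_pow, div_pow, ← add_div, hsq,
      div_eq_iff (ne_zero_iff_coord.1 hv).ne']
    ring
  have hg : 1 / 2 ≤ (r + c * v 1) / r := by
    rw [le_div_iff₀ hr]
    linarith
  rcases eq_or_ne k 0 with h0 | h0
  · rw [h0] at hek ⊢
    have hc2 : c ^ 2 ≤ 1 / 4 := by
      have := sq_le_sq' (by linarith [abs_nonneg c]) hc
      rw [sq_abs] at this
      linarith
    have : e + c * u 1 ≠ 0 := by
      intro h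
      have h2 : e ^ 2 = c ^ 2 * u 1 ^ 2 := by
        rw [eq_neg_of_add_eq_zero_left h]
        ring
      nlinarith [sq_nonneg (u 0), sq_nonneg (u 1)]
    positivity
  · have : 0 < (r + c * v 1) / r := by linarith
    positivity

theorem abs_sin_div_two_le (x : ℝ) : |Real.sin x / 2| ≤ 1 / 2 := by
  rw [abs_div, abs_two]
  linarith [Real.abs_sin_le_one x]

/-- The Finsler structure of the Randers metric `√(dx₀² + dx₁²) + (sin x₀ / 2) dx₁`. -/
def randers : FinslerStructure 2 (EuclideanSpace ℝ (Fin 2)) :=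
  FinslerStructure.ofFun (fun x v => √(v 0 ^ 2 + v 1 ^ 2) + Real.sin (x 0) / 2 * v 1)
    (fun x v => by
      linarith [neg_le_randers (abs_sin_div_two_le (x 0)) v, Real.sqrt_nonneg (v 0 ^ 2 + v 1 ^ 2)])
    (by
      intro x v hv
      refine ContDiffAt.add (ContDiffAt.sqrt ?_ (ne_zero_iff_coord.1 hv).ne') ?_
      · fun_prop
      · exact ((Real.contDiff_sin.comp (by fun_prop)).div_const 2 |>.mul (by fun_prop)).contDiffAt)
    (by
      intro x v c hc
      have : (c • v) 0 ^ 2 + (c • v) 1 ^ 2 = c ^ 2 * (v 0 ^ 2 + v 1 ^ 2) := by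
        simp only [PiLp.smul_apply, smul_eq_mul]
        ring
      rw [this, Real.sqrt_mul (sq_nonneg c), Real.sqrt_sq hc.le]
      simp only [PiLp.smul_apply, smul_eq_mul]
      ring)
    (by
      intro x v u hv hu
      rw [fderiv_fderiv_randers_sq _ hv]
      exact randers_posDef (abs_sin_div_two_le _) hv hu)

/-- The Finsler function of the Randers plane in the standard coordinates. -/
abbrev randersFun : (TIdx 2 → ℝ) → ℝ := randers.inChart (OpenPartialHomeomorph.refl _)

end RandersPlane

/-! ### Metric and spray of the Randers plane. -/

section RandersPlane

open Sum

/-- The Euclidean norm of the fibre coordinates. -/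
def fiberNorm (z : TIdx 2 → ℝ) : ℝ := √(z (inr 0) ^ 2 + z (inr 1) ^ 2)

/-- The open set of coordinates with nonzero fibre coordinates. -/
abbrev slitPlane : Set (TIdx 2 → ℝ) :=
  slitDomain (OpenPartialHomeomorph.refl (EuclideanSpace ℝ (Fin 2)))

theorem isLocalFinsler_randers : IsLocalFinsler randersFun slitPlane :=
  randers.isLocalFinsler refl_mem_maximalAtlas

theorem randersFun_eq : randersFun = fun z =>
    fiberNorm z + Real.sin (z (inl 0)) / 2 * z (inr 1) := by
  rw [randersFun, randers, FinslerStructure.ofFun_inChart]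
  rfl

theorem sq_add_sq_pos_of_mem {z : TIdx 2 → ℝ} (hz : z ∈ slitPlane) :
    0 < z (inr 0) ^ 2 + z (inr 1) ^ 2 := by
  have h : (WithLp.toLp 2 fun a => z (inr a) : EuclideanSpace ℝ (Fin 2)) ≠ 0 := fun h =>
    (mem_slitDomain_refl z).1 hz (congrArg WithLp.ofLp h)
  exact ne_zero_iff_coord.1 h

theorem fiberNorm_pos {z : TIdx 2 → ℝ} (hz : z ∈ slitPlane) : 0 < fiberNorm z :=
  Real.sqrt_pos.2 (sq_add_sq_pos_of_mem hz)

theorem sq_fiberNorm (z : TIdx 2 → ℝ) : fiberNorm z ^ 2 = z (inr 0) ^ 2 + z (inr 1) ^ 2 :=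
  Real.sq_sqrt (by positivity)

theorem hasFDerivAt_fiberNorm {z : TIdx 2 → ℝ} (hz : z ∈ slitPlane) :
    HasFDerivAt fiberNorm ((fiberNorm z)⁻¹ • (z (inr 0) • (ContinuousLinearMap.proj (inr 0) :
      (TIdx 2 → ℝ) →L[ℝ] ℝ) + z (inr 1) • (ContinuousLinearMap.proj (inr 1) :
      (TIdx 2 → ℝ) →L[ℝ] ℝ))) z := by
  have h := (((hasFDerivAt_apply (𝕜 := ℝ) (inr 0) z).pow 2).fun_add
    ((hasFDerivAt_apply (𝕜 := ℝ) (inr 1) z).pow 2)).sqrt (sq_add_sq_pos_of_mem hz).ne'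
  refine h.congr_fderiv ?_
  ext u
  have := (fiberNorm_pos hz).ne'
  rw [fiberNorm] at *
  simp
  field_simp

theorem differentiableAt_fiberNorm {z : TIdx 2 → ℝ} (hz : z ∈ slitPlane) :
    DifferentiableAt ℝ fiberNorm z :=
  (hasFDerivAt_fiberNorm hz).differentiableAt

theorem pd_inl_fiberNorm {z : TIdx 2 → ℝ} (hz : z ∈ slitPlane) (α : Fin 2) :
    pd (inl α) fiberNorm z = 0 := by
  rw [pd, (hasFDerivAt_fiberNorm hz).fderiv]
  simp

theorem pd_inr_fiberNorm {z : TIdx 2 → ℝ} (hz : z ∈ slitPlane) (a : Fin 2) :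
    pd (inr a) fiberNorm z = z (inr a) * (fiberNorm z)⁻¹ := by
  rw [pd, (hasFDerivAt_fiberNorm hz).fderiv]
  fin_cases a <;> simp [mul_comm]

theorem pd_inv {ι : Type} [Fintype ι] [DecidableEq ι] {u : (ι → ℝ) → ℝ} {z : ι → ℝ}
    (hu : DifferentiableAt ℝ u z) (h0 : u z ≠ 0) (i : ι) :
    pd i (fun z => (u z)⁻¹) z = -(pd i u z * (u z)⁻¹ ^ 2) := by
  have := ((hasDerivAt_inv h0).comp_hasFDerivAt z hu.hasFDerivAt).fderiv
  refine (congrArg (fun L : (ι → ℝ) →L[ℝ] ℝ => L (Pi.single i 1)) this).trans ?_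
  simp [pd, mul_comm]

theorem pd_sin (A : TIdx 2) (z : TIdx 2 → ℝ) :
    pd A (fun z => Real.sin (z (inl 0)) / 2) z =
      if A = inl 0 then Real.cos (z (inl 0)) / 2 else 0 := by
  have h : HasFDerivAt (fun z : TIdx 2 → ℝ => Real.sin (z (inl 0)) / 2)
      ((2 : ℝ)⁻¹ • Real.cos (z (inl 0)) • (ContinuousLinearMap.proj (inl 0) :
        (TIdx 2 → ℝ) →L[ℝ] ℝ)) z :=
    ((hasFDerivAt_apply (𝕜 := ℝ) (inl 0) z).sin.const_mul 2⁻¹).congr_of_eventuallyEq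
      (.of_forall fun _ => div_eq_inv_mul _ _)
  rw [pd, h.fderiv]
  by_cases hA : A = inl 0
  · simp [hA, div_eq_inv_mul]
  · simp [hA, Ne.symm hA]

/-- The fibre derivatives of the Randers function. -/
def randersLin (a : Fin 2) (z : TIdx 2 → ℝ) : ℝ :=
  z (inr a) * (fiberNorm z)⁻¹ + if a = 1 then Real.sin (z (inl 0)) / 2 else 0

theorem differentiableAt_sin (z : TIdx 2 → ℝ) :
    DifferentiableAt ℝ (fun z : TIdx 2 → ℝ => Real.sin (z (inl 0)) / 2) z := by
  fun_prop

theorem pd_inr_randersFun {z : TIdx 2 → ℝ} (hz : z ∈ slitPlane) (a : Fin 2) :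
    pd (inr a) randersFun z = randersLin a z := by
  have h1 := differentiableAt_fiberNorm hz
  rw [randersFun_eq, pd_add h1 (by fun_prop), pd_mul (differentiableAt_sin z) (by fun_prop),
    pd_inr_fiberNorm hz, pd_sin, pd_coord, randersLin]
  simp [eq_comm]

theorem pd_inl_randersFun {z : TIdx 2 → ℝ} (hz : z ∈ slitPlane) (α : Fin 2) :
    pd (inl α) randersFun z = if α = 0 then Real.cos (z (inl 0)) / 2 * z (inr 1) else 0 := by
  have h1 := differentiableAt_fiberNorm hz
  rw [randersFun_eq, pd_add h1 (by fun_prop), pd_mul (differentiableAt_sin z) (by fun_prop),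
    pd_inl_fiberNorm hz, pd_sin, pd_coord]
  simp

theorem differentiableAt_inv_fiberNorm {z : TIdx 2 → ℝ} (hz : z ∈ slitPlane) :
    DifferentiableAt ℝ (fun z => (fiberNorm z)⁻¹) z :=
  (differentiableAt_fiberNorm hz).inv (fiberNorm_pos hz).ne'

theorem differentiableAt_ite_sin (P : Prop) [Decidable P] (z : TIdx 2 → ℝ) :
    DifferentiableAt ℝ (fun z : TIdx 2 → ℝ => if P then Real.sin (z (inl 0)) / 2 else 0) z := by
  split_ifs <;> fun_prop

theorem differentiableAt_randersLin {z : TIdx 2 → ℝ} (hz : z ∈ slitPlane) (a : Fin 2) :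
    DifferentiableAt ℝ (randersLin a) z := by
  have h1 := differentiableAt_inv_fiberNorm hz
  have h2 := differentiableAt_ite_sin (a = 1) z
  unfold randersLin
  fun_prop

theorem pd_inr_randersLin {z : TIdx 2 → ℝ} (hz : z ∈ slitPlane) (a b : Fin 2) :
    pd (inr a) (randersLin b) z = (if a = b then (fiberNorm z)⁻¹ else 0) -
      z (inr a) * z (inr b) * (fiberNorm z)⁻¹ ^ 3 := by
  have h1 := differentiableAt_inv_fiberNorm hz
  have h2 := differentiableAt_ite_sin (b = 1) z
  have h3 : pd (inr a) (fun z => if b = 1 then Real.sin (z (inl 0)) / 2 else 0) z = 0 := by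
    split_ifs <;> simp [pd_sin, pd_const]
  unfold randersLin
  rw [pd_add (by fun_prop) h2, pd_mul (by fun_prop) h1, pd_coord, h3,
    pd_inv (differentiableAt_fiberNorm hz) (fiberNorm_pos hz).ne', pd_inr_fiberNorm hz]
  simp only [inr.injEq, eq_comm (a := b)]
  split_ifs <;> ring

theorem pd_inl_randersLin {z : TIdx 2 → ℝ} (hz : z ∈ slitPlane) (α b : Fin 2) :
    pd (inl α) (randersLin b) z = if α = 0 ∧ b = 1 then Real.cos (z (inl 0)) / 2 else 0 := by
  have h1 := differentiableAt_inv_fiberNorm hz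
  have h2 := differentiableAt_ite_sin (b = 1) z
  have h3 : pd (inl α) (fun z => if b = 1 then Real.sin (z (inl 0)) / 2 else 0) z =
      if α = 0 ∧ b = 1 then Real.cos (z (inl 0)) / 2 else 0 := by
    split_ifs <;> simp_all [pd_sin, pd_const]
  unfold randersLin
  rw [pd_add (by fun_prop) h2, pd_mul (by fun_prop) h1, pd_coord, h3,
    pd_inv (differentiableAt_fiberNorm hz) (fiberNorm_pos hz).ne', pd_inl_fiberNorm hz]
  simp

theorem metric_randers {z : TIdx 2 → ℝ} (hz : z ∈ slitPlane) (a b : Fin 2) :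
    metric randersFun a b z = randersLin a z * randersLin b z + randersFun z *
      ((if a = b then (fiberNorm z)⁻¹ else 0) - z (inr a) * z (inr b) * (fiberNorm z)⁻¹ ^ 3) := by
  have hf := isLocalFinsler_randers
  have hd : ∀ z ∈ slitPlane, DifferentiableAt ℝ randersFun z := fun z hz =>
    hf.differentiableAt hf.smooth hz
  have h : Set.EqOn (pd (inr b) fun z => randersFun z ^ 2)
      (fun z => 2 * (randersFun z * randersLin b z)) slitPlane := by
    intro z hz
    simp only [sq]
    rw [pd_mul (hd z hz) (hd z hz), pd_inr_randersFun hz]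
    ring
  have hl := differentiableAt_randersLin hz b
  rw [metric, pd_congr_of_eqOn hf.isOpen hz h, pd_const_mul ((hd z hz).fun_mul hl),
    pd_mul (hd z hz) hl, pd_inr_randersFun hz, pd_inr_randersLin hz]
  ring

theorem pd_inl_metric_randers {z : TIdx 2 → ℝ} (hz : z ∈ slitPlane) (α a b : Fin 2) :
    pd (inl α) (metric randersFun a b) z = if α = 0 then Real.cos (z (inl 0)) / 2 *
      ((if a = 1 then randersLin b z else 0) + (if b = 1 then randersLin a z else 0) + z (inr 1) *
      ((if a = b then (fiberNorm z)⁻¹ else 0) - z (inr a) * z (inr b) * (fiberNorm z)⁻¹ ^ 3))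
      else 0 := by
  have hf := isLocalFinsler_randers
  have hd : DifferentiableAt ℝ randersFun z := hf.differentiableAt hf.smooth hz
  have h1 := differentiableAt_inv_fiberNorm hz
  have h2 : DifferentiableAt ℝ (fun z : TIdx 2 → ℝ => if a = b then (fiberNorm z)⁻¹ else 0) z := by
    split_ifs <;> fun_prop
  have h3 : pd (inl α) (fun z => (fiberNorm z)⁻¹) z = 0 := by
    rw [pd_inv (differentiableAt_fiberNorm hz) (fiberNorm_pos hz).ne', pd_inl_fiberNorm hz]
    simp
  have h4 : pd (inl α) (fun z : TIdx 2 → ℝ => if a = b then (fiberNorm z)⁻¹ else 0) z = 0 := by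
    split_ifs
    · exact h3
    · exact pd_const _ _ _
  have h5 : pd (inl α) (fun z : TIdx 2 → ℝ => z (inr a) * z (inr b) * (fiberNorm z)⁻¹ ^ 3) z = 0 := by
    simp only [pow_three]
    rw [pd_mul (by fun_prop) (by fun_prop), pd_mul (by fun_prop) (by fun_prop),
      pd_mul (by fun_prop) (by fun_prop), pd_mul (by fun_prop) (by fun_prop), h3, pd_coord, pd_coord]
    simp
  have hl := differentiableAt_randersLin hz
  rw [pd_congr_of_eqOn hf.isOpen hz (fun z hz => metric_randers hz a b) (inl α),
    pd_add ((hl a).fun_mul (hl b)) (hd.fun_mul (h2.fun_sub (by fun_prop))), pd_mul (hl a) (hl b),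
    pd_mul hd (h2.fun_sub (by fun_prop)), pd_sub h2 (by fun_prop), h4, h5, pd_inl_randersLin hz,
    pd_inl_randersLin hz, pd_inl_randersFun hz]
  split_ifs <;> simp_all <;> ring

/-- Where sin t⁰ = 0 the Randers function is the Euclidean norm. -/
theorem metric_randers_zero {z : TIdx 2 → ℝ} (hz : z ∈ slitPlane) (h0 : z (inl 0) = 0)
    (a b : Fin 2) : metric randersFun a b z = if a = b then 1 else 0 := by
  have hr := (fiberNorm_pos hz).ne'
  rw [metric_randers hz, randersLin, randersLin, randersFun_eq]
  simp only [h0, Real.sin_zero, zero_div, ite_self, add_zero, zero_mul]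
  split_ifs <;> field_simp <;> ring

/-- Over t⁰ = 0 lowering an index changes nothing, so the spray is read off from the t-derivatives
of g without inverting the Randers metric. -/
theorem spray_randers_zero {z : TIdx 2 → ℝ} (hz : z ∈ slitPlane) (h0 : z (inl 0) = 0) (μ : Fin 2) :
    spray randersFun μ z = 1 / 4 * if μ = 0 then -(z (inr 1) ^ 3 * (fiberNorm z)⁻¹) else
      z (inr 0) * (fiberNorm z + z (inr 1) ^ 2 * (fiberNorm z)⁻¹) := by
  have h := isLocalFinsler_randers.sum_metric_mul_spray hz μ
  have hr := (fiberNorm_pos hz).ne'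
  have h0sq : z (inr 0) ^ 2 = fiberNorm z ^ 2 - z (inr 1) ^ 2 := by
    rw [sq_fiberNorm]
    ring
  simp only [metric_randers_zero hz h0, ite_mul, one_mul, zero_mul, Finset.sum_ite_eq,
    Finset.mem_univ, if_true] at h
  rw [h]
  simp only [lowerChr, pd_inl_metric_randers hz, Fin.sum_univ_two, randersLin, h0]
  generalize fiberNorm z = r at *
  fin_cases μ
  · simp
    field_simp
    rw [h0sq]
    ring
  · simp
    field_simp
    rw [h0sq]
    ring

end RandersPlane

/-! ### P for the Randers plane over t = 0, and general identities for B, P and N_{α:β}. -/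

section RandersPlane

open Sum

/-- Fibre derivatives depend only on the values on the fibre. -/
theorem pd_inr_congr {p : ℕ} {u v : (TIdx p → ℝ) → ℝ} {U : Set (TIdx p → ℝ)} (hU : IsOpen U)
    {z : TIdx p → ℝ} (hz : z ∈ U) (hu : DifferentiableAt ℝ u z) (hv : DifferentiableAt ℝ v z)
    (h : ∀ z' ∈ U, (∀ α, z' (inl α) = z (inl α)) → u z' = v z') (a : Fin p) :
    pd (inr a) u z = pd (inr a) v z := by
  have hl : HasDerivAt (fun τ : ℝ => z + τ • (Pi.single (inr a) 1 : TIdx p → ℝ))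
      (Pi.single (inr a) 1) 0 := by
    simpa using ((hasDerivAt_id (0 : ℝ)).smul_const (Pi.single (inr a) 1 : TIdx p → ℝ)).const_add z
  have h0 : z + (0 : ℝ) • (Pi.single (inr a) 1 : TIdx p → ℝ) = z := by simp
  have key : ∀ u : (TIdx p → ℝ) → ℝ, DifferentiableAt ℝ u z → HasDerivAt
      (fun τ : ℝ => u (z + τ • (Pi.single (inr a) 1 : TIdx p → ℝ))) (pd (inr a) u z) 0 := by
    intro u hu
    refine HasFDerivAt.comp_hasDerivAt (l := u) (l' := fderiv ℝ u z) 0 ?_ hl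
    rw [h0]
    exact hu.hasFDerivAt
  refine (key u hu).unique ((key v hv).congr_of_eventuallyEq ?_)
  have hmem : ∀ᶠ τ : ℝ in nhds 0, z + τ • (Pi.single (inr a) 1 : TIdx p → ℝ) ∈ U :=
    hl.continuousAt.eventually_mem (hU.mem_nhds (by rwa [h0]))
  filter_upwards [hmem] with τ hτ
  exact h _ hτ fun α => by simp

theorem pd_pow {ι : Type} [Fintype ι] [DecidableEq ι] {u : (ι → ℝ) → ℝ} {z : ι → ℝ}
    (hu : DifferentiableAt ℝ u z) (m : ℕ) (i : ι) :
    pd i (fun z => u z ^ m) z = m * u z ^ (m - 1) * pd i u z := by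
  simp [pd, fderiv_fun_pow m hu]

/-- The span of the functions (s¹)^m |s|^{−k} is stable under ∂/∂s¹, so iterated fibre derivatives
reduce to arithmetic on exponents. For m = 0 the truncated exponent `m - 1` is harmless, its
coefficient being zero. -/
theorem pd_inr_one_monomial {z : TIdx 2 → ℝ} (hz : z ∈ slitPlane) (m k : ℕ) :
    pd (inr 1) (fun z => z (inr 1) ^ m * (fiberNorm z)⁻¹ ^ k) z =
      m * (z (inr 1) ^ (m - 1) * (fiberNorm z)⁻¹ ^ k) -
        k * (z (inr 1) ^ (m + 1) * (fiberNorm z)⁻¹ ^ (k + 2)) := by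
  have h := differentiableAt_inv_fiberNorm hz
  rw [pd_mul (by fun_prop) (by fun_prop), pd_pow (by fun_prop), pd_pow h, pd_coord,
    pd_inv (differentiableAt_fiberNorm hz) (fiberNorm_pos hz).ne', pd_inr_fiberNorm hz]
  rcases k with _ | k
  · simp
  · simp only [Nat.add_sub_cancel, if_true]
    ring

theorem differentiableAt_monomial {z : TIdx 2 → ℝ} (hz : z ∈ slitPlane) (m k : ℕ) :
    DifferentiableAt ℝ (fun z => z (inr 1) ^ m * (fiberNorm z)⁻¹ ^ k) z := by
  have := differentiableAt_inv_fiberNorm hz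
  fun_prop

/-- P⁰₁₁₁ is the third derivative in s¹ of G⁰. On the fibres over t = 0 one has G⁰ = −(s¹)³/(4|s|),
and at s¹ = 0 only the cubic factor is differentiated, giving −6/(4|s|). Since only fibre
derivatives occur, knowing G⁰ over t = 0 is enough. -/
theorem berwaldP_randers {z : TIdx 2 → ℝ} (hz : z ∈ slitPlane) (h0 : ∀ α, z (inl α) = 0)
    (h1 : z (inr 1) = 0) : berwaldP randersFun 0 1 1 1 z = -(3 / 2) * (fiberNorm z)⁻¹ := by
  have hf := isLocalFinsler_randers
  have hm := fun {z : TIdx 2 → ℝ} (hz : z ∈ slitPlane) m k => differentiableAt_monomial hz m k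
  have e1 : ∀ z ∈ slitPlane, (∀ α, z (inl α) = 0) → pd (inr 1) (spray randersFun 0) z =
      -1 / 4 * (3 * (z (inr 1) ^ 2 * (fiberNorm z)⁻¹ ^ 1) -
        1 * (z (inr 1) ^ 4 * (fiberNorm z)⁻¹ ^ 3)) := by
    intro z hz h0
    rw [pd_inr_congr (v := fun z => -1 / 4 * (z (inr 1) ^ 3 * (fiberNorm z)⁻¹ ^ 1)) hf.isOpen hz
      (hf.differentiableAt (hf.contDiffOn_spray 0) hz) ((hm hz _ _).const_mul _) (fun z' hz' h' => by
        rw [spray_randers_zero hz' ((h' 0).trans (h0 0))]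
        simp
        ring), pd_const_mul (hm hz _ _), pd_inr_one_monomial hz]
    norm_num
  have e2 : ∀ z ∈ slitPlane, (∀ α, z (inl α) = 0) → berwald randersFun 0 1 1 z =
      -1 / 4 * (6 * (z (inr 1) ^ 1 * (fiberNorm z)⁻¹ ^ 1) - 7 * (z (inr 1) ^ 3 * (fiberNorm z)⁻¹ ^ 3)
        + 3 * (z (inr 1) ^ 5 * (fiberNorm z)⁻¹ ^ 5)) := by
    intro z hz h0
    rw [hf.berwald_eq_pd_pd_spray hz, pd_inr_congr hf.isOpen hz
      (hf.differentiableAt (hf.contDiffOn_pd (hf.contDiffOn_spray 0) _) hz)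
      ((((hm hz _ _).const_mul _).fun_sub ((hm hz _ _).const_mul _)).const_mul _)
      (fun z' hz' h' => e1 z' hz' fun α => (h' α).trans (h0 α)),
      pd_const_mul (((hm hz _ _).const_mul _).fun_sub ((hm hz _ _).const_mul _)),
      pd_sub ((hm hz _ _).const_mul _) ((hm hz _ _).const_mul _), pd_const_mul (hm hz _ _),
      pd_const_mul (hm hz _ _), pd_inr_one_monomial hz, pd_inr_one_monomial hz]
    norm_num
    ring
  have hd := (((hm hz 1 1).const_mul 6).fun_sub ((hm hz 3 3).const_mul 7)).fun_add
    ((hm hz 5 5).const_mul 3)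
  rw [berwaldP, pd_inr_congr hf.isOpen hz (hf.differentiableAt (hf.contDiffOn_berwald 0 1 1) hz)
    (hd.const_mul (-1 / 4)) (fun z' hz' h' => e2 z' hz' fun α => (h' α).trans (h0 α)),
    pd_const_mul hd, pd_add (((hm hz 1 1).const_mul 6).fun_sub ((hm hz 3 3).const_mul 7))
    ((hm hz 5 5).const_mul 3), pd_sub ((hm hz _ _).const_mul _) ((hm hz _ _).const_mul _),
    pd_const_mul (hm hz _ _), pd_const_mul (hm hz _ _), pd_const_mul (hm hz _ _),
    pd_inr_one_monomial hz, pd_inr_one_monomial hz, pd_inr_one_monomial hz, h1]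
  norm_num
  ring

namespace IsLocalFinsler

variable {p : ℕ} {f : (TIdx p → ℝ) → ℝ} {U : Set (TIdx p → ℝ)} {z : TIdx p → ℝ}

/-- The spray has degree two in s, because N = ∂G/∂s and N^γ_a s^a = 2G^γ; hence N has degree one.
-/
theorem sum_mul_berwald (hf : IsLocalFinsler f U) (hz : z ∈ U) (γ α : Fin p) :
    ∑ β, z (inr β) * berwald f γ α β z = nonlin f γ α z := by
  have h : ∀ z ∈ U, ∑ a, z (inr a) * pd (inr a) (spray f γ) z = 2 * spray f γ z := by
    intro z hz
    rw [← hf.sum_nonlin_mul hz]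
    exact Finset.sum_congr rfl fun a _ => by rw [hf.pd_spray hz, mul_comm]
  have h2 := hf.sum_mul_pd_pd (hf.contDiffOn_spray γ) h hz α
  simp only [← hf.berwald_eq_pd_pd_spray hz, hf.pd_spray hz] at h2
  rw [h2]
  ring

/-- B is the fibre derivative of a function of degree one, so it has degree zero. At s = (1, 0) this
forces every P with a lower index 0 to vanish. -/
theorem sum_mul_berwaldP (hf : IsLocalFinsler f U) (hz : z ∈ U) (γ α β : Fin p) :
    ∑ a, z (inr a) * berwaldP f γ α β a z = 0 := by
  have h : ∀ z ∈ U, ∑ a, z (inr a) * pd (inr a) (nonlin f γ α) z = 1 * nonlin f γ α z := by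
    intro z hz
    simp only [hf.pd_nonlin hz, hf.sum_mul_berwald hz, one_mul]
  have h2 := hf.sum_mul_pd_pd (hf.contDiffOn_nonlin γ α) h hz β
  rw [sub_self, zero_mul] at h2
  rw [← h2]
  exact Finset.sum_congr rfl fun a _ => by
    rw [berwaldP, pd_congr_of_eqOn hf.isOpen hz (fun _ hz => hf.pd_nonlin hz γ α β)]

/-- The curvature component of mixed type in terms of `P`. -/
theorem nonlinCov_curv (hf : IsLocalFinsler f U) (hz : z ∈ U) (d α β c : Fin p) :
    pd (inr c) (nonlinCov f d α β) z - pd (inl β) (berwald f d α c) z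
      + ∑ μ, berwald f μ α β z * berwald f d μ c z - ∑ e, berwald f e α c z * berwald f d e β z =
      ∑ e, nonlin f e α z * berwaldP f d e β c z - ∑ μ, nonlin f d μ z * berwaldP f μ α β c z := by
  have hN : ∀ a b, DifferentiableAt ℝ (nonlin f a b) z := fun _ _ =>
    hf.differentiableAt (hf.contDiffOn_nonlin _ _) hz
  have hB : ∀ a b c, DifferentiableAt ℝ (berwald f a b c) z := fun _ _ _ =>
    hf.differentiableAt (hf.contDiffOn_berwald _ _ _) hz
  have hd : DifferentiableAt ℝ (pd (inl β) (nonlin f d α)) z :=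
    hf.differentiableAt (hf.contDiffOn_pd (hf.contDiffOn_nonlin _ _) _) hz
  have h1 : pd (inr c) (pd (inl β) (nonlin f d α)) z = pd (inl β) (berwald f d α c) z := by
    rw [pd_comm hf.isOpen (hf.contDiffOn_nonlin _ _) hz]
    exact pd_congr_of_eqOn hf.isOpen hz (fun _ hz => hf.pd_nonlin hz d α c) _
  have h2 : ∀ e, pd (inr c) (fun z => nonlin f e α z * berwald f d e β z) z =
      berwald f e α c z * berwald f d e β z + nonlin f e α z * berwaldP f d e β c z := fun e => by
    rw [pd_mul (hN _ _) (hB _ _ _), hf.pd_nonlin hz, berwaldP]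
  have h3 : ∀ μ, pd (inr c) (fun z => nonlin f d μ z * berwald f μ α β z) z =
      berwald f d μ c z * berwald f μ α β z + nonlin f d μ z * berwaldP f μ α β c z := fun μ => by
    rw [pd_mul (hN _ _) (hB _ _ _), hf.pd_nonlin hz, berwaldP]
  have hs1 : DifferentiableAt ℝ (fun z => ∑ e, nonlin f e α z * berwald f d e β z) z :=
    DifferentiableAt.fun_sum fun _ _ => (hN _ _).fun_mul (hB _ _ _)
  have hs2 : DifferentiableAt ℝ (fun z => ∑ μ, nonlin f d μ z * berwald f μ α β z) z :=
    DifferentiableAt.fun_sum fun _ _ => (hN _ _).fun_mul (hB _ _ _)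
  unfold nonlinCov
  rw [pd_sub (hd.fun_add hs1) hs2, pd_add hd hs1, h1,
    pd_sum fun _ _ => (hN _ _).fun_mul (hB _ _ _), pd_sum fun _ _ => (hN _ _).fun_mul (hB _ _ _)]
  simp only [h2, h3, Finset.sum_add_distrib, mul_comm (berwald f d _ c z)]
  ring

end IsLocalFinsler

end RandersPlane

/-! ### Nonvanishing components of the Randers plane. -/

section RandersPlane

open Sum

open Kind in
/-- Types of components which do not vanish for the Randers plane. -/
def randersTypes : Finset (Kind × Kind × Kind × Kind) :=
  {(t, t, t, s), (s, t, t, s), (t, t, s, t), (s, t, s, t), (s, s, t, s), (s, s, s, t),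
    (x, x, t, x), (x, x, s, x), (x, x, x, y), (xt, xt, t, s), (xt, xt, s, t), (y, y, t, s),
    (y, y, s, t), (xt, xt, t, x), (xt, xt, s, x), (y, y, t, x), (y, y, s, x), (xt, xt, x, y),
    (y, y, x, y)}

/-- At s = (1, 0) the only lower indices of P that survive are 1, 1, 1, so each sum used collapses
to P⁰₁₁₁, possibly multiplied by N¹₀ or B¹₀₀. -/
theorem randers_jetCurv_ne_zero {q : Kind × Kind × Kind × Kind}
    (hq : q ∈ randersTypes) :
    ∃ d a b c : JIdx 2 2, (kind d, kind a, kind b, kind c) = q ∧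
      jetCurv randersFun randersFun d a b c (jetPoint (Pi.single 0 1)) ≠ 0 := by
  have hf := isLocalFinsler_randers
  set w : JIdx 2 2 → ℝ := jetPoint (Pi.single 0 1) with hw
  have hts : tgtPt w = srcPt w := by rw [hw, tgtPt_jetPoint, srcPt_jetPoint]
  have e0 : ∀ α : Fin 2, srcPt w (inl α) = 0 := fun α => by rw [hw, srcPt_jetPoint]; rfl
  have e1 : srcPt w (inr 0) = 1 := by rw [hw, srcPt_jetPoint]; rfl
  have e2 : srcPt w (inr 1) = 0 := by rw [hw, srcPt_jetPoint]; rfl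
  have hz : srcPt w ∈ slitPlane := by
    rw [mem_slitDomain_refl]
    exact fun h => one_ne_zero (e1.symm.trans (congrFun h 0))
  have hz' : tgtPt w ∈ slitPlane := hts ▸ hz
  have hr : fiberNorm (srcPt w) = 1 := by simp [fiberNorm, e1, e2]
  have hP : berwaldP randersFun 0 1 1 1 (srcPt w) ≠ 0 := by
    rw [berwaldP_randers hz e0 e2, hr]
    norm_num
  have hP0 : ∀ γ α β, berwaldP randersFun γ α β 0 (srcPt w) = 0 := fun γ α β => by
    simpa [e1, e2] using hf.sum_mul_berwaldP hz γ α β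
  have hP1 : ∀ γ α β, berwaldP randersFun γ α 0 β (srcPt w) = 0 := fun γ α β => by
    rw [hf.berwaldP_comm_right hz, hP0]
  have hP2 : ∀ γ α β, berwaldP randersFun γ 0 α β (srcPt w) = 0 := fun γ α β => by
    rw [hf.berwaldP_comm_left hz, hP1]
  -- At s = (1, 0), N¹_μ s^μ = 2G¹ reads N¹₀ = 2G¹ = 1/2.
  have hN : nonlin randersFun 1 0 (srcPt w) ≠ 0 := by
    have := hf.sum_nonlin_mul hz 1
    rw [spray_randers_zero hz (e0 0)] at this
    simp [e1, e2, hr] at this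
    rw [this]
    norm_num
  have hB : berwald randersFun 1 0 0 (srcPt w) ≠ 0 := by
    have := hf.sum_mul_berwald hz 1 0
    simp [e1, e2] at this
    rwa [this]
  have ht : jetCurv randersFun randersFun (jx 0) (jx 1) (jt 0) (jx 1) w ≠ 0 := by
    rw [jetCurv_jx_jx_jt_jx hf hf hz hz', hts]
    have hyi : ∀ a i : Fin 2, w (jy a i) = if a = i then 1 else 0 := fun _ _ => rfl
    have hs0 : w (js 0) = 1 := e1
    have hs1 : w (js 1) = 0 := e2
    simp [hP0, hyi, hs0, hs1, hP, hB]
  have hs : jetCurv randersFun randersFun (jx 0) (jx 1) (js 1) (jx 1) w ≠ 0 := by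
    rw [jetCurv_jx_jx_js_jx _ hf hz', hts]
    simpa [hP0, hw, jetPoint] using hP
  have hy : jetCurv randersFun randersFun (jx 0) (jx 1) (jx 1) (jy 0 1) w ≠ 0 := by
    rw [jetCurv_jx_jx_jx_jy _ hf hz', hts]
    simpa [hw, jetPoint] using hP
  have h4 : jetCurv randersFun randersFun (js 0) (jt 0) (jt 1) (js 1) w ≠ 0 := by
    -- After `nonlinCov_curv` only the product N¹₀ P⁰₁₁₁ is left.
    rw [hf.jetCurv_stts hz, hf.nonlinCov_curv hz]
    simp [hP2, hP, hN]
  fin_cases hq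
  · refine ⟨jt 0, jt 1, jt 1, js 1, rfl, ?_⟩
    rwa [hf.jetCurv_ttts hz]
  · exact ⟨js 0, jt 0, jt 1, js 1, rfl, h4⟩
  · refine ⟨jt 0, jt 1, js 1, jt 1, rfl, ?_⟩
    rw [hf.jetCurv_ttst hz]
    exact neg_ne_zero.2 hP
  · refine ⟨js 0, jt 0, js 1, jt 1, rfl, ?_⟩
    rw [jetCurv_swap]
    exact neg_ne_zero.2 h4
  · refine ⟨js 0, js 1, jt 1, js 1, rfl, ?_⟩
    rwa [hf.jetCurv_ssts hz]
  · refine ⟨js 0, js 1, js 1, jt 1, rfl, ?_⟩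
    rw [hf.jetCurv_ssst hz]
    exact neg_ne_zero.2 hP
  · exact ⟨jx 0, jx 1, jt 0, jx 1, rfl, ht⟩
  · exact ⟨jx 0, jx 1, js 1, jx 1, rfl, hs⟩
  · exact ⟨jx 0, jx 1, jx 1, jy 0 1, rfl, hy⟩
  · refine ⟨jxt 1 0, jxt 0 0, jt 1, js 1, rfl, ?_⟩
    rw [hf.jetCurv_jX_ttts hz]
    simpa using hP
  · refine ⟨jxt 1 0, jxt 0 0, js 1, jt 1, rfl, ?_⟩
    rw [hf.jetCurv_jX_ttst hz]
    simpa using hP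
  · refine ⟨jy 1 0, jy 0 0, jt 1, js 1, rfl, ?_⟩
    rw [hf.jetCurv_jX_ssts hz]
    simpa using hP
  · refine ⟨jy 1 0, jy 0 0, js 1, jt 1, rfl, ?_⟩
    rw [hf.jetCurv_jX_ssst hz]
    simpa using hP
  · refine ⟨jxt 0 0, jxt 0 1, jt 0, jx 1, rfl, ?_⟩
    rw [hf.jetCurv_jX_jT_jx hz]
    simpa using ht
  · refine ⟨jxt 0 0, jxt 0 1, js 1, jx 1, rfl, ?_⟩
    rw [hf.jetCurv_jX_jT_jx hz]
    simpa using hs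
  · refine ⟨jy 0 0, jy 0 1, jt 0, jx 1, rfl, ?_⟩
    rw [hf.jetCurv_jX_jT_jx hz]
    simpa using ht
  · refine ⟨jy 0 0, jy 0 1, js 1, jx 1, rfl, ?_⟩
    rw [hf.jetCurv_jX_jT_jx hz]
    simpa using hs
  · refine ⟨jxt 0 0, jxt 0 1, jx 1, jy 0 1, rfl, ?_⟩
    rw [jetCurv_jX_jX_jx_jX]
    simpa using hy
  · refine ⟨jy 0 0, jy 0 1, jx 1, jy 0 1, rfl, ?_⟩
    rw [jetCurv_jX_jX_jx_jX]
    simpa using hy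

end RandersPlane

end JetBerwald

end

/-! ### The main theorem. -/

theorem mainTheorem8 :
    -- the formulas (C1)-(C30), and the vanishing of all the other components
    (∀ (p n : ℕ)
      (M : Type*) [TopologicalSpace M] [ChartedSpace (EuclideanSpace ℝ (Fin p)) M]
      [IsManifold (𝓡 p) ∞ M]
      (N : Type*) [TopologicalSpace N] [ChartedSpace (EuclideanSpace ℝ (Fin n)) N]
      [IsManifold (𝓡 n) ∞ N]
      (F : FinslerStructure p M) (F' : FinslerStructure n N)
      (φ : OpenPartialHomeomorph M (EuclideanSpace ℝ (Fin p)))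
      (ψ : OpenPartialHomeomorph N (EuclideanSpace ℝ (Fin n))),
      φ ∈ IsManifold.maximalAtlas (𝓡 p) ∞ M → ψ ∈ IsManifold.maximalAtlas (𝓡 n) ∞ N →
      ∀ w ∈ jetDomain φ ψ,
      let R := fun d a b c : JIdx p n => jetCurv (F.inChart φ) (F'.inChart ψ) d a b c w
      -- the source objects, at `(t, s)`
      let z := srcPt w
      let s := fun a : Fin p => w (js a)
      let dt := fun (α : Fin p) (u : (TIdx p → ℝ) → ℝ) => pd (Sum.inl α) u z
      let ds := fun (a : Fin p) (u : (TIdx p → ℝ) → ℝ) => pd (Sum.inr a) u z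
      let Nn := fun b α : Fin p => nonlin (F.inChart φ) b α z
      let Nc := fun c α β : Fin p => nonlinCov (F.inChart φ) c α β
      let B := fun γ α β : Fin p => berwald (F.inChart φ) γ α β
      let Rb := fun δ α β γ : Fin p => berwaldR (F.inChart φ) δ α β γ z
      let Pb := fun δ α β γ : Fin p => berwaldP (F.inChart φ) δ α β γ z
      -- the target objects, at `(x^l, y^l_a s^a)`
      let y := fun (a : Fin p) (i : Fin n) => w (jy a i)
      let Nt := fun r k : Fin n => nonlin (F'.inChart ψ) r k (tgtPt w)
      let Bt := fun l i j : Fin n => berwald (F'.inChart ψ) l i j (tgtPt w)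
      let Rt := fun l i j k : Fin n => berwaldR (F'.inChart ψ) l i j k (tgtPt w)
      let Pt := fun l i j k : Fin n => berwaldP (F'.inChart ψ) l i j k (tgtPt w)
      -- (C1)
      (∀ δ α β γ, R (jt δ) (jt α) (jt β) (jt γ) =
        Rb δ α β γ + ∑ c, Pb δ α β c * Nn c γ - ∑ c, Pb δ α γ c * Nn c β) ∧
      -- (C2)
      (∀ d α β γ, R (js d) (jt α) (jt β) (jt γ) =
        alt (fun β γ => dt γ (Nc d α β) + ∑ c, Nc c α β z * B d c γ z
          - ∑ μ, Nc d μ β z * B μ α γ z) β γ) ∧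
      -- (C3)
      (∀ δ α β c, R (jt δ) (jt α) (jt β) (js c) = Pb δ α β c) ∧
      -- (C4)
      (∀ d α β c, R (js d) (jt α) (jt β) (js c) =
        ds c (Nc d α β) - dt β (B d α c) + ∑ μ, B μ α β z * B d μ c z
          - ∑ e, B e α c z * B d e β z) ∧
      -- (C5)
      (∀ δ α b γ, R (jt δ) (jt α) (js b) (jt γ) = -Pb δ α b γ) ∧
      -- (C6)
      (∀ d α b γ, R (js d) (jt α) (js b) (jt γ) =
        dt γ (B d α b) - ds b (Nc d α γ) + ∑ c, B c α b z * B d c γ z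
          - ∑ μ, B μ α γ z * B d μ b z) ∧
      -- (C7)
      (∀ d a β γ, R (js d) (js a) (jt β) (jt γ) =
        Rb d a β γ + ∑ c, Pb d a β c * Nn c γ - ∑ c, Pb d a γ c * Nn c β) ∧
      -- (C8)
      (∀ d a β c, R (js d) (js a) (jt β) (js c) = Pb d a β c) ∧
      -- (C9)
      (∀ d a b γ, R (js d) (js a) (js b) (jt γ) = -Pb d a b γ) ∧
      -- (C10)
      (∀ l i β k, R (jx l) (jx i) (jt β) (jx k) =
        -∑ j, ∑ a, ∑ c, Pt l i k j * B c β a z * s a * y c j) ∧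
      -- (C11)
      (∀ l i b k, R (jx l) (jx i) (js b) (jx k) = -∑ j, Pt l i k j * y b j) ∧
      -- (C12)
      (∀ l i j k, R (jx l) (jx i) (jx j) (jx k) =
        Rt l i j k + ∑ r, Pt l i j r * Nt r k - ∑ r, Pt l i k r * Nt r j
          + ∑ p', ∑ b, (∑ r, Pt l i k r * Bt r j p' - ∑ r, Pt l i j r * Bt r k p')
              * y b p' * s b) ∧
      -- (C13)
      (∀ l i j k c, R (jx l) (jx i) (jx j) (jy c k) = Pt l i j k * s c) ∧
      -- (C14)
      (∀ ε l α i β γ,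
        R (jxt ε l) (jxt α i) (jt β) (jt γ) =
          -(if l = i then 1 else 0) *
            (Rb α ε β γ + ∑ c, Pb α ε β c * Nn c γ - ∑ c, Pb α ε γ c * Nn c β) ∧
        R (jxt ε l) (jxt α i) (jt β) (jt γ) =
          -(if l = i then 1 else 0) * R (jt α) (jt ε) (jt β) (jt γ)) ∧
      -- (C15)
      (∀ ε l α i β c,
        R (jxt ε l) (jxt α i) (jt β) (js c) = -(if l = i then 1 else 0) * Pb α ε β c ∧
        R (jxt ε l) (jxt α i) (jt β) (js c) =
          -(if l = i then 1 else 0) * R (jt α) (jt ε) (jt β) (js c)) ∧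
      -- (C16)
      (∀ ε l α i b γ,
        R (jxt ε l) (jxt α i) (js b) (jt γ) = (if l = i then 1 else 0) * Pb α ε b γ ∧
        R (jxt ε l) (jxt α i) (js b) (jt γ) =
          -(if l = i then 1 else 0) * R (jt α) (jt ε) (js b) (jt γ)) ∧
      -- (C17)
      (∀ ε l a i β γ, R (jxt ε l) (jy a i) (jt β) (jt γ) =
        -(if l = i then 1 else 0) *
          alt (fun β γ => dt γ (Nc a β ε) + ∑ c, Nc c β ε z * B a c γ z
            - ∑ μ, Nc a β μ z * B μ ε γ z) β γ) ∧
      -- (C18)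
      (∀ ε l a i β c, R (jxt ε l) (jy a i) (jt β) (js c) =
        -(if l = i then 1 else 0) *
          (ds c (Nc a β ε) - dt β (B a c ε) + ∑ μ, B μ β ε z * B a μ c z
            - ∑ d, B d c ε z * B a d β z)) ∧
      -- (C19)
      (∀ ε l a i b γ, R (jxt ε l) (jy a i) (js b) (jt γ) =
        -(if l = i then 1 else 0) *
          (dt γ (B a b ε) - ds b (Nc a γ ε) + ∑ c, B c b ε z * B a c γ z
            - ∑ μ, B μ γ ε z * B a μ b z)) ∧
      -- (C20)
      (∀ d l a i β γ,
        R (jy d l) (jy a i) (jt β) (jt γ) =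
          -(if l = i then 1 else 0) *
            (Rb a d β γ + ∑ c, Pb a d β c * Nn c γ - ∑ c, Pb a d γ c * Nn c β) ∧
        R (jy d l) (jy a i) (jt β) (jt γ) =
          -(if l = i then 1 else 0) * R (js a) (js d) (jt β) (jt γ)) ∧
      -- (C21)
      (∀ d l a i β c,
        R (jy d l) (jy a i) (jt β) (js c) = -(if l = i then 1 else 0) * Pb a d β c ∧
        R (jy d l) (jy a i) (jt β) (js c) =
          -(if l = i then 1 else 0) * R (js a) (js d) (jt β) (js c)) ∧
      -- (C22)
      (∀ d l a i b γ,
        R (jy d l) (jy a i) (js b) (jt γ) = (if l = i then 1 else 0) * Pb a d b γ ∧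
        R (jy d l) (jy a i) (js b) (jt γ) =
          -(if l = i then 1 else 0) * R (js a) (js d) (js b) (jt γ)) ∧
      -- (C23)
      (∀ ε l α i β k,
        R (jxt ε l) (jxt α i) (jt β) (jx k) =
          -(if α = ε then 1 else 0) * ∑ j, ∑ b, ∑ c, Pt l i k j * B c β b z * s b * y c j ∧
        R (jxt ε l) (jxt α i) (jt β) (jx k) =
          (if α = ε then 1 else 0) * R (jx l) (jx i) (jt β) (jx k)) ∧
      -- (C24)
      (∀ ε l α i b k,
        R (jxt ε l) (jxt α i) (js b) (jx k) =
          -(if α = ε then 1 else 0) * ∑ j, Pt l i k j * y b j ∧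
        R (jxt ε l) (jxt α i) (js b) (jx k) =
          (if α = ε then 1 else 0) * R (jx l) (jx i) (js b) (jx k)) ∧
      -- (C25)
      (∀ d l a i β k,
        R (jy d l) (jy a i) (jt β) (jx k) =
          -(if a = d then 1 else 0) * ∑ j, ∑ b, ∑ c, Pt l i k j * B c β b z * s b * y c j ∧
        R (jy d l) (jy a i) (jt β) (jx k) =
          (if a = d then 1 else 0) * R (jx l) (jx i) (jt β) (jx k)) ∧
      -- (C26)
      (∀ d l a i b k,
        R (jy d l) (jy a i) (js b) (jx k) =
          -(if a = d then 1 else 0) * ∑ j, Pt l i k j * y b j ∧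
        R (jy d l) (jy a i) (js b) (jx k) =
          (if a = d then 1 else 0) * R (jx l) (jx i) (js b) (jx k)) ∧
      -- (C27)
      (∀ ε l α i j k, R (jxt ε l) (jxt α i) (jx j) (jx k) =
        (if α = ε then 1 else 0) * R (jx l) (jx i) (jx j) (jx k)) ∧
      -- (C28)
      (∀ d l a i j k, R (jy d l) (jy a i) (jx j) (jx k) =
        (if a = d then 1 else 0) * R (jx l) (jx i) (jx j) (jx k)) ∧
      -- (C29)
      (∀ ε l α i j k c,
        R (jxt ε l) (jxt α i) (jx j) (jy c k) = (if α = ε then 1 else 0) * (Pt l i j k * s c) ∧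
        R (jxt ε l) (jxt α i) (jx j) (jy c k) =
          (if α = ε then 1 else 0) * R (jx l) (jx i) (jx j) (jy c k)) ∧
      -- (C30)
      (∀ d l a i j k c,
        R (jy d l) (jy a i) (jx j) (jy c k) = (if a = d then 1 else 0) * (Pt l i j k * s c) ∧
        R (jy d l) (jy a i) (jx j) (jy c k) =
          (if a = d then 1 else 0) * R (jx l) (jx i) (jx j) (jy c k)) ∧
      -- all the other adapted components vanish
      (∀ d a b c, (kind d, kind a, kind b, kind c) ∉ curvTypes →
        (kind d, kind a, kind c, kind b) ∉ curvTypes → R d a b c = 0)) ∧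
    -- there are thirty types of components in the list, and none of them vanishes identically
    curvTypes.card = 30 ∧
    (∀ q ∈ curvTypes, ∃ (p n : ℕ)
      (M : Type) (_ : TopologicalSpace M) (_ : ChartedSpace (EuclideanSpace ℝ (Fin p)) M)
      (_ : IsManifold (𝓡 p) ∞ M)
      (N : Type) (_ : TopologicalSpace N) (_ : ChartedSpace (EuclideanSpace ℝ (Fin n)) N)
      (_ : IsManifold (𝓡 n) ∞ N)
      (F : FinslerStructure p M) (F' : FinslerStructure n N)
      (φ : OpenPartialHomeomorph M (EuclideanSpace ℝ (Fin p)))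
      (ψ : OpenPartialHomeomorph N (EuclideanSpace ℝ (Fin n))),
      φ ∈ IsManifold.maximalAtlas (𝓡 p) ∞ M ∧ ψ ∈ IsManifold.maximalAtlas (𝓡 n) ∞ N ∧
      ∃ w ∈ jetDomain φ ψ, ∃ d a b c : JIdx p n, (kind d, kind a, kind b, kind c) = q ∧
        jetCurv (F.inChart φ) (F'.inChart ψ) d a b c w ≠ 0) := by
  refine ⟨?_, rfl, ?_⟩
  · intro p n M _ _ _ N _ _ _ F F' φ ψ hφ hψ w hw
    have hf := F.isLocalFinsler hφ
    have hh := F'.isLocalFinsler hψ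
    have hz : srcPt w ∈ slitDomain φ := ⟨hw.1, hw.2.1⟩
    have hz' : tgtPt w ∈ slitDomain ψ := ⟨hw.2.2.1, hw.2.2.2⟩
    -- From here only the local Finsler properties of the two functions are used; manifolds and
    -- charts can be forgotten.
    generalize F.inChart φ = f at hf ⊢
    generalize F'.inChart ψ = h at hh ⊢
    dsimp only
    refine ⟨hf.jetCurv_tttt hz h, hf.jetCurv_sttt hz h, hf.jetCurv_ttts hz h, hf.jetCurv_stts hz h,
      hf.jetCurv_ttst hz h, hf.jetCurv_stst hz h, hf.jetCurv_sstt hz h, hf.jetCurv_ssts hz h,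
      hf.jetCurv_ssst hz h, fun l i β k => jetCurv_jx_jx_jt_jx hf hh hz hz' l i k β,
      fun l i b k => jetCurv_jx_jx_js_jx f hh hz' l i k b, jetCurv_jx f hh hz',
      jetCurv_jx_jx_jx_jy f hh hz', ?_, ?_, ?_, hf.jetCurv_jX_tstt hz h, hf.jetCurv_jX_tsts hz h,
      hf.jetCurv_jX_tsst hz h, ?_, ?_, ?_, ?_, ?_, ?_, ?_, ?_, ?_, ?_, ?_,
      jetCurv_eq_zero hf hh hz hz'⟩
    · intro ε l α i β γ
      rw [hf.jetCurv_jX_tttt hz, hf.jetCurv_tttt hz]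
      exact ⟨rfl, rfl⟩
    · intro ε l α i β c
      rw [hf.jetCurv_jX_ttts hz, hf.jetCurv_ttts hz]
      exact ⟨rfl, rfl⟩
    · intro ε l α i b γ
      rw [hf.jetCurv_jX_ttst hz, hf.jetCurv_ttst hz]
      exact ⟨rfl, (neg_mul_neg _ _).symm⟩
    · intro d l a i β γ
      rw [hf.jetCurv_jX_sstt hz, hf.jetCurv_sstt hz]
      exact ⟨rfl, rfl⟩
    · intro d l a i β c
      rw [hf.jetCurv_jX_ssts hz, hf.jetCurv_ssts hz]
      exact ⟨rfl, rfl⟩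
    · intro d l a i b γ
      rw [hf.jetCurv_jX_ssst hz, hf.jetCurv_ssst hz]
      exact ⟨rfl, (neg_mul_neg _ _).symm⟩
    · intro ε l α i β k
      rw [hf.jetCurv_jX_jT_jx hz, jetCurv_jx_jx_jt_jx hf hh hz hz']
      simp only [Sum.inl.injEq, neg_mul, mul_neg, and_self]
    · intro ε l α i b k
      rw [hf.jetCurv_jX_jT_jx hz, jetCurv_jx_jx_js_jx f hh hz']
      simp only [Sum.inl.injEq, neg_mul, mul_neg, and_self]
    · intro d l a i β k
      rw [hf.jetCurv_jX_jT_jx hz, jetCurv_jx_jx_jt_jx hf hh hz hz']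
      simp only [Sum.inr.injEq, neg_mul, mul_neg, and_self]
    · intro d l a i b k
      rw [hf.jetCurv_jX_jT_jx hz, jetCurv_jx_jx_js_jx f hh hz']
      simp only [Sum.inr.injEq, neg_mul, mul_neg, and_self]
    · intro ε l α i j k
      rw [jetCurv_jX_jX_jx_jx]
      simp only [Sum.inl.injEq]
    · intro d l a i j k
      rw [jetCurv_jX_jX_jx_jx]
      simp only [Sum.inr.injEq]
    · intro ε l α i j k c
      rw [jetCurv_jX_jX_jx_jX, jetCurv_jx_jx_jx_jy f hh hz']
      simp only [Sum.inl.injEq, and_self]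
    · intro d l a i j k c
      rw [jetCurv_jX_jX_jx_jX, jetCurv_jx_jx_jx_jy f hh hz']
      simp only [Sum.inr.injEq, and_self]
  · intro q hq
    -- The two examples together exhaust the thirty types, which is a finite check.
    have hq' : q ∈ hyperbolicTypes ∨ q ∈ randersTypes := by
      revert q
      decide
    rcases hq' with hq' | hq'
    · refine ⟨2, 2, EuclideanSpace ℝ (Fin 2), inferInstance, inferInstance, inferInstance,
        EuclideanSpace ℝ (Fin 2), inferInstance, inferInstance, inferInstance, hyperbolic,
        hyperbolic, _, _, refl_mem_maximalAtlas, refl_mem_maximalAtlas, jetPoint fun _ => 1,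
        jetPoint_mem_jetDomain fun h => one_ne_zero (congrFun h 0), ?_⟩
      exact hyperbolic_jetCurv_ne_zero hq'
    · refine ⟨2, 2, EuclideanSpace ℝ (Fin 2), inferInstance, inferInstance, inferInstance,
        EuclideanSpace ℝ (Fin 2), inferInstance, inferInstance, inferInstance, randers, randers,
        _, _, refl_mem_maximalAtlas, refl_mem_maximalAtlas, jetPoint (Pi.single 0 1),
        jetPoint_mem_jetDomain (by simp), ?_⟩
      exact randers_jetCurv_ne_zero hq'
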